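/- **Setting.** Let $k\in\mathbb N$ and let $n_1,\dots,n_k,m_1,\dots,m_k$ be positive integers, $\mathbf m=(m_1,\dots,m_k)$. Let $\mathbb F_{n_i}^+$ be the free monoid on $g^i_1,\dots,g^i_{n_i}$ with identity $g^i_0$. For each $i$ let $f_i=\sum_{\alpha\in\mathbb F_{n_i}^+}a_{i,\alpha}Z_{i,\alpha}$ be a positive regular free holomorphic function, i.e. $a_{i,\alpha}\ge 0$, $a_{i,g_0^i}=0$, $a_{i,g_j^i}>0$ and $\limsup_{p\to\infty}\big(\sum_{|\alpha|=p}|a_{i,\alpha}|^2\big)^{1/2p}<\infty$; put $\mathbf f=(f_1,\dots,f_k)$. Put $b^{(m_i)}_{i,g^i_0}=1$ and, for $|\alpha|\ge 1$, $$b^{(m_i)}_{i,\alpha}=\sum_{p=1}^{|\alpha|}\ \sum_{\gamma_1\cdots\gamma_p=\alpha,\ |\gamma_l|\ge 1}a_{i,\gamma_1}\cdots a_{i,\gamma_p}\binom{p+m_i-1}{m_i-1}.$$ Let $F^2(H_{n_i})$ be the full Fock space with orthonormal basis $\{e^i_\alpha\}_{\alpha\in\mathbb F^+_{n_i}}$,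 let $W_{i,j}e^i_\alpha=\sqrt{b^{(m_i)}_{i,\alpha}/b^{(m_i)}_{i,g^i_j\alpha}}\;e^i_{g^i_j\alpha}$, and let $\mathbf W_{i,j}=I\otimes\cdots\otimes W_{i,j}\otimes\cdots\otimes I$ (with $W_{i,j}$ in position $i$) on $\bigotimes_{i=1}^kF^2(H_{n_i})$. For a tuple $\mathbf X=\{X_{i,j}\}$ of operators and $(\alpha)=(\alpha_1,\dots,\alpha_k)\in\mathbb F_{n_1}^+\times\cdots\times\mathbb F_{n_k}^+$ write $X_{(\alpha)}=X_{1,\alpha_1}\cdots X_{k,\alpha_k}$. Let $\mathcal Q$ be an arbitrary set of polynomials in noncommuting indeterminates $Z_{i,j}$ ($1\le i\le k$, $1\le j\le n_i$), where $Z_{s,j}$ and $Z_{t,l}$ commute whenever $s\neq t$. Let $$\mathcal M_{\mathcal Q}=\overline{\operatorname{span}}\{\mathbf W_{(\alpha)}q(\mathbf W)\mathbf W_{(\beta)}(\mathbb C):\ q\in\mathcal Q\},\qquad \mathcal N_{\mathcal Q}=\Big(\bigotimes_iF^2(H_{n_i})\Big)\ominus\mathcal M_{\mathcal Q},$$ where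 $\mathbb C$ denotes the span of the vacuum vector; assume $\mathcal N_{\mathcal Q}\ne\{0\}$ and let $\mathbf S_{i,j}=P_{\mathcal N_{\mathcal Q}}\mathbf W_{i,j}|_{\mathcal N_{\mathcal Q}}$. Let $$\mathcal S^{w^*}=\overline{\operatorname{span}}^{\,w^*}\{\mathbf S_{(\alpha)}\mathbf S_{(\beta)}^*\}\subset B(\mathcal N_{\mathcal Q}).$$ Let $\mathcal H$ be a complex Hilbert space and $\mathbf A=\{A_{i,j}\}$ ($A_{i,j}\in B(\mathcal H)$) be such that $A_{s,j}A_{t,l}=A_{t,l}A_{s,j}$ for $s\ne t$, $\sum_\alpha a_{i,\alpha}A_{i,\alpha}A_{i,\alpha}^*$ converges in the weak operator topology for each $i$, and $q(\mathbf A)=0$ for all $q\in\mathcal Q$. Let $\Phi_i(X)=\sum_{\alpha}a_{i,\alpha}A_{i,\alpha}XA_{i,\alpha}^*$ (WOT convergence) and $\mathbf\Delta^{\mathbf p}_{\mathbf f,\mathbf A}=(\mathrm{id}-\Phi_1)^{p_1}\circ\cdots\circ(\mathrm{id}-\Phi_k)^{p_k}$. Let $C^{pure}_{\ge}(\mathbf\Delta^{\mathbf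 m}_{\mathbf f,\mathbf A})^+$ be the set of all $X\ge 0$ in $B(\mathcal H)$ such that $\mathbf\Delta^{\mathbf p}_{\mathbf f,\mathbf A}(X)\ge 0$ for all $0\le\mathbf p\le\mathbf m$, $\mathbf p\ne 0$, and $\Phi_i^s(X)\to 0$ weakly as $s\to\infty$ for each $i$. Let $CP^{w^*}(\mathbf A,\mathcal V_{\mathcal Q})$ be the set of all $w^*$-continuous completely positive linear maps $\varphi:\mathcal S^{w^*}\to B(\mathcal H)$ with $$\varphi(\mathbf S_{(\alpha)}\mathbf S_{(\beta)}^*)=A_{(\alpha)}\varphi(I)A_{(\beta)}^*\qquad\text{for all }(\alpha),(\beta).$$ **Theorem.** The map $\Gamma(\varphi)=\varphi(I)$ is a bijection from $CP^{w^*}(\mathbf A,\mathcal V_{\mathcal Q})$ onto $C^{pure}_{\ge}(\mathbf\Delta^{\mathbf m}_{\mathbf f,\mathbf A})^+$. Moreover, let $D\in C^{pure}_{\ge}(\mathbf\Delta^{\mathbf m}_{\mathbf f,\mathbf A})^+$ and $R=\mathbf\Delta^{\mathbf m}_{\mathbf f,\mathbf A}(D)$. Then $(\mathbf f,\mathbf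 m,\mathbf A,R,\mathcal Q)$ is compatible, i.e. (in addition to the hypotheses on $\mathbf A$) $R\ge 0$ and the WOT-convergent series $$\sum_{(s_1,\dots,s_k)\in\mathbb Z_+^k}\binom{s_1+m_1-1}{m_1-1}\cdots\binom{s_k+m_k-1}{m_k-1}\,\Phi_1^{s_1}\circ\cdots\circ\Phi_k^{s_k}(R)$$ is $\le bI$ for some $b>0$; the generalized Berezin kernel $$\mathbf K h=\sum_{\beta_1,\dots,\beta_k}\sqrt{b^{(m_1)}_{1,\beta_1}}\cdots\sqrt{b^{(m_k)}_{k,\beta_k}}\;e^1_{\beta_1}\otimes\cdots\otimes e^k_{\beta_k}\otimes R^{1/2}A_{1,\beta_1}^*\cdots A_{k,\beta_k}^*h$$ is a well-defined bounded operator $\mathcal H\to\bigotimes_iF^2(H_{n_i})\otimes\overline{R^{1/2}\mathcal H}$; and, with $\mathbf K_\omega=(P_{\mathcal N_{\mathcal Q}}\otimes I)\mathbf K$, the map $\Gamma^{-1}(D)$ is the constrained noncommutative Berezin transform $$\Gamma^{-1}(D)[\chi]=\mathbf K_\omega^*(\chi\otimes I)\mathbf K_\omega,\qquad\chi\in\mathcal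 S^{w^*}.$$ -/

import Mathlib

open Filter
open scoped ComplexOrder InnerProductSpace TensorProduct Topology

noncomputable section

namespace Polydomain

/-! ### Positive regular free holomorphic functions and the coefficients `b` -/

/-- A positive regular free holomorphic function in `n` noncommuting indeterminates,
`f = ∑ a_α Z_α`, given by its coefficients `a_α`, `α` in the free monoid on `n` generators. -/
structure PosRegular (n : ℕ) where
  coeff : FreeMonoid (Fin n) → ℝ
  coeff_nonneg : ∀ α, 0 ≤ coeff α
  coeff_one : coeff 1 = 0
  coeff_of_pos : ∀ j, 0 < coeff (FreeMonoid.of j)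
  limsup_lt_top :
    limsup (fun p : ℕ => ENNReal.ofReal
      ((∑ v : List.Vector (Fin n) p, |coeff (FreeMonoid.ofList v.toList)| ^ 2)
        ^ (1 / (2 * (p : ℝ))))) atTop < ⊤

/-- The coefficient `b_α^{(m)}`: the sum over all factorizations `α = γ₁ ⋯ γ_p` into nonempty
words of `a_{γ₁} ⋯ a_{γ_p} * C(p + m - 1, m - 1)`. The factorizations are indexed by the
compositions of the length of `α`; for the empty word there is only the empty one (`p = 0`). -/
def bCoeff {n : ℕ} (f : PosRegular n) (m : ℕ) (α : FreeMonoid (Fin n)) : ℝ :=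
  ∑ c : Composition (FreeMonoid.toList α).length,
    (((FreeMonoid.toList α).splitWrtComposition c).map
        (fun γ => f.coeff (FreeMonoid.ofList γ))).prod
      * ((c.length + m - 1).choose (m - 1) : ℝ)

theorem bCoeff_one {n : ℕ} (f : PosRegular n) (m : ℕ) : bCoeff f m 1 = 1 := by
  have h : ∀ c : Composition (FreeMonoid.toList (1 : FreeMonoid (Fin n))).length,
      ((((FreeMonoid.toList (1 : FreeMonoid (Fin n))).splitWrtComposition c).map
        (fun γ => f.coeff (FreeMonoid.ofList γ))).prod
      * ((c.length + m - 1).choose (m - 1) : ℝ)) = 1 := by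
    intro c
    have hb : c.blocks = [] := by
      have hs : c.blocks.sum = 0 := c.blocks_sum
      rcases hc : c.blocks with _ | ⟨a, l⟩
      · rfl
      · have hp : 0 < a := c.blocks_pos (by simp [hc])
        rw [hc] at hs
        simp at hs
        omega
    simp [List.splitWrtComposition, List.splitWrtCompositionAux, Composition.length, hb]
  unfold bCoeff
  rw [Finset.sum_congr rfl (fun c _ => h c)]
  have : Fintype.card (Composition (FreeMonoid.toList (1 : FreeMonoid (Fin n))).length) = 1 := by
    rw [composition_card]; simp
  rw [Finset.sum_const, Finset.card_univ, this, one_smul]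

theorem bCoeff_nonneg {n : ℕ} (f : PosRegular n) (m : ℕ) (α : FreeMonoid (Fin n)) :
    0 ≤ bCoeff f m α := by
  unfold bCoeff
  refine Finset.sum_nonneg fun c _ => mul_nonneg (List.prod_nonneg ?_) (Nat.cast_nonneg _)
  intro x hx
  obtain ⟨γ, -, rfl⟩ := List.mem_map.1 hx
  exact f.coeff_nonneg _

/-- `a_{g_j} b_α ≤ b_{g_j α}`: this makes the weighted left creation operators bounded. -/
theorem coeff_mul_bCoeff_le {n : ℕ} (f : PosRegular n) (m : ℕ) (j : Fin n)
    (α : FreeMonoid (Fin n)) :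
    f.coeff (FreeMonoid.of j) * bCoeff f m α ≤ bCoeff f m (FreeMonoid.of j * α) := by
  unfold bCoeff
  rw [Finset.mul_sum]
  let e : Composition (FreeMonoid.toList α).length →
      Composition (FreeMonoid.toList (FreeMonoid.of j * α)).length := fun c =>
    { blocks := 1 :: c.blocks
      blocks_pos := by
        intro i hi
        rcases List.mem_cons.1 hi with rfl | h
        · exact Nat.one_pos
        · exact c.blocks_pos h
      blocks_sum := by
        have := c.blocks_sum
        simp [FreeMonoid.toList_mul, this, add_comm] }
  have he : Function.Injective e := by
    intro c d h
    have : (e c).blocks = (e d).blocks := by rw [h]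
    exact Composition.ext (List.cons.inj this).2
  have key : ∀ c : Composition (FreeMonoid.toList α).length,
      f.coeff (FreeMonoid.of j) * ((((FreeMonoid.toList α).splitWrtComposition c).map
        (fun γ => f.coeff (FreeMonoid.ofList γ))).prod
        * ((c.length + m - 1).choose (m - 1) : ℝ)) ≤
      (((FreeMonoid.toList (FreeMonoid.of j * α)).splitWrtComposition (e c)).map
        (fun γ => f.coeff (FreeMonoid.ofList γ))).prod
        * (((e c).length + m - 1).choose (m - 1) : ℝ) := by
    intro c
    have h1 : (FreeMonoid.toList (FreeMonoid.of j * α)).splitWrtComposition (e c)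
        = [j] :: (FreeMonoid.toList α).splitWrtComposition c := by
      simp [List.splitWrtComposition, e, List.splitWrtCompositionAux, FreeMonoid.toList_mul]
    have h2 : (e c).length = c.length + 1 := by simp [Composition.length, e]
    rw [h1, h2, List.map_cons, List.prod_cons, FreeMonoid.ofList_singleton, mul_assoc]
    refine mul_le_mul_of_nonneg_left ?_ (f.coeff_nonneg _)
    refine mul_le_mul_of_nonneg_left ?_ (List.prod_nonneg ?_)
    · exact_mod_cast Nat.choose_le_choose _ (by omega)
    · intro x hx
      obtain ⟨γ, -, rfl⟩ := List.mem_map.1 hx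
      exact f.coeff_nonneg _
  calc _ ≤ ∑ c, (((FreeMonoid.toList (FreeMonoid.of j * α)).splitWrtComposition (e c)).map
        (fun γ => f.coeff (FreeMonoid.ofList γ))).prod
        * (((e c).length + m - 1).choose (m - 1) : ℝ) := Finset.sum_le_sum fun c _ => key c
    _ = ∑ d ∈ Finset.univ.image e,
        (((FreeMonoid.toList (FreeMonoid.of j * α)).splitWrtComposition d).map
        (fun γ => f.coeff (FreeMonoid.ofList γ))).prod
        * ((d.length + m - 1).choose (m - 1) : ℝ) :=
          by rw [Finset.sum_image fun _ _ _ _ h => he h]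
    _ ≤ _ := by
      refine Finset.sum_le_sum_of_subset_of_nonneg (Finset.subset_univ _) fun d _ _ =>
        mul_nonneg (List.prod_nonneg ?_) (Nat.cast_nonneg _)
      intro x hx
      obtain ⟨γ, -, rfl⟩ := List.mem_map.1 hx
      exact f.coeff_nonneg _

/-! ### Fock space and the universal model `W` of the polydomain -/

variable {k : ℕ}

/-- The product of free monoids on `n 1, …, n k` generators: multi-words `(α₁, …, α_k)`. -/
abbrev Words (n : Fin k → ℕ) : Type := ∀ i, FreeMonoid (Fin (n i))

/-- The tensor product `F²(H_{n₁}) ⊗ ⋯ ⊗ F²(H_{n_k})` of full Fock spaces, presented through its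
orthonormal basis `e¹_{β₁} ⊗ ⋯ ⊗ e^k_{β_k}` as the space `ℓ²` over the multi-words. -/
abbrev Fock (n : Fin k → ℕ) : Type := lp (fun _ : Words n => ℂ) 2

/-- The basis vector `e_β = e¹_{β₁} ⊗ ⋯ ⊗ e^k_{β_k}`. -/
def basisVec {n : Fin k → ℕ} (β : Words n) : Fock n :=
  haveI : DecidableEq (Words n) := Classical.decEq _
  lp.single 2 β (1 : ℂ)

/-- The weighted shift on `ℓ²` with `e_i ↦ c i • e_{σ i}`, for `σ` injective and `c` bounded. -/
def weightedShift {ι : Type*} (σ : ι → ι) (hσ : Function.Injective σ) (c : ι → ℂ) (C : ℝ)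
    (hC : 0 ≤ C) (hc : ∀ i, ‖c i‖ ≤ C) :
    lp (fun _ : ι => ℂ) 2 →L[ℂ] lp (fun _ : ι => ℂ) 2 :=
  have hsum : ∀ x : lp (fun _ : ι => ℂ) 2,
      HasSum (fun i => ‖x i‖ ^ (2 : ℝ)) (‖x‖ ^ (2 : ℝ)) := fun x => by
    have := lp.hasSum_norm (p := 2) (by norm_num) x
    simpa using this
  have hle : ∀ (x : lp (fun _ : ι => ℂ) 2) i,
      ‖c i * x i‖ ^ (2 : ℝ) ≤ C ^ (2 : ℝ) * ‖x i‖ ^ (2 : ℝ) := fun x i => by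
    rw [← Real.mul_rpow hC (norm_nonneg _), norm_mul]
    exact Real.rpow_le_rpow (by positivity)
      (mul_le_mul_of_nonneg_right (hc i) (norm_nonneg _)) (by norm_num)
  have hs : ∀ x : lp (fun _ : ι => ℂ) 2, Summable fun i => ‖c i * x i‖ ^ (2 : ℝ) := fun x =>
    Summable.of_nonneg_of_le (fun i => by positivity) (hle x) ((hsum x).summable.mul_left _)
  have hext : ∀ x : lp (fun _ : ι => ℂ) 2,
      (fun j => ‖Function.extend σ (fun i => c i * x i) 0 j‖ ^ (2 : ℝ))
        = Function.extend σ (fun i => ‖c i * x i‖ ^ (2 : ℝ)) 0 := fun x => by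
    funext j
    by_cases hj : ∃ i, σ i = j
    · obtain ⟨i, rfl⟩ := hj
      simp [hσ.extend_apply]
    · simp [Function.extend_apply' _ _ _ hj]
  have hext' : ∀ x : lp (fun _ : ι => ℂ) 2,
      HasSum (fun j => ‖Function.extend σ (fun i => c i * x i) 0 j‖ ^ (2 : ℝ))
        (∑' i, ‖c i * x i‖ ^ (2 : ℝ)) := fun x => by
    rw [hext x]
    exact (hasSum_extend_zero hσ).2 (hs x).hasSum
  LinearMap.mkContinuous
    { toFun := fun x => ⟨Function.extend σ (fun i => c i * x i) 0,
        memℓp_gen (by simpa using (hext' x).summable)⟩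
      map_add' := fun x y => by
        ext j
        change Function.extend σ (fun i => c i * (x i + y i)) 0 j
          = Function.extend σ (fun i => c i * x i) 0 j + Function.extend σ (fun i => c i * y i) 0 j
        by_cases hj : ∃ i, σ i = j
        · obtain ⟨i, rfl⟩ := hj
          simp [hσ.extend_apply, mul_add]
        · simp [Function.extend_apply' _ _ _ hj]
      map_smul' := fun a x => by
        ext j
        change Function.extend σ (fun i => c i * (a * x i)) 0 j
          = a * Function.extend σ (fun i => c i * x i) 0 j
        by_cases hj : ∃ i, σ i = j
        · obtain ⟨i, rfl⟩ := hj
          simp [hσ.extend_apply, mul_left_comm]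
        · simp [Function.extend_apply' _ _ _ hj] }
    C (fun x => by
      refine lp.norm_le_of_tsum_le (p := 2) (by norm_num) (by positivity) ?_
      have h1 := (hext' x).tsum_eq
      have h2 : ∑' i, ‖c i * x i‖ ^ (2 : ℝ) ≤ C ^ (2 : ℝ) * ‖x‖ ^ (2 : ℝ) :=
        ((hs x).tsum_le_tsum (hle x) ((hsum x).summable.mul_left _)).trans_eq
          ((hsum x).mul_left _).tsum_eq
      rw [Real.mul_rpow hC (norm_nonneg _)]
      simpa using h1.le.trans h2)

theorem weightedShift_single {ι : Type*} [DecidableEq ι] (σ : ι → ι)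
    (hσ : Function.Injective σ) (c : ι → ℂ) (C : ℝ) (hC : 0 ≤ C) (hc : ∀ i, ‖c i‖ ≤ C) (i : ι) :
    weightedShift σ hσ c C hC hc (lp.single 2 i (1 : ℂ)) = c i • lp.single 2 (σ i) (1 : ℂ) := by
  ext j
  change Function.extend σ (fun i' => c i' * (lp.single 2 i (1 : ℂ) : lp (fun _ : ι => ℂ) 2) i') 0 j
    = _
  by_cases hj : ∃ i', σ i' = j
  · obtain ⟨i', rfl⟩ := hj
    rw [hσ.extend_apply]
    by_cases h : i' = i
    · subst h; simp
    · have h' : σ i' ≠ σ i := fun e => h (hσ e)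
      simp [h, h']
  · rw [Function.extend_apply' _ _ _ hj]
    have h' : j ≠ σ i := fun e => hj ⟨i, e.symm⟩
    simp [h']

/-- Left multiplication of the `i`-th component of a multi-word by the generator `g_j`. -/
def leftMul {n : Fin k → ℕ} (i : Fin k) (j : Fin (n i)) (β : Words n) : Words n :=
  Function.update β i (FreeMonoid.of j * β i)

theorem leftMul_injective {n : Fin k → ℕ} (i : Fin k) (j : Fin (n i)) :
    Function.Injective (leftMul (n := n) i j) := by
  intro β γ h
  funext l
  have hl := congrFun h l
  by_cases hli : l = i
  · subst hli
    simpa [leftMul] using hl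
  · simpa [leftMul, hli] using hl

/-- The weight `√b_{i,β_i} / √b_{i,g_j β_i}`. -/
def weight {n : Fin k → ℕ} (f : ∀ i, PosRegular (n i)) (m : Fin k → ℕ) (i : Fin k)
    (j : Fin (n i)) (β : Words n) : ℝ :=
  √(bCoeff (f i) (m i) (β i)) / √(bCoeff (f i) (m i) (FreeMonoid.of j * β i))

theorem weight_nonneg {n : Fin k → ℕ} (f : ∀ i, PosRegular (n i)) (m : Fin k → ℕ) (i : Fin k)
    (j : Fin (n i)) (β : Words n) : 0 ≤ weight f m i j β :=
  div_nonneg (Real.sqrt_nonneg _) (Real.sqrt_nonneg _)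

theorem weight_le {n : Fin k → ℕ} (f : ∀ i, PosRegular (n i)) (m : Fin k → ℕ) (i : Fin k)
    (j : Fin (n i)) (β : Words n) :
    weight f m i j β ≤ 1 / √((f i).coeff (FreeMonoid.of j)) := by
  have ha := (f i).coeff_of_pos j
  have h := coeff_mul_bCoeff_le (f i) (m i) j (β i)
  unfold weight
  rw [le_div_iff₀ (Real.sqrt_pos.2 ha), div_mul_eq_mul_div]
  refine div_le_one_of_le₀ ?_ (Real.sqrt_nonneg _)
  rw [← Real.sqrt_mul (bCoeff_nonneg _ _ _), mul_comm]
  exact Real.sqrt_le_sqrt h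

/-- The universal model `𝐖_{i,j} = I ⊗ ⋯ ⊗ W_{i,j} ⊗ ⋯ ⊗ I` of the polydomain, where `W_{i,j}` is
the weighted left creation operator. -/
def W {n : Fin k → ℕ} (f : ∀ i, PosRegular (n i)) (m : Fin k → ℕ) (i : Fin k) (j : Fin (n i)) :
    Fock n →L[ℂ] Fock n :=
  weightedShift (leftMul i j) (leftMul_injective i j) (fun β => (weight f m i j β : ℂ))
    (1 / √((f i).coeff (FreeMonoid.of j))) (by positivity)
    (fun β => by
      rw [Complex.norm_real, Real.norm_of_nonneg (weight_nonneg f m i j β)]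
      exact weight_le f m i j β)

theorem W_basisVec {n : Fin k → ℕ} (f : ∀ i, PosRegular (n i)) (m : Fin k → ℕ) (i : Fin k)
    (j : Fin (n i)) (β : Words n) :
    W f m i j (basisVec β)
      = ((√(bCoeff (f i) (m i) (β i)) / √(bCoeff (f i) (m i) (FreeMonoid.of j * β i)) : ℝ) : ℂ)
        • basisVec (Function.update β i (FreeMonoid.of j * β i)) :=
  letI : DecidableEq (Words n) := Classical.decEq _
  weightedShift_single (leftMul i j) (leftMul_injective i j)
    (fun β => (weight f m i j β : ℂ)) (1 / √((f i).coeff (FreeMonoid.of j))) (by positivity)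
    (fun β => by
      rw [Complex.norm_real, Real.norm_of_nonneg (weight_nonneg f m i j β)]
      exact weight_le f m i j β) β

/-! ### Tuples of operators and polynomials -/

section Tuples

variable {E : Type*} [NormedAddCommGroup E] [InnerProductSpace ℂ E]

/-- `X_α = X_{j₁} ⋯ X_{j_p}` for a word `α = g_{j₁} ⋯ g_{j_p}`. -/
def wordOp {n : ℕ} (X : Fin n → E →L[ℂ] E) (α : FreeMonoid (Fin n)) : E →L[ℂ] E :=
  ((FreeMonoid.toList α).map X).prod

/-- `X_{(α)} = X_{1,α₁} ⋯ X_{k,α_k}` for a multi-word `(α) = (α₁, …, α_k)`. -/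
def multiOp {n : Fin k → ℕ} (X : ∀ i, Fin (n i) → E →L[ℂ] E) (α : Words n) : E →L[ℂ] E :=
  (List.ofFn fun i => wordOp (X i) (α i)).prod

theorem multiOp_one {n : Fin k → ℕ} (X : ∀ i, Fin (n i) → E →L[ℂ] E) : multiOp X 1 = 1 := by
  simp [multiOp, wordOp]

/-- The entries of `X_p` commute with the entries of `X_q` for `p ≠ q`. -/
def CommutingTuples {n : Fin k → ℕ} (X : ∀ i, Fin (n i) → E →L[ℂ] E) : Prop :=
  ∀ p q, p ≠ q → ∀ s t, Commute (X p s) (X q t)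

/-- The algebra of polynomials in the indeterminates `Z_{i,j}`, where `Z_{p,s}` and `Z_{q,t}`
commute for `p ≠ q` and there are no other relations: its monomials are the multi-words. -/
abbrev NCPoly (n : Fin k → ℕ) : Type := MonoidAlgebra ℂ (Words n)

/-- The value `q(X)` of a polynomial at a tuple of operators. -/
def polyEval {n : Fin k → ℕ} (q : NCPoly n) (X : ∀ i, Fin (n i) → E →L[ℂ] E) : E →L[ℂ] E :=
  q.coeff.sum fun α c => c • multiOp X α

end Tuples

/-! ### The universal model `S` of the variety -/

/-- The space `M_Q`, the closed span of the vectors `𝐖_{(α)} q(𝐖) 𝐖_{(β)} c`, `c ∈ ℂ`. -/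
def MQ {n : Fin k → ℕ} (f : ∀ i, PosRegular (n i)) (m : Fin k → ℕ) (Q : Set (NCPoly n)) :
    Submodule ℂ (Fock n) :=
  (Submodule.span ℂ {v | ∃ (α β : Words n) (q : NCPoly n) (c : ℂ), q ∈ Q ∧
    v = (multiOp (W f m) α * polyEval q (W f m) * multiOp (W f m) β)
      (c • basisVec 1)}).topologicalClosure

/-- `N_Q`, the orthogonal complement of `M_Q`. -/
abbrev NQ {n : Fin k → ℕ} (f : ∀ i, PosRegular (n i)) (m : Fin k → ℕ) (Q : Set (NCPoly n)) :
    Submodule ℂ (Fock n) := (MQ f m Q)ᗮ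

/-- The orthogonal projection of the Fock space onto `N_Q`. -/
def projN {n : Fin k → ℕ} (f : ∀ i, PosRegular (n i)) (m : Fin k → ℕ) (Q : Set (NCPoly n)) :
    Fock n →L[ℂ] NQ f m Q := (NQ f m Q).orthogonalProjectionOnto

/-- The universal model `𝐒_{i,j} = P_{N_Q} 𝐖_{i,j} |_{N_Q}` of the variety. -/
def S {n : Fin k → ℕ} (f : ∀ i, PosRegular (n i)) (m : Fin k → ℕ) (Q : Set (NCPoly n))
    (i : Fin k) (j : Fin (n i)) : NQ f m Q →L[ℂ] NQ f m Q :=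
  projN f m Q ∘L W f m i j ∘L (NQ f m Q).subtypeL

/-! ### The `w*`-topology, and completely positive maps -/

section WStar

variable (E : Type*) [NormedAddCommGroup E] [InnerProductSpace ℂ E]

/-- The vector functional `T ↦ ⟪x, T y⟫` on `B(E)`. -/
def vectorFunctional (x y : E) : StrongDual ℂ (E →L[ℂ] E) :=
  (innerSL ℂ x) ∘L (ContinuousLinearMap.apply ℂ E y)

/-- The predual `B(E)_*` of `B(E)`: the norm closed span of the vector functionals. -/
def predual : Submodule ℂ (StrongDual ℂ (E →L[ℂ] E)) :=
  (Submodule.span ℂ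
    (Set.range fun z : E × E => vectorFunctional E z.1 z.2)).topologicalClosure

/-- The `w*`-topology on `B(E)`, i.e. the topology of pointwise convergence on the predual. -/
@[reducible] def wstar : TopologicalSpace (E →L[ℂ] E) :=
  TopologicalSpace.induced (fun T (ψ : predual E) => (ψ : StrongDual ℂ (E →L[ℂ] E)) T)
    Pi.topologicalSpace

/-- The evaluation of operators against the predual, as a linear map. -/
def predualEval : (E →L[ℂ] E) →ₗ[ℂ] (predual E → ℂ) where
  toFun T ψ := (ψ : StrongDual ℂ (E →L[ℂ] E)) T
  map_add' T U := by ext ψ; simp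
  map_smul' c T := by ext ψ; simp

variable {E}

/-- The `w*`-closure of a linear subspace of `B(E)`. -/
def wstarClosure (V : Submodule ℂ (E →L[ℂ] E)) : Submodule ℂ (E →L[ℂ] E) :=
  letI : TopologicalSpace (E →L[ℂ] E) := wstar E
  haveI : ContinuousAdd (E →L[ℂ] E) := continuousAdd_induced (predualEval E)
  haveI : ContinuousSMul ℂ (E →L[ℂ] E) := continuousSMul_induced (predualEval E)
  V.topologicalClosure

theorem coe_wstarClosure (V : Submodule ℂ (E →L[ℂ] E)) :
    (wstarClosure V : Set (E →L[ℂ] E)) = @closure _ (wstar E) V := rfl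

theorem le_wstarClosure (V : Submodule ℂ (E →L[ℂ] E)) : V ≤ wstarClosure V :=
  fun _ h => @subset_closure _ (wstar E) _ _ h

/-- Positivity of a `d × d` matrix of operators on `E`, as an operator on `E ⊕ ⋯ ⊕ E`. -/
def MatrixPos {d : ℕ} (X : Fin d → Fin d → E →L[ℂ] E) : Prop :=
  ∀ x : Fin d → E, 0 ≤ ∑ s, ∑ t, ⟪x s, X s t (x t)⟫_ℂ

/-- Complete positivity of a linear map on an operator space `V ⊆ B(E)`. -/
def CompletelyPos {H : Type*} [NormedAddCommGroup H] [InnerProductSpace ℂ H]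
    {V : Submodule ℂ (E →L[ℂ] E)} (φ : V →ₗ[ℂ] (H →L[ℂ] H)) : Prop :=
  ∀ (d : ℕ) (X : Fin d → Fin d → V),
    MatrixPos (fun s t => (X s t : E →L[ℂ] E)) → MatrixPos (fun s t => φ (X s t))

/-- `w*`-continuity of a linear map on a subspace `V ⊆ B(E)`. -/
def WStarContinuous {H : Type*} [NormedAddCommGroup H] [InnerProductSpace ℂ H]
    {V : Submodule ℂ (E →L[ℂ] E)} (φ : V →ₗ[ℂ] (H →L[ℂ] H)) : Prop :=
  @Continuous V (H →L[ℂ] H) (TopologicalSpace.induced Subtype.val (wstar E)) (wstar H) φ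

end WStar

/-! ### The operator system generated by `S`, and the maps on it -/

/-- The `w*`-closed span of the operators `𝐒_{(α)} 𝐒_{(β)}*`. -/
def opSystem {n : Fin k → ℕ} (f : ∀ i, PosRegular (n i)) (m : Fin k → ℕ) (Q : Set (NCPoly n)) :
    Submodule ℂ (NQ f m Q →L[ℂ] NQ f m Q) :=
  wstarClosure (Submodule.span ℂ {T | ∃ α β : Words n,
    T = multiOp (S f m Q) α * ContinuousLinearMap.adjoint (multiOp (S f m Q) β)})

/-- `𝐒_{(α)} 𝐒_{(β)}*` as an element of the operator system. -/
def genS {n : Fin k → ℕ} (f : ∀ i, PosRegular (n i)) (m : Fin k → ℕ) (Q : Set (NCPoly n))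
    (α β : Words n) : opSystem f m Q :=
  ⟨multiOp (S f m Q) α * ContinuousLinearMap.adjoint (multiOp (S f m Q) β),
    le_wstarClosure _ (Submodule.subset_span ⟨α, β, rfl⟩)⟩

/-- The identity of `N_Q` as an element of the operator system. -/
def unitS {n : Fin k → ℕ} (f : ∀ i, PosRegular (n i)) (m : Fin k → ℕ) (Q : Set (NCPoly n)) :
    opSystem f m Q :=
  ⟨1, by
    have h := (genS f m Q 1 1).2
    have e : ((genS f m Q 1 1 : opSystem f m Q) : NQ f m Q →L[ℂ] NQ f m Q) = 1 := by
      change multiOp (S f m Q) 1 * ContinuousLinearMap.adjoint (multiOp (S f m Q) 1) = 1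
      rw [multiOp_one, one_mul]
      exact star_one _
    rwa [e] at h⟩

section Main

variable {H : Type*} [NormedAddCommGroup H] [InnerProductSpace ℂ H] [CompleteSpace H]

/-- The set `CP^{w*}(A, V_Q)`. -/
def CPw {n : Fin k → ℕ} (f : ∀ i, PosRegular (n i)) (m : Fin k → ℕ) (Q : Set (NCPoly n))
    (A : ∀ i, Fin (n i) → H →L[ℂ] H) : Set (opSystem f m Q →ₗ[ℂ] (H →L[ℂ] H)) :=
  {φ | WStarContinuous φ ∧ CompletelyPos φ ∧ ∀ α β : Words n,
    φ (genS f m Q α β)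
      = multiOp A α * φ (unitS f m Q) * ContinuousLinearMap.adjoint (multiOp A β)}

/-! ### The maps `Φ_{f,A}`, defect maps and the pure cone -/

/-- The term `a_α A_α X A_α*`, in `B(H)` with the weak operator topology. -/
def phiTerm {n : ℕ} (f : PosRegular n) (A : Fin n → H →L[ℂ] H) (X : H →L[ℂ] H)
    (α : FreeMonoid (Fin n)) : H →WOT[ℂ] H :=
  ContinuousLinearMapWOT.ofCLM
    ((f.coeff α : ℂ) • (wordOp A α * X * ContinuousLinearMap.adjoint (wordOp A α)))

/-- `Φ_{f,A}` is well defined: `∑ a_α A_α A_α*` converges in the weak operator topology. -/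
def PhiWellDefined {n : ℕ} (f : PosRegular n) (A : Fin n → H →L[ℂ] H) : Prop :=
  Summable (phiTerm f A 1)

/-- `Φ_{f,A}(X) = ∑ a_α A_α X A_α*`, with convergence in the weak operator topology
(the term of the empty word vanishes, as its coefficient is `0`). -/
def Phi {n : ℕ} (f : PosRegular n) (A : Fin n → H →L[ℂ] H) (X : H →L[ℂ] H) : H →L[ℂ] H :=
  (∑' α, phiTerm f A X α).toCLM

/-- The composition `ψ₁^{p₁} ∘ ⋯ ∘ ψ_k^{p_k}` of iterates of self-maps of `B(H)`. -/
def compIter (ψ : Fin k → (H →L[ℂ] H) → (H →L[ℂ] H)) (p : Fin k → ℕ) :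
    (H →L[ℂ] H) → (H →L[ℂ] H) :=
  (List.ofFn fun i => (ψ i)^[p i]).foldr (fun g h => g ∘ h) id

/-- The defect map `Δ^p_{f,A} = (id - Φ_{f₁,A₁})^{p₁} ∘ ⋯ ∘ (id - Φ_{f_k,A_k})^{p_k}`. -/
def defect {n : Fin k → ℕ} (f : ∀ i, PosRegular (n i)) (A : ∀ i, Fin (n i) → H →L[ℂ] H)
    (p : Fin k → ℕ) : (H →L[ℂ] H) → (H →L[ℂ] H) :=
  compIter (fun i X => X - Phi (f i) (A i) X) p

/-- The pure cone `C^{pure}_≥(Δ^m_{f,A})^+`. -/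
def pureCone {n : Fin k → ℕ} (f : ∀ i, PosRegular (n i)) (m : Fin k → ℕ)
    (A : ∀ i, Fin (n i) → H →L[ℂ] H) : Set (H →L[ℂ] H) :=
  {X | 0 ≤ X ∧ (∀ p : Fin k → ℕ, p ≤ m → p ≠ 0 → 0 ≤ defect f A p X) ∧
    ∀ i, Tendsto (fun s : ℕ => ContinuousLinearMapWOT.ofCLM ((Phi (f i) (A i))^[s] X)) atTop
      (𝓝 (0 : H →WOT[ℂ] H))}

/-! ### Compatible tuples and the constrained Berezin kernel -/

/-- The term of index `s` of the series `∑ C(s₁+m₁-1, m₁-1) ⋯ C(s_k+m_k-1, m_k-1)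
Φ_{f₁,A₁}^{s₁} ∘ ⋯ ∘ Φ_{f_k,A_k}^{s_k}(R)`, in the weak operator topology. -/
def compatTerm {n : Fin k → ℕ} (f : ∀ i, PosRegular (n i)) (m : Fin k → ℕ)
    (A : ∀ i, Fin (n i) → H →L[ℂ] H) (R : H →L[ℂ] H) (s : Fin k → ℕ) : H →WOT[ℂ] H :=
  ContinuousLinearMapWOT.ofCLM
    (((∏ i, (s i + m i - 1).choose (m i - 1) : ℕ) : ℂ)
      • compIter (fun i => Phi (f i) (A i)) s R)

/-- The tuple `ω = (f, m, A, R, Q)` is compatible. -/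
structure Compatible {n : Fin k → ℕ} (f : ∀ i, PosRegular (n i)) (m : Fin k → ℕ)
    (A : ∀ i, Fin (n i) → H →L[ℂ] H) (R : H →L[ℂ] H) (Q : Set (NCPoly n)) : Prop where
  comm : CommutingTuples A
  wellDefined : ∀ i, PhiWellDefined (f i) (A i)
  nonneg : 0 ≤ R
  summable : Summable (compatTerm f m A R)
  bound : ∃ b : ℝ, 0 < b ∧
    (∑' s, compatTerm f m A R s).toCLM ≤ (b : ℂ) • (1 : H →L[ℂ] H)
  polyEval_eq_zero : ∀ q ∈ Q, polyEval q A = 0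

/-- The Hilbert space tensor product: the completion of the algebraic one. -/
abbrev HTensor (E F : Type*) [NormedAddCommGroup E] [InnerProductSpace ℂ E]
    [NormedAddCommGroup F] [InnerProductSpace ℂ F] : Type _ :=
  UniformSpace.Completion (E ⊗[ℂ] F)

/-- The bounded operator `T ⊗ I_G` between Hilbert space tensor products. -/
def tensorId {E F : Type*} (G : Type*) [NormedAddCommGroup E] [InnerProductSpace ℂ E]
    [NormedAddCommGroup F] [InnerProductSpace ℂ F] [NormedAddCommGroup G] [InnerProductSpace ℂ G]
    (T : E →L[ℂ] F) : HTensor E G →L[ℂ] HTensor F G :=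
  (T.rTensor G).completion

/-- The closure of the range of `R^{1/2}`. -/
abbrev rangeSqrt (R : H →L[ℂ] H) : Submodule ℂ H :=
  (LinearMap.range (CFC.sqrt R).toLinearMap).topologicalClosure

/-- `R^{1/2} x` as an element of the closure of the range of `R^{1/2}`. -/
def sqrtVec (R : H →L[ℂ] H) (x : H) : rangeSqrt R :=
  ⟨CFC.sqrt R x, subset_closure ⟨x, rfl⟩⟩

/-- `A_{1,β₁}* ⋯ A_{k,β_k}*`. -/
def multiOpStar {n : Fin k → ℕ} (A : ∀ i, Fin (n i) → H →L[ℂ] H) (β : Words n) : H →L[ℂ] H :=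
  (List.ofFn fun i => ContinuousLinearMap.adjoint (wordOp (A i) (β i))).prod

/-- The bounded operator `K` is the generalized Berezin kernel of `(f, m, A, R)`:
`K h = ∑ √b_{1,β₁} ⋯ √b_{k,β_k} e_β ⊗ R^{1/2} A_{1,β₁}* ⋯ A_{k,β_k}* h` for all `h`, the series
being norm convergent. There is at most one such `K`. -/
def IsBerezinKernel {n : Fin k → ℕ} (f : ∀ i, PosRegular (n i)) (m : Fin k → ℕ)
    (A : ∀ i, Fin (n i) → H →L[ℂ] H) (R : H →L[ℂ] H)
    (K : H →L[ℂ] HTensor (Fock n) (rangeSqrt R)) : Prop :=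
  ∀ h : H, HasSum (fun β : Words n =>
    ((((∏ i, √(bCoeff (f i) (m i) (β i)) : ℝ) : ℂ)
      • (basisVec β ⊗ₜ[ℂ] sqrtVec R (multiOpStar A β h)) : Fock n ⊗[ℂ] rangeSqrt R) :
      HTensor (Fock n) (rangeSqrt R))) (K h)

/-- The constrained Berezin kernel `K_ω = (P_{N_Q} ⊗ I) K`, for `K` the generalized one. -/
def constrainedKernel {n : Fin k → ℕ} (f : ∀ i, PosRegular (n i)) (m : Fin k → ℕ)
    (Q : Set (NCPoly n)) (R : H →L[ℂ] H) (K : H →L[ℂ] HTensor (Fock n) (rangeSqrt R)) :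
    H →L[ℂ] HTensor (NQ f m Q) (rangeSqrt R) :=
  tensorId (rangeSqrt R) (projN f m Q) ∘L K

/-- The Berezin transform `χ ↦ K_ω* (χ ⊗ I) K_ω`. -/
def berezinTransform {E G : Type*} [NormedAddCommGroup E] [InnerProductSpace ℂ E]
    [NormedAddCommGroup G] [InnerProductSpace ℂ G] (Kω : H →L[ℂ] HTensor E G)
    (χ : E →L[ℂ] E) : H →L[ℂ] H :=
  ContinuousLinearMap.adjoint Kω ∘L tensorId G χ ∘L Kω

end Main

end Polydomain

end

open Polydomain

/-!
The maps `φ` in `CP^{w*}(A, V_Q)` and the elements `D` of the pure cone correspond to each other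
by `D = φ(I)`. All positive operators are handled through their quadratic forms `qform X` with
values in `[0, ∞]`: there every series converges and may be rearranged, the map `Φ_{f,A}` becomes
`psi f A`, and a bounded sum of forms comes from a weakly convergent series of operators
(`exists_hasSum_ofCLM`). The coefficients enter through the convolution identity
`b^{(m+1)} = b^{(m)} + a * b^{(m+1)}` (`tsum_bWord_succ_mul`), where `b^{(0)}` is the indicator of
the empty word, and through `b^{(m)} = ∑ C(s + m - 1, m - 1) a^s` (`tsum_bWord_mul`).

From `D` to `φ`. If `q = r + ψ q` and `ψ^s q → 0`, then `q = ∑ ψ^s r`. Applying this once for each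
factor `id - Φ_i` of the defect map gives the reconstruction formula
`⟪h, D h⟫ = ∑ b_β ‖R^{1/2} A_β* h‖²`, where `R` is the defect of `D`
(`qform_eq_tsum_multiOpStar`). It yields the compatibility of `R` (`compatible_of_mem_pureCone`)
and a bounded Berezin kernel `K` with `K* K = D` (`exists_isBerezinKernel`). The slices of `K`
along vectors of the closed range of `R^{1/2}` intertwine `A_{i,j}*` with `𝐖_{i,j}*`, and they take
values in `N_Q` because the polynomials in `Q` vanish at `A` (`adjoint_slice_kernel_mem_NQ`).
Hence the constrained Berezin transform has the required values on `𝐒_α 𝐒_β*`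
(`berezinTransform_constrainedKernel_mul`). Being a sum `χ ↦ ∑ K_i* χ K_i` over the slices `K_i`
along a Hilbert basis, it is `w*`-continuous and completely positive
(`continuous_wstar_berezinL`, `completelyPos_berezinL`).

From `φ` to `D`. On `N_Q` the adjoint `𝐒_{i,j}*` is the restriction of `𝐖_{i,j}*`, and the
convolution identity shows that the defect `Δ^p(I)` of the model has the quadratic form
`x ↦ ∑ b_β^{(m-p)} |x_β|² / b_β^{(m)}` (`sub_phi_S_spec`), which is positive for `p ≤ m`; moreover
`Φ_i^s(I)` only sees words of length at least `s` in the `i`-th variable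
(`qform_phi_S_iterate_le`). Bounded weakly convergent nets converge in the `w*`-topology
(`tendsto_wstar_of_bounded`), so the operator system is invariant under the maps `Φ_i` of the
model, and `φ` intertwines them with those of `A` (`exists_map_phi`). Therefore `φ(I)` has positive
defects and is pure (`map_unitS_mem_pureCone`). Finally `φ` is determined by `φ(I)`, since the
values on the generators `𝐒_α 𝐒_β*` determine a `w*`-continuous map (`ext_genS`).
-/

open scoped ENNReal

noncomputable section

namespace Polydomain

/-! ### Quadratic forms of positive operators -/

section QuadraticForms

variable {H : Type*} [NormedAddCommGroup H] [InnerProductSpace ℂ H]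

theorem nonneg_iff_forall_inner {X : H →L[ℂ] H} : 0 ≤ X ↔ ∀ h, 0 ≤ ⟪h, X h⟫_ℂ := by
  rw [ContinuousLinearMap.nonneg_iff_isPositive, ContinuousLinearMap.isPositive_iff_complex]
  refine forall_congr' fun h => ?_
  rw [← inner_conj_symm h (X h), Complex.le_def]
  simp only [RCLike.re_to_complex, Complex.ext_iff, Complex.ofReal_re, Complex.ofReal_im,
    Complex.zero_re, Complex.zero_im, Complex.conj_re, Complex.conj_im, true_and]
  constructor
  · rintro ⟨h1, h2⟩
    exact ⟨h2, by rw [← h1]; simp⟩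
  · rintro ⟨h1, h2⟩
    exact ⟨by linarith, h1⟩

/-- The quadratic form `h ↦ ⟪h, X h⟫` of a positive operator `X`, with values in `[0, ∞]`, where
all sums exist and may be interchanged. -/
def qform (X : H →L[ℂ] H) (h : H) : ℝ≥0∞ := ENNReal.ofReal (⟪h, X h⟫_ℂ).re

theorem qform_lt_top (X : H →L[ℂ] H) (h : H) : qform X h < ∞ := ENNReal.ofReal_lt_top

theorem inner_eq_toReal_qform {X : H →L[ℂ] H} (hX : 0 ≤ X) (h : H) :
    ⟪h, X h⟫_ℂ = ((qform X h).toReal : ℂ) := by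
  have := nonneg_iff_forall_inner.1 hX h
  rw [Complex.le_def] at this
  rw [qform, ENNReal.toReal_ofReal this.1]
  exact Complex.ext (by simp) (by simpa using this.2.symm)

theorem qform_add {X Y : H →L[ℂ] H} (hX : 0 ≤ X) (hY : 0 ≤ Y) (h : H) :
    qform (X + Y) h = qform X h + qform Y h := by
  have h1 := (Complex.le_def.1 (nonneg_iff_forall_inner.1 hX h)).1
  have h2 := (Complex.le_def.1 (nonneg_iff_forall_inner.1 hY h)).1
  rw [qform, qform, qform, ← ENNReal.ofReal_add h1 h2]
  simp

theorem qform_le (X : H →L[ℂ] H) (h : H) : qform X h ≤ ENNReal.ofReal (‖X‖ * ‖h‖ ^ 2) := by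
  refine ENNReal.ofReal_le_ofReal ((Complex.re_le_norm _).trans ((norm_inner_le_norm _ _).trans ?_))
  calc ‖h‖ * ‖X h‖ ≤ ‖h‖ * (‖X‖ * ‖h‖) := by gcongr; exact X.le_opNorm h
    _ = ‖X‖ * ‖h‖ ^ 2 := by ring

theorem qform_one (h : H) : qform (1 : H →L[ℂ] H) h = ENNReal.ofReal (‖h‖ ^ 2) := by
  rw [qform, one_apply_eq_self, inner_self_eq_norm_sq_to_K]
  norm_cast

theorem qform_le_norm_mul_qform_one (X : H →L[ℂ] H) (h : H) :
    qform X h ≤ ENNReal.ofReal ‖X‖ * qform 1 h := by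
  rw [qform_one, ← ENNReal.ofReal_mul (norm_nonneg _)]
  exact qform_le X h

theorem nonneg_of_qform {X Y : H →L[ℂ] H} (hX : 0 ≤ X) (hY : 0 ≤ Y)
    (h : ∀ x, qform Y x ≤ qform X x) : 0 ≤ X - Y := by
  refine nonneg_iff_forall_inner.2 fun x => ?_
  rw [sub_apply, inner_sub_right, inner_eq_toReal_qform hX,
    inner_eq_toReal_qform hY, ← Complex.ofReal_sub]
  exact_mod_cast sub_nonneg.2 (ENNReal.toReal_mono (qform_lt_top X x).ne (h x))

theorem qform_eq_qform_sub_add {X Y : H →L[ℂ] H} (hY : 0 ≤ Y) (hXY : 0 ≤ X - Y) (h : H) :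
    qform X h = qform (X - Y) h + qform Y h := by
  rw [← qform_add hXY hY, sub_add_cancel]

/-- Conjugation `X ↦ T X T*`, scaled by `c ≥ 0`, acts on quadratic forms through `T*`. -/
theorem qform_smul_conj [CompleteSpace H] {c : ℝ} (hc : 0 ≤ c) (T X : H →L[ℂ] H) (h : H) :
    qform ((c : ℂ) • (T * X * ContinuousLinearMap.adjoint T)) h
      = ENNReal.ofReal c * qform X (ContinuousLinearMap.adjoint T h) := by
  rw [qform, qform, ← ENNReal.ofReal_mul hc, smul_apply, inner_smul_right,
    Complex.re_ofReal_mul, mul_apply_eq_comp, mul_apply_eq_comp,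
    ContinuousLinearMap.adjoint_inner_left]

theorem smul_conj_nonneg [CompleteSpace H] {c : ℝ} (hc : 0 ≤ c) (T : H →L[ℂ] H) {X : H →L[ℂ] H}
    (hX : 0 ≤ X) : 0 ≤ (c : ℂ) • (T * X * ContinuousLinearMap.adjoint T) := by
  refine nonneg_iff_forall_inner.2 fun h => ?_
  rw [smul_apply, inner_smul_right, mul_apply_eq_comp,
    mul_apply_eq_comp, ← ContinuousLinearMap.adjoint_inner_left]
  exact mul_nonneg (by exact_mod_cast hc) (nonneg_iff_forall_inner.1 hX _)

/-- By polarization, weak operator convergence is convergence of the quadratic forms. -/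
theorem tendsto_ofCLM_of_inner_self [CompleteSpace H] {ι : Type*} {l : Filter ι}
    {T : ι → H →L[ℂ] H} {S : H →L[ℂ] H}
    (h : ∀ x, Tendsto (fun i => ⟪x, T i x⟫_ℂ) l (𝓝 ⟪x, S x⟫_ℂ)) :
    Tendsto (fun i => ContinuousLinearMapWOT.ofCLM (T i)) l
      (𝓝 (ContinuousLinearMapWOT.ofCLM S)) := by
  rw [ContinuousLinearMapWOT.tendsto_iff_forall_inner_apply_tendsto]
  intro x y
  have h' : ∀ x, Tendsto (fun i => ⟪T i x, x⟫_ℂ) l (𝓝 ⟪S x, x⟫_ℂ) := fun x => by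
    have := (continuous_star.tendsto _).comp (h x)
    simpa [Function.comp_def, inner_conj_symm, starRingEnd_apply] using this
  have h2 : Tendsto (fun i => ⟪T i x, y⟫_ℂ) l (𝓝 ⟪S x, y⟫_ℂ) := by
    have e : ∀ U : H →L[ℂ] H, ⟪U x, y⟫_ℂ = _ := fun U => inner_map_polarization' (U : H →ₗ[ℂ] H) x y
    rw [e S]
    simp_rw [fun i => e (T i)]
    exact ((((h' _).sub (h' _)).sub ((h' _).const_mul _)).add ((h' _).const_mul _)).div_const _
  have := (continuous_star.tendsto _).comp h2
  simpa [Function.comp_def, inner_conj_symm, starRingEnd_apply] using this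

theorem tendsto_inner_self_of_ofCLM [CompleteSpace H] {ι : Type*} {l : Filter ι}
    {T : ι → H →L[ℂ] H} {S : H →L[ℂ] H}
    (h : Tendsto (fun i => ContinuousLinearMapWOT.ofCLM (T i)) l
      (𝓝 (ContinuousLinearMapWOT.ofCLM S))) (x y : H) :
    Tendsto (fun i => ⟪x, T i y⟫_ℂ) l (𝓝 ⟪x, S y⟫_ℂ) :=
  ContinuousLinearMapWOT.tendsto_iff_forall_inner_apply_tendsto.1 h y x

theorem ofCLM_sum {ι : Type*} (F : Finset ι) (T : ι → H →L[ℂ] H) :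
    ContinuousLinearMapWOT.ofCLM (∑ i ∈ F, T i)
      = ∑ i ∈ F, ContinuousLinearMapWOT.ofCLM (T i) :=
  map_sum (ContinuousLinearMapWOT.addEquiv (σ := RingHom.id ℂ) (E := H) (F := H)).symm T F

/-- A square summable family of operators assembles to an operator into the `ℓ²`-direct sum. -/
theorem exists_clm_lp {ι G : Type*} [NormedAddCommGroup G] [NormedSpace ℂ G]
    {T : ι → H →L[ℂ] G} {C : ℝ} (hC : 0 ≤ C)
    (h : ∀ x, ∑' i, ENNReal.ofReal (‖T i x‖ ^ 2) ≤ ENNReal.ofReal (C * ‖x‖ ^ 2)) :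
    ∃ V : H →L[ℂ] lp (fun _ : ι => G) 2, ∀ x i, V x i = T i x := by
  have hsum : ∀ x, HasSum (fun i => ‖T i x‖ ^ 2)
      (∑' i, ENNReal.ofReal (‖T i x‖ ^ 2)).toReal := fun x => by
    have := ENNReal.hasSum_toReal ((h x).trans_lt ENNReal.ofReal_lt_top).ne
    rw [ENNReal.tsum_toReal_eq fun i => ENNReal.ofReal_ne_top]
    simpa only [ENNReal.toReal_ofReal (sq_nonneg _)] using this
  let V0 : H →ₗ[ℂ] lp (fun _ : ι => G) 2 :=
    { toFun := fun x => ⟨fun i => T i x, memℓp_gen (by simpa using (hsum x).summable)⟩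
      map_add' := fun x y => by ext i; exact map_add _ x y
      map_smul' := fun a x => by ext i; exact map_smul _ a x }
  refine ⟨V0.mkContinuous (√C) fun x => ?_, fun x i => rfl⟩
  refine lp.norm_le_of_tsum_le (p := 2) (by norm_num) (by positivity) ?_
  have e : ∀ i, ‖(V0 x) i‖ ^ (ENNReal.toReal 2) = ‖T i x‖ ^ 2 := fun i => by
    simp [V0]
  simp_rw [e]
  rw [(hsum x).tsum_eq]
  have : (√C * ‖x‖) ^ (ENNReal.toReal 2) = C * ‖x‖ ^ 2 := by
    simp [mul_pow, Real.sq_sqrt hC]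
  rw [this]
  exact ENNReal.toReal_le_of_le_ofReal (by positivity) (h x)

variable [CompleteSpace H]

theorem hasSum_ofCLM_iff {ι : Type*} {T : ι → H →L[ℂ] H} {S : H →L[ℂ] H} :
    HasSum (fun i => ContinuousLinearMapWOT.ofCLM (T i)) (ContinuousLinearMapWOT.ofCLM S)
      ↔ ∀ x, HasSum (fun i => ⟪x, T i x⟫_ℂ) ⟪x, S x⟫_ℂ := by
  have e : ∀ x (F : Finset ι), ∑ i ∈ F, ⟪x, T i x⟫_ℂ = ⟪x, (∑ i ∈ F, T i) x⟫_ℂ := fun x F => by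
    rw [sum_apply, inner_sum]
  constructor
  · intro h x
    simp only [HasSum, SummationFilter.unconditional_filter, e]
    refine tendsto_inner_self_of_ofCLM ?_ x x
    simpa only [ofCLM_sum, HasSum, SummationFilter.unconditional_filter] using h
  · intro h
    have := tendsto_ofCLM_of_inner_self (l := atTop) (T := fun F : Finset ι => ∑ i ∈ F, T i)
      (S := S) (fun x => by
        simpa only [← e, HasSum, SummationFilter.unconditional_filter] using h x)
    simpa only [ofCLM_sum, HasSum, SummationFilter.unconditional_filter] using this

/-- For positive operators, weak operator summation is summation of quadratic forms. -/
theorem hasSum_ofCLM_iff_qform {ι : Type*} {T : ι → H →L[ℂ] H} {S : H →L[ℂ] H}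
    (hT : ∀ i, 0 ≤ T i) (hS : 0 ≤ S) :
    HasSum (fun i => ContinuousLinearMapWOT.ofCLM (T i)) (ContinuousLinearMapWOT.ofCLM S)
      ↔ ∀ x, qform S x = ∑' i, qform (T i) x := by
  rw [hasSum_ofCLM_iff]
  refine forall_congr' fun x => ?_
  simp_rw [fun i => inner_eq_toReal_qform (hT i) x]
  rw [inner_eq_toReal_qform hS, Complex.hasSum_ofReal]
  constructor
  · intro h
    rw [← ENNReal.ofReal_toReal (qform_lt_top S x).ne, ← h.tsum_eq,
      ENNReal.ofReal_tsum_of_nonneg (fun _ => ENNReal.toReal_nonneg) h.summable]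
    simp_rw [fun i => ENNReal.ofReal_toReal (qform_lt_top (T i) x).ne]
  · intro h
    rw [h, ENNReal.tsum_toReal_eq fun i => (qform_lt_top (T i) x).ne]
    exact ENNReal.hasSum_toReal (h ▸ (qform_lt_top S x).ne)

theorem tendsto_ofCLM_zero_iff_qform {T : ℕ → H →L[ℂ] H} (hT : ∀ i, 0 ≤ T i) :
    Tendsto (fun s => ContinuousLinearMapWOT.ofCLM (T s)) atTop (𝓝 (0 : H →WOT[ℂ] H))
      ↔ ∀ x, Tendsto (fun s => qform (T s) x) atTop (𝓝 0) := by
  have key : ∀ x, Tendsto (fun s => qform (T s) x) atTop (𝓝 0)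
      ↔ Tendsto (fun s => ⟪x, T s x⟫_ℂ) atTop (𝓝 ⟪x, (0 : H →L[ℂ] H) x⟫_ℂ) := fun x => by
    simp_rw [fun i => inner_eq_toReal_qform (hT i) x]
    rw [zero_apply, inner_zero_right, ← Complex.ofReal_zero,
      Filter.tendsto_ofReal_iff, ← ENNReal.toReal_zero,
      ENNReal.tendsto_toReal_iff (fun s => (qform_lt_top (T s) x).ne) ENNReal.zero_ne_top]
  simp_rw [key]
  exact ⟨fun h x => tendsto_inner_self_of_ofCLM (S := 0) h x x,
    fun h => tendsto_ofCLM_of_inner_self (S := 0) h⟩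

theorem inner_sqrt_apply {R : H →L[ℂ] H} (hR : 0 ≤ R) (x y : H) :
    ⟪CFC.sqrt R x, CFC.sqrt R y⟫_ℂ = ⟪x, R y⟫_ℂ := by
  have hs : ContinuousLinearMap.adjoint (CFC.sqrt R) = CFC.sqrt R :=
    IsSelfAdjoint.of_nonneg (CFC.sqrt_nonneg R)
  rw [← ContinuousLinearMap.adjoint_inner_right, hs, ← mul_apply_eq_comp,
    CFC.sqrt_mul_sqrt_self R hR]

theorem ofReal_norm_sq_sqrt_apply {R : H →L[ℂ] H} (hR : 0 ≤ R) (x : H) :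
    ENNReal.ofReal (‖CFC.sqrt R x‖ ^ 2) = qform R x := by
  rw [qform, ← inner_sqrt_apply hR, inner_self_eq_norm_sq_to_K]
  norm_cast

/-- A family of positive operators whose quadratic forms add up to a bounded form is summable in
the weak operator topology. The sum is `V* V`, where `V h = (T_i^{1/2} h)_i` maps into the
`ℓ²`-direct sum of copies of the space. -/
theorem exists_hasSum_ofCLM {ι : Type*} {T : ι → H →L[ℂ] H} (hT : ∀ i, 0 ≤ T i) {C : ℝ}
    (hC : 0 ≤ C) (h : ∀ x, ∑' i, qform (T i) x ≤ ENNReal.ofReal (C * ‖x‖ ^ 2)) :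
    ∃ S : H →L[ℂ] H, 0 ≤ S ∧
      HasSum (fun i => ContinuousLinearMapWOT.ofCLM (T i)) (ContinuousLinearMapWOT.ofCLM S) := by
  obtain ⟨V, hV0⟩ := exists_clm_lp (T := fun i => CFC.sqrt (T i)) hC
    (fun x => by simpa only [ofReal_norm_sq_sqrt_apply (hT _)] using h x)
  have hV : ∀ x y, HasSum (fun i => ⟪x, T i y⟫_ℂ) ⟪x, (ContinuousLinearMap.adjoint V ∘L V) y⟫_ℂ :=
    fun x y => by
      rw [ContinuousLinearMap.comp_apply, ContinuousLinearMap.adjoint_inner_right]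
      have := lp.hasSum_inner (𝕜 := ℂ) (V x) (V y)
      simpa only [hV0, inner_sqrt_apply (hT _)] using this
  refine ⟨ContinuousLinearMap.adjoint V ∘L V, ?_, hasSum_ofCLM_iff.2 fun x => hV x x⟩
  refine nonneg_iff_forall_inner.2 fun x => ?_
  rw [ContinuousLinearMap.comp_apply, ContinuousLinearMap.adjoint_inner_right,
    inner_self_eq_norm_sq_to_K]
  simp

end QuadraticForms

/-! ### The maps `Φ` on positive operators -/

section PhiPos

variable {n : ℕ} {H : Type*} [NormedAddCommGroup H] [InnerProductSpace ℂ H]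

theorem wordOp_one (A : Fin n → H →L[ℂ] H) : wordOp A 1 = 1 := rfl

theorem wordOp_mul (A : Fin n → H →L[ℂ] H) (α β : FreeMonoid (Fin n)) :
    wordOp A (α * β) = wordOp A α * wordOp A β := by
  simp [wordOp, FreeMonoid.toList_mul]

theorem wordOp_of (A : Fin n → H →L[ℂ] H) (j : Fin n) : wordOp A (FreeMonoid.of j) = A j := by
  simp [wordOp]

variable [CompleteSpace H]

theorem adjoint_wordOp_mul_apply (A : Fin n → H →L[ℂ] H) (α β : FreeMonoid (Fin n)) (h : H) :
    ContinuousLinearMap.adjoint (wordOp A (α * β)) h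
      = ContinuousLinearMap.adjoint (wordOp A β) (ContinuousLinearMap.adjoint (wordOp A α) h) := by
  rw [wordOp_mul, ContinuousLinearMap.mul_def, ContinuousLinearMap.adjoint_comp]
  rfl

/-- The action of `Φ_{f,A}` on quadratic forms, `q ↦ ∑ a_α q(A_α* ·)`. -/
def psi (f : PosRegular n) (A : Fin n → H →L[ℂ] H) (q : H → ℝ≥0∞) (h : H) : ℝ≥0∞ :=
  ∑' α, ENNReal.ofReal (f.coeff α) * q (ContinuousLinearMap.adjoint (wordOp A α) h)

theorem psi_mono (f : PosRegular n) (A : Fin n → H →L[ℂ] H) : Monotone (psi f A) :=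
  fun _ _ hq _ => ENNReal.tsum_le_tsum fun _ => by gcongr; exact hq _

theorem psi_add (f : PosRegular n) (A : Fin n → H →L[ℂ] H) (q r : H → ℝ≥0∞) :
    psi f A (q + r) = psi f A q + psi f A r := by
  funext h
  simp [psi, mul_add, ENNReal.tsum_add]

theorem psi_tsum (f : PosRegular n) (A : Fin n → H →L[ℂ] H) {ι : Type*} (q : ι → H → ℝ≥0∞) :
    psi f A (fun h => ∑' s, q s h) = fun h => ∑' s, psi f A (q s) h := by
  funext h
  simp only [psi, ← ENNReal.tsum_mul_left]
  exact ENNReal.tsum_comm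

theorem psi_const_mul (f : PosRegular n) (A : Fin n → H →L[ℂ] H) (c : ℝ≥0∞) (q : H → ℝ≥0∞) :
    psi f A (fun h => c * q h) = fun h => c * psi f A q h := by
  funext h
  simp only [psi, ← ENNReal.tsum_mul_left, mul_left_comm]

theorem exists_bound_of_phiWellDefined {f : PosRegular n} {A : Fin n → H →L[ℂ] H}
    (hΦ : PhiWellDefined f A) : ∃ C : ℝ, 0 ≤ C ∧ ∀ h,
      psi f A (qform 1) h ≤ ENNReal.ofReal (C * ‖h‖ ^ 2) := by
  have hpos : ∀ α, 0 ≤ (phiTerm f A 1 α).toCLM := fun α =>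
    smul_conj_nonneg (f.coeff_nonneg α) _ zero_le_one
  obtain ⟨S, hS⟩ := hΦ
  have hS' : HasSum (fun α => ContinuousLinearMapWOT.ofCLM (phiTerm f A 1 α).toCLM)
      (ContinuousLinearMapWOT.ofCLM S.toCLM) := hS
  have h0 : 0 ≤ S.toCLM := nonneg_iff_forall_inner.2 fun x =>
    (hasSum_ofCLM_iff.1 hS' x).nonneg fun α => nonneg_iff_forall_inner.1 (hpos α) x
  refine ⟨‖S.toCLM‖, norm_nonneg _, fun h => ?_⟩
  have := (hasSum_ofCLM_iff_qform hpos h0).1 hS' h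
  calc psi f A (qform 1) h = ∑' α, qform (phiTerm f A 1 α).toCLM h :=
        tsum_congr fun α => (qform_smul_conj (f.coeff_nonneg α) _ _ h).symm
    _ = qform S.toCLM h := this.symm
    _ ≤ _ := qform_le _ _

/-- If the form `∑ a_α ⟪A_α* h, X A_α* h⟫` is bounded, then the series defining `Φ_{f,A}(X)`
converges weakly, so that its value is not the default value of a divergent sum. -/
theorem hasSum_phiTerm {f : PosRegular n} {A : Fin n → H →L[ℂ] H} {C : ℝ} (hC : 0 ≤ C)
    {X : H →L[ℂ] H} (hX : 0 ≤ X)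
    (h : ∀ x, psi f A (qform X) x ≤ ENNReal.ofReal (C * ‖x‖ ^ 2)) :
    0 ≤ Phi f A X ∧
      HasSum (phiTerm f A X) (ContinuousLinearMapWOT.ofCLM (Phi f A X)) ∧
      qform (Phi f A X) = psi f A (qform X) := by
  have hpos : ∀ α, 0 ≤ (phiTerm f A X α).toCLM := fun α =>
    smul_conj_nonneg (f.coeff_nonneg α) _ hX
  have e : ∀ x, ∑' α, qform (phiTerm f A X α).toCLM x = psi f A (qform X) x := fun x =>
    tsum_congr fun α => qform_smul_conj (f.coeff_nonneg α) _ _ x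
  obtain ⟨S, hS, hsum⟩ := exists_hasSum_ofCLM hpos hC (fun x => (e x).trans_le (h x))
  have hsum' : HasSum (phiTerm f A X) (ContinuousLinearMapWOT.ofCLM S) := hsum
  have hphi : Phi f A X = S := by
    rw [Phi, hsum'.tsum_eq]
  refine ⟨hphi ▸ hS, hphi ▸ hsum', ?_⟩
  funext x
  rw [hphi, (hasSum_ofCLM_iff_qform hpos hS).1 hsum x, e]

/-- Well-definedness at `I` suffices for every positive operator, by `X ≤ ‖X‖ I`. -/
theorem phi_spec {f : PosRegular n} {A : Fin n → H →L[ℂ] H} (hΦ : PhiWellDefined f A)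
    {X : H →L[ℂ] H} (hX : 0 ≤ X) :
    0 ≤ Phi f A X ∧
      HasSum (phiTerm f A X) (ContinuousLinearMapWOT.ofCLM (Phi f A X)) ∧
      qform (Phi f A X) = psi f A (qform X) := by
  obtain ⟨C, hC, h⟩ := exists_bound_of_phiWellDefined hΦ
  refine hasSum_phiTerm (C := ‖X‖ * C) (by positivity) hX fun x => ?_
  calc psi f A (qform X) x ≤ psi f A (fun y => ENNReal.ofReal ‖X‖ * qform 1 y) x :=
        psi_mono f A (fun y => qform_le_norm_mul_qform_one X y) x
    _ = ENNReal.ofReal ‖X‖ * psi f A (qform 1) x := by rw [psi_const_mul]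
    _ ≤ ENNReal.ofReal ‖X‖ * ENNReal.ofReal (C * ‖x‖ ^ 2) := by gcongr; exact h x
    _ = ENNReal.ofReal (‖X‖ * C * ‖x‖ ^ 2) := by
        rw [← ENNReal.ofReal_mul (norm_nonneg _), mul_assoc]

theorem phi_iterate_spec {f : PosRegular n} {A : Fin n → H →L[ℂ] H} (hΦ : PhiWellDefined f A)
    {X : H →L[ℂ] H} (hX : 0 ≤ X) (s : ℕ) :
    0 ≤ (Phi f A)^[s] X ∧ qform ((Phi f A)^[s] X) = (psi f A)^[s] (qform X) := by
  induction s with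
  | zero => exact ⟨hX, rfl⟩
  | succ s ih =>
    rw [Function.iterate_succ_apply', Function.iterate_succ_apply', ← ih.2]
    exact ⟨(phi_spec hΦ ih.1).1, (phi_spec hΦ ih.1).2.2⟩

end PhiPos

/-! ### The coefficients `b` as sums over factorizations -/

section Coefficients

variable {n : ℕ}

/-- The pairing of the `s`-th convolution power of `a` with a function `g` on words:
`∑ a_{γ₁} ⋯ a_{γ_s} g(γ₁ ⋯ γ_s)` over all `s`-tuples of words. -/
def convPow (a : FreeMonoid (Fin n) → ℝ≥0∞) : ℕ → (FreeMonoid (Fin n) → ℝ≥0∞) → ℝ≥0∞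
  | 0, g => g 1
  | s + 1, g => ∑' α, a α * convPow a s (fun β => g (α * β))

theorem convPow_eq_tsum_fin (a : FreeMonoid (Fin n) → ℝ≥0∞) (s : ℕ)
    (g : FreeMonoid (Fin n) → ℝ≥0∞) :
    convPow a s g
      = ∑' v : Fin s → FreeMonoid (Fin n), ((List.ofFn v).map a).prod * g (List.ofFn v).prod := by
  induction s generalizing g with
  | zero => simp [convPow]
  | succ s ih =>
    rw [convPow, ← (Fin.consEquiv fun _ : Fin (s + 1) => FreeMonoid (Fin n)).tsum_eq,
      ENNReal.tsum_prod']
    refine tsum_congr fun α => ?_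
    rw [ih, ← ENNReal.tsum_mul_left]
    refine tsum_congr fun v => ?_
    simp [Fin.consEquiv, List.ofFn_succ, mul_assoc]

theorem tsum_mul_convPow (a : FreeMonoid (Fin n) → ℝ≥0∞) (w : ℕ → ℝ≥0∞)
    (g : FreeMonoid (Fin n) → ℝ≥0∞) :
    ∑' s, w s * convPow a s g
      = ∑' L : List (FreeMonoid (Fin n)), w L.length * (L.map a).prod * g L.prod := by
  rw [← List.equivSigmaTuple.symm.tsum_eq, ENNReal.tsum_sigma']
  refine tsum_congr fun s => ?_
  rw [convPow_eq_tsum_fin, ← ENNReal.tsum_mul_left]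
  refine tsum_congr fun v => ?_
  simp [List.equivSigmaTuple, mul_assoc]

theorem exists_splitWrtComposition_eq {ι : Type*} (L : List (List ι)) (hL : ∀ l ∈ L, l ≠ [])
    {l : List ι} (h : L.flatten = l) :
    ∃ c : Composition l.length, l.splitWrtComposition c = L := by
  subst h
  refine ⟨⟨L.map List.length, fun {i} hi => ?_, by rw [List.length_flatten]⟩,
    List.splitWrtComposition_flatten _ _ rfl⟩
  obtain ⟨l, hl, rfl⟩ := List.mem_map.1 hi
  exact List.length_pos_of_ne_nil (hL l hl)

/-- The coefficient `b_α` as a sum over all lists of words with product `α`: the lists containing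
the empty word contribute nothing, and the others are the compositions of the length of `α`. -/
theorem ofReal_bCoeff (f : PosRegular n) (m : ℕ) (α : FreeMonoid (Fin n)) :
    ENNReal.ofReal (bCoeff f m α)
      = ∑' L : {L : List (FreeMonoid (Fin n)) // L.prod = α},
          ((L.1.length + m - 1).choose (m - 1) : ℝ≥0∞)
            * (L.1.map fun γ => ENNReal.ofReal (f.coeff γ)).prod := by
  let e : Composition (FreeMonoid.toList α).length →
      {L : List (FreeMonoid (Fin n)) // L.prod = α} := fun c =>
    ⟨((FreeMonoid.toList α).splitWrtComposition c).map FreeMonoid.ofList, by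
      rw [← FreeMonoid.ofList_flatten, List.flatten_splitWrtComposition,
        FreeMonoid.ofList_toList]⟩
  have he : Function.Injective e := by
    intro c d h
    have h1 : (FreeMonoid.toList α).splitWrtComposition c
        = (FreeMonoid.toList α).splitWrtComposition d :=
      List.map_injective_iff.2 FreeMonoid.ofList.injective (congrArg Subtype.val h)
    have h2 := congrArg (List.map List.length) h1
    rw [List.map_length_splitWrtComposition, List.map_length_splitWrtComposition] at h2
    exact Composition.ext h2
  have hsupp : Function.support (fun L : {L : List (FreeMonoid (Fin n)) // L.prod = α} =>
      ((L.1.length + m - 1).choose (m - 1) : ℝ≥0∞)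
            * (L.1.map fun γ => ENNReal.ofReal (f.coeff γ)).prod) ⊆ Set.range e := by
    rintro ⟨L, hL⟩ hne
    have h1 : ∀ l ∈ L.map FreeMonoid.toList, l ≠ [] := by
      intro l hl hnil
      obtain ⟨γ, hγ, rfl⟩ := List.mem_map.1 hl
      have hγ1 : γ = 1 := FreeMonoid.toList.injective hnil
      refine hne ?_
      have : (L.map fun γ => ENNReal.ofReal (f.coeff γ)).prod = 0 :=
        List.prod_eq_zero (List.mem_map.2 ⟨γ, hγ, by rw [hγ1, f.coeff_one, ENNReal.ofReal_zero]⟩)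
      simp [this]
    obtain ⟨c, hc⟩ := exists_splitWrtComposition_eq (L.map FreeMonoid.toList) h1
      (l := FreeMonoid.toList α) (by rw [← hL, FreeMonoid.toList_prod])
    refine ⟨c, Subtype.ext ?_⟩
    change ((FreeMonoid.toList α).splitWrtComposition c).map FreeMonoid.ofList = L
    rw [hc, List.map_map]
    simp
  rw [← he.tsum_eq hsupp, tsum_fintype, bCoeff, ENNReal.ofReal_sum_of_nonneg]
  · refine Finset.sum_congr rfl fun c _ => ?_
    have hnn : ∀ l : List (List (Fin n)),
        ENNReal.ofReal (l.map fun γ => f.coeff (FreeMonoid.ofList γ)).prod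
          = (l.map fun γ => ENNReal.ofReal (f.coeff (FreeMonoid.ofList γ))).prod := by
      intro l
      induction l with
      | nil => simp
      | cons γ l ih => simp [ENNReal.ofReal_mul (f.coeff_nonneg _), ih]
    rw [ENNReal.ofReal_mul' (Nat.cast_nonneg _), hnn, ENNReal.ofReal_natCast, mul_comm]
    congr 2
    · simp [e, List.length_splitWrtComposition]
    · simp [e, Function.comp_def]
  · intro c _
    refine mul_nonneg (List.prod_nonneg ?_) (Nat.cast_nonneg _)
    intro x hx
    obtain ⟨γ, -, rfl⟩ := List.mem_map.1 hx
    exact f.coeff_nonneg _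

/-- The binomial weight `C(s + m - 1, m - 1)`, the `s`-th coefficient of `(1 - x)^{-m}`;
for `m = 0` it is the coefficient of `1`. -/
def binomWeight : ℕ → ℕ → ℝ≥0∞
  | 0, s => if s = 0 then 1 else 0
  | m + 1, s => (s + m).choose m

theorem binomWeight_eq_choose {m : ℕ} (hm : 0 < m) (s : ℕ) :
    binomWeight m s = ((s + m - 1).choose (m - 1) : ℝ≥0∞) := by
  obtain ⟨m, rfl⟩ := Nat.exists_eq_succ_of_ne_zero hm.ne'
  rfl

theorem binomWeight_zero_right (m : ℕ) : binomWeight m 0 = 1 := by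
  cases m <;> simp [binomWeight]

theorem binomWeight_succ_succ (m s : ℕ) :
    binomWeight (m + 1) (s + 1) = binomWeight m (s + 1) + binomWeight (m + 1) s := by
  cases m with
  | zero => simp [binomWeight]
  | succ m =>
    simp only [binomWeight]
    rw [← Nat.cast_add]
    congr 1
    rw [show s + 1 + (m + 1) = (s + 1 + m) + 1 by ring, Nat.choose_succ_succ,
      show s + (m + 1) = s + 1 + m by ring]

open Classical in
/-- The coefficient `b_α^{(m)}` in `[0, ∞]`, with the convention that `b^{(0)}` is the
indicator function of the empty word, as for `(1 - f)^{-m}` with `m = 0`. -/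
def bWord (f : PosRegular n) (m : ℕ) (α : FreeMonoid (Fin n)) : ℝ≥0∞ :=
  if m = 0 then (if α = 1 then 1 else 0) else ENNReal.ofReal (bCoeff f m α)

theorem bWord_of_pos (f : PosRegular n) {m : ℕ} (hm : 0 < m) (α : FreeMonoid (Fin n)) :
    bWord f m α = ENNReal.ofReal (bCoeff f m α) := by
  rw [bWord, if_neg hm.ne']

theorem bWord_one (f : PosRegular n) (m : ℕ) : bWord f m 1 = 1 := by
  by_cases h : m = 0 <;> simp [bWord, h, bCoeff_one]

/-- `b^{(m)} = ∑ C(s + m - 1, m - 1) a^s`, for the convolution powers `a^s` of the coefficients. -/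
theorem tsum_bWord_mul (f : PosRegular n) (m : ℕ) (g : FreeMonoid (Fin n) → ℝ≥0∞) :
    ∑' α, bWord f m α * g α
      = ∑' s, binomWeight m s * convPow (fun γ => ENNReal.ofReal (f.coeff γ)) s g := by
  rcases Nat.eq_zero_or_pos m with rfl | hm
  · rw [tsum_eq_single 1, tsum_eq_single 0]
    · simp [bWord, binomWeight, convPow]
    · intro s hs
      simp [binomWeight, hs]
    · intro α hα
      simp [bWord, hα]
  · rw [tsum_mul_convPow, ← (Equiv.sigmaFiberEquiv
      (fun L : List (FreeMonoid (Fin n)) => L.prod)).tsum_eq, ENNReal.tsum_sigma']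
    refine tsum_congr fun α => ?_
    rw [bWord_of_pos f hm, ofReal_bCoeff, ← ENNReal.tsum_mul_right]
    refine tsum_congr fun L => ?_
    rw [Equiv.sigmaFiberEquiv_apply, L.2, binomWeight_eq_choose hm]

/-- The identity `b^{(m+1)} = b^{(m)} + a * b^{(m+1)}` for the convolution product, paired with a
function on words. -/
theorem tsum_bWord_succ_mul (f : PosRegular n) (m : ℕ) (g : FreeMonoid (Fin n) → ℝ≥0∞) :
    ∑' β, bWord f (m + 1) β * g β
      = ∑' β, bWord f m β * g β
        + ∑' α, ENNReal.ofReal (f.coeff α) * ∑' β, bWord f (m + 1) β * g (α * β) := by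
  have h3 : ∑' α, ENNReal.ofReal (f.coeff α) * ∑' β, bWord f (m + 1) β * g (α * β)
      = ∑' s, binomWeight (m + 1) s
        * convPow (fun γ => ENNReal.ofReal (f.coeff γ)) (s + 1) g := by
    simp_rw [tsum_bWord_mul, ← ENNReal.tsum_mul_left]
    rw [ENNReal.tsum_comm]
    refine tsum_congr fun s => ?_
    rw [convPow, ← ENNReal.tsum_mul_left]
    exact tsum_congr fun α => mul_left_comm _ _ _
  rw [h3, tsum_bWord_mul, tsum_bWord_mul, tsum_eq_zero_add' ENNReal.summable,
    tsum_eq_zero_add' (f := fun s => binomWeight m s * _) ENNReal.summable, add_assoc,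
    ← ENNReal.tsum_add]
  simp_rw [binomWeight_succ_succ, add_mul, binomWeight_zero_right]

theorem bCoeff_pos (f : PosRegular n) (m : ℕ) (α : FreeMonoid (Fin n)) : 0 < bCoeff f m α := by
  induction α using FreeMonoid.recOn with
  | one => simp [bCoeff_one]
  | of_mul j α ih =>
    exact (mul_pos (f.coeff_of_pos j) ih).trans_le (coeff_mul_bCoeff_le f m j α)

end Coefficients

/-! ### Reconstruction of an element of the pure cone from its defect -/

section Reconstruction

variable {H : Type*} [NormedAddCommGroup H] [InnerProductSpace ℂ H]

theorem qform_ofReal_smul {c : ℝ} (hc : 0 ≤ c) (X : H →L[ℂ] H) (h : H) :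
    qform ((c : ℂ) • X) h = ENNReal.ofReal c * qform X h := by
  rw [qform, qform, ← ENNReal.ofReal_mul hc, smul_apply, inner_smul_right, Complex.re_ofReal_mul]

theorem ofReal_smul_nonneg {c : ℝ} (hc : 0 ≤ c) {X : H →L[ℂ] H} (hX : 0 ≤ X) :
    0 ≤ (c : ℂ) • X := by
  refine nonneg_iff_forall_inner.2 fun h => ?_
  rw [smul_apply, inner_smul_right]
  exact mul_nonneg (by exact_mod_cast hc) (nonneg_iff_forall_inner.1 hX _)

theorem compIter_succ {k : ℕ} (ψ : Fin (k + 1) → (H →L[ℂ] H) → (H →L[ℂ] H))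
    (p : Fin (k + 1) → ℕ) (X : H →L[ℂ] H) :
    compIter ψ p X = (ψ 0)^[p 0] (compIter (fun i => ψ i.succ) (fun i => p i.succ) X) := by
  simp [compIter, List.ofFn_succ]

theorem multiOp_cons {k : ℕ} {n : Fin (k + 1) → ℕ} (A : ∀ i, Fin (n i) → H →L[ℂ] H)
    (α : FreeMonoid (Fin (n 0))) (β : Words fun i : Fin k => n i.succ) :
    multiOp A (Fin.cons α β : Words n) = wordOp (A 0) α * multiOp (fun i => A i.succ) β := by
  simp [multiOp, List.ofFn_succ]

theorem commute_wordOp {k : ℕ} {n : Fin k → ℕ} {A : ∀ i, Fin (n i) → H →L[ℂ] H}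
    (hA : CommutingTuples A) {i j : Fin k} (hij : i ≠ j) (α : FreeMonoid (Fin (n i)))
    (β : FreeMonoid (Fin (n j))) : Commute (wordOp (A i) α) (wordOp (A j) β) := by
  refine Commute.list_prod_left _ _ fun T hT => Commute.list_prod_right _ _ fun U hU => ?_
  obtain ⟨s, -, rfl⟩ := List.mem_map.1 hT
  obtain ⟨t, -, rfl⟩ := List.mem_map.1 hU
  exact hA i j hij s t

theorem commute_wordOp_multiOp {k : ℕ} {n : Fin (k + 1) → ℕ} {A : ∀ i, Fin (n i) → H →L[ℂ] H}
    (hA : CommutingTuples A) (α : FreeMonoid (Fin (n 0))) (β : Words fun i : Fin k => n i.succ) :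
    Commute (wordOp (A 0) α) (multiOp (fun i => A i.succ) β) := by
  refine Commute.list_prod_right _ _ fun T hT => ?_
  obtain ⟨i, rfl⟩ := (List.mem_ofFn' _ _).1 hT
  exact commute_wordOp hA (Fin.succ_ne_zero i).symm _ _

variable [CompleteSpace H]

theorem multiOpStar_cons {k : ℕ} {n : Fin (k + 1) → ℕ} (A : ∀ i, Fin (n i) → H →L[ℂ] H)
    (α : FreeMonoid (Fin (n 0))) (β : Words fun i : Fin k => n i.succ) :
    multiOpStar A (Fin.cons α β : Words n)
      = ContinuousLinearMap.adjoint (wordOp (A 0) α) * multiOpStar (fun i => A i.succ) β := by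
  simp [multiOpStar, List.ofFn_succ]

theorem adjoint_one_eq : ContinuousLinearMap.adjoint (1 : H →L[ℂ] H) = 1 := star_one _

theorem adjoint_mul_eq (T U : H →L[ℂ] H) :
    ContinuousLinearMap.adjoint (T * U)
      = ContinuousLinearMap.adjoint U * ContinuousLinearMap.adjoint T :=
  ContinuousLinearMap.adjoint_comp T U

theorem convPow_adjoint_wordOp {n : ℕ} (f : PosRegular n) (A : Fin n → H →L[ℂ] H) (s : ℕ)
    (q : H → ℝ≥0∞) (h : H) :
    convPow (fun γ => ENNReal.ofReal (f.coeff γ)) s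
        (fun α => q (ContinuousLinearMap.adjoint (wordOp A α) h)) = (psi f A)^[s] q h := by
  induction s generalizing h with
  | zero =>
    simp only [convPow, wordOp_one, Function.iterate_zero, id]
    congr 1
    exact congrArg (· h) (star_one (H →L[ℂ] H))
  | succ s ih =>
    rw [convPow, Function.iterate_succ_apply', psi]
    refine tsum_congr fun α => ?_
    simp_rw [adjoint_wordOp_mul_apply]
    rw [ih]

/-- Summing over words with the weights `b_α` is summing over iterates of `Φ` with binomial
weights. -/
theorem tsum_bWord_mul_adjoint {n : ℕ} (f : PosRegular n) (A : Fin n → H →L[ℂ] H) (m : ℕ)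
    (q : H → ℝ≥0∞) (h : H) :
    ∑' α, bWord f m α * q (ContinuousLinearMap.adjoint (wordOp A α) h)
      = ∑' s, binomWeight m s * (psi f A)^[s] q h := by
  rw [tsum_bWord_mul f m fun α => q (ContinuousLinearMap.adjoint (wordOp A α) h)]
  simp_rw [convPow_adjoint_wordOp]

theorem psi_iterate_tsum {n : ℕ} (f : PosRegular n) (A : Fin n → H →L[ℂ] H) {ι : Type*}
    (q : ι → H → ℝ≥0∞) (s : ℕ) :
    (psi f A)^[s] (fun h => ∑' i, q i h) = fun h => ∑' i, (psi f A)^[s] (q i) h := by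
  induction s with
  | zero => rfl
  | succ s ih => simp_rw [Function.iterate_succ_apply', ih, psi_tsum]

theorem psi_iterate_const_mul {n : ℕ} (f : PosRegular n) (A : Fin n → H →L[ℂ] H) (c : ℝ≥0∞)
    (q : H → ℝ≥0∞) (s : ℕ) :
    (psi f A)^[s] (fun h => c * q h) = fun h => c * (psi f A)^[s] q h := by
  induction s with
  | zero => rfl
  | succ s ih => simp_rw [Function.iterate_succ_apply', ih, psi_const_mul]

theorem sum_range_binomWeight (m u : ℕ) :
    ∑ s ∈ Finset.range (u + 1), binomWeight m s = binomWeight (m + 1) u := by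
  induction u with
  | zero => simp [binomWeight_zero_right]
  | succ u ih => rw [Finset.sum_range_succ, ih, binomWeight_succ_succ, add_comm]

/-- If `q = r + ψ q` and the iterates `ψ^s q` tend to `0`, then `q = ∑ ψ^s r`. -/
theorem eq_tsum_psi_iterate {n : ℕ} (f : PosRegular n) (A : Fin n → H →L[ℂ] H)
    {q r : H → ℝ≥0∞} (h : q = r + psi f A q)
    (hq : ∀ x, Tendsto (fun s => (psi f A)^[s] q x) atTop (𝓝 0)) :
    q = fun x => ∑' s, (psi f A)^[s] r x := by
  have hadd : ∀ N, (psi f A)^[N] (r + psi f A q) = (psi f A)^[N] r + (psi f A)^[N + 1] q := by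
    intro N
    induction N with
    | zero => rfl
    | succ N ih =>
      rw [Function.iterate_succ_apply', ih, psi_add, Function.iterate_succ_apply' _ N r,
        Function.iterate_succ_apply' _ (N + 1) q]
  have hN : ∀ N x, q x = ∑ s ∈ Finset.range N, (psi f A)^[s] r x + (psi f A)^[N] q x := by
    intro N x
    induction N with
    | zero => simp
    | succ N ih =>
      rw [Finset.sum_range_succ, add_assoc, ih]
      congr 1
      conv_lhs => rw [h]
      rw [hadd]
      rfl
  funext x
  have h1 : Tendsto (fun N => ∑ s ∈ Finset.range N, (psi f A)^[s] r x + (psi f A)^[N] q x) atTop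
      (𝓝 (∑' s, (psi f A)^[s] r x + 0)) :=
    (ENNReal.tendsto_nat_tsum _).add (hq x)
  simp_rw [← hN, add_zero] at h1
  exact tendsto_nhds_unique tendsto_const_nhds h1

/-- The expansion `q₀ = ∑ C(s + m - 1, m - 1) ψ^s q_m`, for `q_j = (id - ψ)^j q₀`. -/
theorem eq_tsum_binomWeight_psi_iterate {n : ℕ} (f : PosRegular n) (A : Fin n → H →L[ℂ] H)
    (m : ℕ) (q : ℕ → H → ℝ≥0∞) (hq : ∀ j < m, q j = q (j + 1) + psi f A (q j))
    (h0 : ∀ x, Tendsto (fun s => (psi f A)^[s] (q 0) x) atTop (𝓝 0)) (x : H) :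
    q 0 x = ∑' s, binomWeight m s * (psi f A)^[s] (q m) x := by
  induction m with
  | zero =>
    rw [tsum_eq_single 0 fun s hs => by simp [binomWeight, hs]]
    simp [binomWeight]
  | succ m ih =>
    have hle : ∀ j ≤ m, q j ≤ q 0 := by
      intro j hj
      induction j with
      | zero => exact le_rfl
      | succ j ihj =>
        refine le_trans ?_ (ihj (by omega))
        rw [hq j (by omega)]
        exact le_self_add
    have h1 : q m = fun x => ∑' s, (psi f A)^[s] (q (m + 1)) x :=
      eq_tsum_psi_iterate f A (hq m (by omega)) fun y =>
        tendsto_of_tendsto_of_tendsto_of_le_of_le tendsto_const_nhds (h0 y)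
          (fun _ => zero_le) (fun s => (psi_mono f A).iterate s (hle m le_rfl) y)
    rw [ih fun j hj => hq j (by omega), h1]
    simp_rw [psi_iterate_tsum, ← Function.iterate_add_apply, ← ENNReal.tsum_mul_left]
    rw [← ENNReal.tsum_prod' (f := fun p : ℕ × ℕ =>
        binomWeight m p.1 * (psi f A)^[p.1 + p.2] (q (m + 1)) x),
      ← (Finset.HasAntidiagonal.sigmaAntidiagonalEquivProd (A := ℕ)).tsum_eq, ENNReal.tsum_sigma']
    refine tsum_congr fun u => ?_
    have hu : ∀ p : Finset.HasAntidiagonal.antidiagonal u,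
        binomWeight m p.1.1 * (psi f A)^[p.1.1 + p.1.2] (q (m + 1)) x
          = binomWeight m p.1.1 * (psi f A)^[u] (q (m + 1)) x := fun p => by
      rw [Finset.HasAntidiagonal.mem_antidiagonal.1 p.2]
    simp only [Finset.HasAntidiagonal.sigmaAntidiagonalEquivProd_apply, hu]
    rw [tsum_fintype (β := Finset.HasAntidiagonal.antidiagonal u), ← sum_range_binomWeight,
      Finset.sum_mul, ← Finset.Nat.sum_antidiagonal_eq_sum_range_succ
        (fun s _ => binomWeight m s * (psi f A)^[u] (q (m + 1)) x)]
    exact Finset.sum_coe_sort (Finset.HasAntidiagonal.antidiagonal u)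
      fun p => binomWeight m p.1 * (psi f A)^[u] (q (m + 1)) x

/-- An element `D` of the pure cone is recovered from its defect `R`, in terms of quadratic forms:
`D = ∑ b_{1,β₁} ⋯ b_{k,β_k} A_β R A_β*`. The maps `Φ_1, …, Φ_k` are peeled off one at a time. -/
theorem qform_eq_tsum_multiOpStar {k : ℕ} {n : Fin k → ℕ} (f : ∀ i, PosRegular (n i))
    (m : Fin k → ℕ) (A : ∀ i, Fin (n i) → H →L[ℂ] H) (hΦ : ∀ i, PhiWellDefined (f i) (A i))
    {D : H →L[ℂ] H} (hD : ∀ p ≤ m, 0 ≤ defect f A p D)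
    (hpure : ∀ i x, Tendsto (fun s => (psi (f i) (A i))^[s] (qform D) x) atTop (𝓝 0)) (h : H) :
    qform D h = ∑' β : Words n, (∏ i, bWord (f i) (m i) (β i))
      * qform (defect f A m D) (multiOpStar A β h) := by
  induction k generalizing h with
  | zero =>
    rw [tsum_eq_single default fun β hβ => (hβ (Subsingleton.elim _ _)).elim]
    simp [multiOpStar, defect, compIter]
  | succ k ih =>
    have htail : ∀ (t : ℕ) (p : Fin k → ℕ), defect f A (Fin.cons t p) D
        = (fun X => X - Phi (f 0) (A 0) X)^[t]
            (defect (fun i => f i.succ) (fun i => A i.succ) p D) := fun t p => by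
      simp [defect, compIter_succ]
    have hle : ∀ (t : ℕ) (p : Fin k → ℕ), t ≤ m 0 → (p ≤ fun i => m i.succ) →
        (Fin.cons t p : Fin (k + 1) → ℕ) ≤ m := fun t p ht hp i => by
      refine Fin.cases ?_ (fun i => ?_) i
      · simpa using ht
      · simpa using hp i
    have ih' := ih (fun i => f i.succ) (fun i => m i.succ) (fun i => A i.succ)
      (fun i => hΦ i.succ)
      (fun p hp => by simpa [htail] using hD _ (hle 0 p (Nat.zero_le _) hp))
      (fun i => hpure i.succ)
    set R' := defect (fun i => f i.succ) (fun i => A i.succ) (fun i => m i.succ) D with hR'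
    have hR : ∀ t ≤ m 0, 0 ≤ (fun X => X - Phi (f 0) (A 0) X)^[t] R' := fun t ht => by
      rw [hR', ← htail]
      exact hD _ (hle t _ ht le_rfl)
    have hRm : defect f A m D = (fun X => X - Phi (f 0) (A 0) X)^[m 0] R' := by
      rw [hR', ← htail]
      congr 1
      exact (Fin.cons_self_tail m).symm
    -- the word `1` contributes `R'` to the expansion of `D`, hence `R' ≤ D`
    have hRD : qform R' ≤ qform D := fun x => by
      rw [ih' x]
      refine le_trans (le_of_eq ?_) (ENNReal.le_tsum (1 : Words fun i : Fin k => n i.succ))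
      have : multiOpStar (fun i => A i.succ) (1 : Words fun i : Fin k => n i.succ) = 1 := by
        refine List.prod_eq_one fun T hT => ?_
        obtain ⟨i, rfl⟩ := (List.mem_ofFn' _ _).1 hT
        exact star_one _
      simp [bWord_one, this]
    have hsingle := eq_tsum_binomWeight_psi_iterate (f 0) (A 0) (m 0)
      (fun t => qform ((fun X => X - Phi (f 0) (A 0) X)^[t] R'))
      (fun t ht => by
        funext x
        have h1 := hR (t + 1) (by omega)
        have h2 := phi_spec (hΦ 0) (hR t (by omega))
        rw [Function.iterate_succ_apply'] at h1
        simp only [Function.iterate_succ_apply', Pi.add_apply]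
        rw [qform_eq_qform_sub_add h2.1 h1, h2.2.2])
      (fun x => tendsto_of_tendsto_of_tendsto_of_le_of_le tendsto_const_nhds (hpure 0 x)
          (fun _ => zero_le) (fun s => (psi_mono (f 0) (A 0)).iterate s hRD x))
    simp_rw [← tsum_bWord_mul_adjoint, Function.iterate_zero, id, ← hRm] at hsingle
    rw [ih' h, ← (Fin.consEquiv fun i => FreeMonoid (Fin (n i))).tsum_eq, ENNReal.tsum_prod',
      ENNReal.tsum_comm]
    refine tsum_congr fun β => ?_
    rw [hsingle, ← ENNReal.tsum_mul_left]
    refine tsum_congr fun α => ?_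
    simp only [Fin.consEquiv, Equiv.coe_fn_mk, Fin.prod_univ_succ, Fin.cons_zero, Fin.cons_succ]
    rw [multiOpStar_cons, mul_apply_eq_comp]
    ring

theorem compIter_phi_nonneg {k : ℕ} {n : Fin k → ℕ} {f : ∀ i, PosRegular (n i)}
    {A : ∀ i, Fin (n i) → H →L[ℂ] H} (hΦ : ∀ i, PhiWellDefined (f i) (A i))
    {R : H →L[ℂ] H} (hR : 0 ≤ R) (s : Fin k → ℕ) :
    0 ≤ compIter (fun i => Phi (f i) (A i)) s R := by
  induction k with
  | zero => simpa [compIter] using hR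
  | succ k ih =>
    rw [compIter_succ]
    exact (phi_iterate_spec (hΦ 0) (ih (fun i => hΦ i.succ) _) _).1

/-- The sum over multi-words with weights `b` equals the sum over iterates of `Φ_1, …, Φ_k` with
binomial weights. -/
theorem tsum_multiOp_adjoint_eq_tsum_compIter {k : ℕ} {n : Fin k → ℕ}
    {f : ∀ i, PosRegular (n i)} (m : Fin k → ℕ) {A : ∀ i, Fin (n i) → H →L[ℂ] H}
    (hΦ : ∀ i, PhiWellDefined (f i) (A i)) {R : H →L[ℂ] H} (hR : 0 ≤ R) (h : H) :
    ∑' β : Words n, (∏ i, bWord (f i) (m i) (β i))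
        * qform R (ContinuousLinearMap.adjoint (multiOp A β) h)
      = ∑' s : Fin k → ℕ, (∏ i, binomWeight (m i) (s i))
        * qform (compIter (fun i => Phi (f i) (A i)) s R) h := by
  induction k generalizing h with
  | zero =>
    rw [tsum_eq_single default fun β hβ => (hβ (Subsingleton.elim _ _)).elim,
      tsum_eq_single default fun β hβ => (hβ (Subsingleton.elim _ _)).elim]
    have : ∀ β : Words n, ContinuousLinearMap.adjoint (multiOp A β) = 1 := fun β => by
      simp [multiOp, adjoint_one_eq]
    simp [compIter, this]
  | succ k ih =>
    have ih' := fun y => ih (f := fun i => f i.succ) (fun i => m i.succ)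
      (A := fun i => A i.succ) (fun i => hΦ i.succ) y
    rw [← (Fin.consEquiv fun i => FreeMonoid (Fin (n i))).tsum_eq, ENNReal.tsum_prod',
      ← (Fin.consEquiv fun _ : Fin (k + 1) => ℕ).tsum_eq, ENNReal.tsum_prod']
    have h1 : ∀ s (s' : Fin k → ℕ),
        qform (compIter (fun i => Phi (f i) (A i)) (Fin.cons s s' : Fin (k + 1) → ℕ) R)
          = (psi (f 0) (A 0))^[s]
            (qform (compIter (fun i : Fin k => Phi (f i.succ) (A i.succ)) s' R)) := fun s s' => by
      rw [compIter_succ]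
      simp only [Fin.cons_zero, Fin.cons_succ]
      exact (phi_iterate_spec (hΦ 0) (compIter_phi_nonneg (fun i => hΦ i.succ) hR s') s).2
    have h2 : ∀ α (β : Words fun i : Fin k => n i.succ),
        ContinuousLinearMap.adjoint (multiOp A (Fin.cons α β : Words n)) h
          = ContinuousLinearMap.adjoint (multiOp (fun i => A i.succ) β)
              (ContinuousLinearMap.adjoint (wordOp (A 0) α) h) := fun α β => by
      rw [multiOp_cons, adjoint_mul_eq, mul_apply_eq_comp]
    simp only [Fin.consEquiv, Equiv.coe_fn_mk, Fin.prod_univ_succ, Fin.cons_zero, Fin.cons_succ,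
      h1, h2, mul_assoc, ENNReal.tsum_mul_left, ih']
    rw [tsum_bWord_mul_adjoint (f 0) (A 0) (m 0) (fun y => ∑' s' : Fin k → ℕ,
      (∏ i : Fin k, binomWeight (m i.succ) (s' i))
        * qform (compIter (fun i : Fin k => Phi (f i.succ) (A i.succ)) s' R) y)]
    simp_rw [psi_iterate_tsum, psi_iterate_const_mul]

/-- The adjoint reverses the order of the factors, and commutativity restores it. -/
theorem adjoint_multiOp {k : ℕ} {n : Fin k → ℕ} {A : ∀ i, Fin (n i) → H →L[ℂ] H}
    (hA : CommutingTuples A) (β : Words n) :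
    ContinuousLinearMap.adjoint (multiOp A β) = multiOpStar A β := by
  induction k with
  | zero => simp [multiOp, multiOpStar, adjoint_one_eq]
  | succ k ih =>
    rw [← Fin.cons_self_tail β]
    have := ih (A := fun i => A i.succ) (fun p q hpq => hA _ _ (by simpa using hpq))
      (fun i => β i.succ)
    change ContinuousLinearMap.adjoint (multiOp A (Fin.cons (β 0) fun i => β i.succ))
      = multiOpStar A (Fin.cons (β 0) fun i => β i.succ)
    rw [multiOp_cons, multiOpStar_cons, ← this, (commute_wordOp_multiOp hA _ _).eq,
      adjoint_mul_eq]

variable {k : ℕ} {n : Fin k → ℕ} {f : ∀ i, PosRegular (n i)} {m : Fin k → ℕ}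
  {A : ∀ i, Fin (n i) → H →L[ℂ] H} {D : H →L[ℂ] H}

theorem defect_zero (f : ∀ i, PosRegular (n i)) (A : ∀ i, Fin (n i) → H →L[ℂ] H)
    (D : H →L[ℂ] H) : defect f A 0 D = D := by
  have : ∀ l : List ((H →L[ℂ] H) → (H →L[ℂ] H)), (∀ g ∈ l, g = id) →
      l.foldr (fun g h => g ∘ h) id = id := by
    intro l hl
    induction l with
    | nil => rfl
    | cons g l ih =>
      rw [List.foldr_cons, ih fun g' hg' => hl g' (List.mem_cons_of_mem _ hg'),
        hl g List.mem_cons_self]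
      rfl
  rw [defect, compIter, this]
  · rfl
  · intro g hg
    obtain ⟨i, rfl⟩ := (List.mem_ofFn' _ _).1 hg
    rfl

theorem defect_nonneg_of_mem_pureCone (hD : D ∈ pureCone f m A) {p : Fin k → ℕ} (hp : p ≤ m) :
    0 ≤ defect f A p D := by
  by_cases h : p = 0
  · rw [h, defect_zero]
    exact hD.1
  · exact hD.2.1 p hp h

/-- The reconstruction formula for the elements of the pure cone. -/
theorem qform_eq_of_mem_pureCone (hΦ : ∀ i, PhiWellDefined (f i) (A i))
    (hD : D ∈ pureCone f m A) (h : H) :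
    qform D h = ∑' β : Words n, (∏ i, bWord (f i) (m i) (β i))
      * qform (defect f A m D) (multiOpStar A β h) := by
  refine qform_eq_tsum_multiOpStar f m A hΦ (fun p hp => defect_nonneg_of_mem_pureCone hD hp)
    (fun i x => ?_) h
  have := (tendsto_ofCLM_zero_iff_qform fun s => (phi_iterate_spec (hΦ i) hD.1 s).1).1
    (hD.2.2 i) x
  simpa only [(phi_iterate_spec (hΦ i) hD.1 _).2] using this

/-- The compatibility series of the defect of `D` sums to `D` itself. -/
theorem hasSum_compatTerm (hm : ∀ i, 0 < m i) (hcomm : CommutingTuples A)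
    (hΦ : ∀ i, PhiWellDefined (f i) (A i)) (hD : D ∈ pureCone f m A) :
    HasSum (compatTerm f m A (defect f A m D)) (ContinuousLinearMapWOT.ofCLM D) := by
  have hR := defect_nonneg_of_mem_pureCone hD le_rfl
  have hcast : ∀ s : Fin k → ℕ,
      (((∏ i, (s i + m i - 1).choose (m i - 1) : ℕ) : ℝ) : ℂ)
        = ((∏ i, (s i + m i - 1).choose (m i - 1) : ℕ) : ℂ) := fun s => by norm_cast
  have hpos : ∀ s, 0 ≤ (compatTerm f m A (defect f A m D) s).toCLM := fun s => by
    rw [compatTerm, ← hcast]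
    exact ofReal_smul_nonneg (Nat.cast_nonneg _) (compIter_phi_nonneg hΦ hR s)
  refine (hasSum_ofCLM_iff_qform hpos hD.1).2 fun x => ?_
  rw [qform_eq_of_mem_pureCone hΦ hD]
  simp_rw [← adjoint_multiOp hcomm]
  rw [tsum_multiOp_adjoint_eq_tsum_compIter m hΦ hR]
  refine tsum_congr fun s => ?_
  rw [compatTerm, ← hcast, ContinuousLinearMapWOT.toCLM_ofCLM,
    qform_ofReal_smul (Nat.cast_nonneg _), ENNReal.ofReal_natCast]
  congr 1
  push_cast
  exact Finset.prod_congr rfl fun i _ => binomWeight_eq_choose (hm i) _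

theorem compatible_of_mem_pureCone (hm : ∀ i, 0 < m i) (hcomm : CommutingTuples A)
    (hΦ : ∀ i, PhiWellDefined (f i) (A i)) {Q : Set (NCPoly n)}
    (hA : ∀ q ∈ Q, polyEval q A = 0) (hD : D ∈ pureCone f m A) :
    Compatible f m A (defect f A m D) Q where
  comm := hcomm
  wellDefined := hΦ
  nonneg := defect_nonneg_of_mem_pureCone hD le_rfl
  summable := (hasSum_compatTerm hm hcomm hΦ hD).summable
  bound := by
    refine ⟨‖D‖ + 1, by positivity, ?_⟩
    rw [(hasSum_compatTerm hm hcomm hΦ hD).tsum_eq, ← sub_nonneg]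
    refine nonneg_of_qform (ofReal_smul_nonneg (by positivity) zero_le_one) hD.1 fun x => ?_
    rw [qform_ofReal_smul (by positivity)]
    refine (qform_le_norm_mul_qform_one D x).trans ?_
    gcongr
    linarith
  polyEval_eq_zero := hA

end Reconstruction

/-! ### Slices of Hilbert space tensor products -/

section Slices

variable {E F G : Type*} [NormedAddCommGroup E] [InnerProductSpace ℂ E]
  [NormedAddCommGroup F] [InnerProductSpace ℂ F] [NormedAddCommGroup G] [InnerProductSpace ℂ G]

/-- A closed subspace of a Hilbert space tensor product that contains the elementary tensors is
everything. -/
theorem HTensor.eq_top_of_isClosed (K : Submodule ℂ (HTensor E G))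
    (hK : IsClosed (K : Set (HTensor E G)))
    (h : ∀ (x : E) (g : G), ((x ⊗ₜ[ℂ] g : E ⊗[ℂ] G) : HTensor E G) ∈ K) : K = ⊤ := by
  refine (Submodule.eq_top_iff').2 fun u => ?_
  induction u using UniformSpace.Completion.induction_on with
  | hp => exact hK
  | ih t =>
    induction t using TensorProduct.induction_on with
    | zero =>
      rw [UniformSpace.Completion.coe_zero]
      exact K.zero_mem
    | tmul x g => exact h x g
    | add s t hs ht =>
      rw [UniformSpace.Completion.coe_add]
      exact K.add_mem hs ht

theorem HTensor.clm_ext {T U : HTensor E G →L[ℂ] F}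
    (h : ∀ (x : E) (g : G), T ((x ⊗ₜ[ℂ] g : E ⊗[ℂ] G) : HTensor E G)
      = U ((x ⊗ₜ[ℂ] g : E ⊗[ℂ] G) : HTensor E G)) : T = U := by
  have := HTensor.eq_top_of_isClosed (LinearMap.eqLocus T.toLinearMap U.toLinearMap)
    (isClosed_eq T.continuous U.continuous) h
  ext u
  have hu : u ∈ LinearMap.eqLocus T.toLinearMap U.toLinearMap := this ▸ Submodule.mem_top
  exact hu

theorem tensorId_tmul (T : E →L[ℂ] F) (x : E) (g : G) :
    tensorId G T ((x ⊗ₜ[ℂ] g : E ⊗[ℂ] G) : HTensor E G)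
      = ((T x ⊗ₜ[ℂ] g : F ⊗[ℂ] G) : HTensor F G) :=
  ContinuousLinearMap.completion_apply_coe _ _

theorem norm_tensorId_apply_le (T : E →L[ℂ] F) (u : HTensor E G) :
    ‖tensorId G T u‖ ≤ ‖T‖ * ‖u‖ := by
  induction u using UniformSpace.Completion.induction_on with
  | hp => exact isClosed_le (by fun_prop) (by fun_prop)
  | ih t =>
    have : tensorId G T (t : HTensor E G) = ((T.rTensor G t : F ⊗[ℂ] G) : HTensor F G) :=
      ContinuousLinearMap.completion_apply_coe _ _
    rw [this, UniformSpace.Completion.norm_coe, UniformSpace.Completion.norm_coe]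
    refine ((T.rTensor G).le_opNorm t).trans ?_
    gcongr
    exact ContinuousLinearMap.norm_rTensor_le _ T

theorem tensorId_add (T U : E →L[ℂ] F) : tensorId G (T + U) = tensorId G T + tensorId G U :=
  HTensor.clm_ext fun x g => by
    rw [add_apply, tensorId_tmul, tensorId_tmul, tensorId_tmul, add_apply, TensorProduct.add_tmul,
      UniformSpace.Completion.coe_add]

theorem tensorId_smul (c : ℂ) (T : E →L[ℂ] F) : tensorId G (c • T) = c • tensorId G T :=
  HTensor.clm_ext fun x g => by
    rw [smul_apply, tensorId_tmul, tensorId_tmul, smul_apply, ← TensorProduct.smul_tmul',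
      UniformSpace.Completion.coe_smul]

/-- The operator `x ↦ x ⊗ g`. -/
def slice (E : Type*) [NormedAddCommGroup E] [InnerProductSpace ℂ E] (g : G) :
    E →L[ℂ] HTensor E G :=
  UniformSpace.Completion.toComplL ∘L (TensorProduct.mkL ℂ E G).flip g

theorem slice_apply (g : G) (x : E) :
    slice E g x = ((x ⊗ₜ[ℂ] g : E ⊗[ℂ] G) : HTensor E G) := rfl

theorem norm_slice_apply (g : G) (x : E) : ‖slice E g x‖ = ‖x‖ * ‖g‖ := by
  rw [slice_apply, UniformSpace.Completion.norm_coe, TensorProduct.norm_tmul]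

theorem inner_slice_slice (g g' : G) (x y : E) :
    ⟪slice E g x, slice E g' y⟫_ℂ = ⟪x, y⟫_ℂ * ⟪g, g'⟫_ℂ := by
  rw [slice_apply, slice_apply, UniformSpace.Completion.inner_coe, TensorProduct.inner_tmul]

variable [CompleteSpace E] [CompleteSpace F]

theorem adjoint_slice_slice (g g' : G) (x : E) :
    ContinuousLinearMap.adjoint (slice E g) (slice E g' x) = ⟪g, g'⟫_ℂ • x := by
  refine ext_inner_left ℂ fun y => ?_
  rw [ContinuousLinearMap.adjoint_inner_right, inner_slice_slice, inner_smul_right, mul_comm]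

theorem adjoint_slice_tensorId (g : G) (T : E →L[ℂ] F) (u : HTensor E G) :
    ContinuousLinearMap.adjoint (slice F g) (tensorId G T u)
      = T (ContinuousLinearMap.adjoint (slice E g) u) := by
  have : ContinuousLinearMap.adjoint (slice F g) ∘L tensorId G T
      = T ∘L ContinuousLinearMap.adjoint (slice E g) := HTensor.clm_ext fun x g' => by
    rw [ContinuousLinearMap.comp_apply, ContinuousLinearMap.comp_apply, tensorId_tmul,
      ← slice_apply, ← slice_apply, adjoint_slice_slice, adjoint_slice_slice, map_smul]
  exact congrArg (· u) this

/-- Parseval's identity for the slices along a Hilbert basis of the second factor. -/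
theorem hasSum_inner_adjoint_slice {ι : Type*} (b : HilbertBasis ι ℂ G) (u v : HTensor E G) :
    HasSum (fun i => ⟪ContinuousLinearMap.adjoint (slice E (b i)) u,
      ContinuousLinearMap.adjoint (slice E (b i)) v⟫_ℂ) ⟪u, v⟫_ℂ := by
  classical
  let V : ι → E →ₗᵢ[ℂ] HTensor E G := fun i =>
    ⟨(slice E (b i)).toLinearMap, fun x => by
      change ‖slice E (b i) x‖ = ‖x‖
      rw [norm_slice_apply, b.orthonormal.1 i, mul_one]⟩
  have hV : OrthogonalFamily ℂ (fun _ : ι => E) V := fun i j hij x y => by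
    change ⟪slice E (b i) x, slice E (b j) y⟫_ℂ = 0
    rw [inner_slice_slice, b.orthonormal.2 hij, mul_zero]
  have hmem : ∀ i x, slice E (b i) x ∈ ⨆ i, LinearMap.range (V i).toLinearMap := fun i x =>
    Submodule.mem_iSup_of_mem i ⟨x, rfl⟩
  have hdense : (⨆ i, LinearMap.range (V i).toLinearMap).topologicalClosure = ⊤ := by
    refine HTensor.eq_top_of_isClosed _ (Submodule.isClosed_topologicalClosure _) fun x g => ?_
    have h1 := (b.hasSum_repr g).mapL
      (UniformSpace.Completion.toComplL ∘L TensorProduct.mkL ℂ E G x)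
    refine mem_closure_of_tendsto h1 (Eventually.of_forall fun s => ?_)
    refine Submodule.sum_mem _ fun i _ => ?_
    rw [map_smul]
    exact Submodule.smul_mem _ _ (hmem i x)
  have hS : IsHilbertSum ℂ (fun _ : ι => E) V := IsHilbertSum.mk hV hdense.ge
  have hcoord : ∀ w i, hS.linearIsometryEquiv w i
      = ContinuousLinearMap.adjoint (slice E (b i)) w := fun w i => by
    refine ext_inner_left ℂ fun x => ?_
    refine (lp.inner_single_left (G := fun _ : ι => E) i x _).symm.trans ?_
    rw [ContinuousLinearMap.adjoint_inner_right,
      ← hS.linearIsometryEquiv.inner_map_map]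
    congr 1
    rw [← hS.linearIsometryEquiv.symm_apply_eq, hS.linearIsometryEquiv_symm_apply_single]
    rfl
  have := lp.hasSum_inner (𝕜 := ℂ) (hS.linearIsometryEquiv u) (hS.linearIsometryEquiv v)
  simpa only [hcoord, LinearIsometryEquiv.inner_map_map] using this

end Slices

/-! ### The weak star topology and Berezin transforms -/

section WStarBerezin

variable {E F : Type*} [NormedAddCommGroup E] [InnerProductSpace ℂ E]
  [NormedAddCommGroup F] [InnerProductSpace ℂ F]

theorem vectorFunctional_apply (x y : E) (T : E →L[ℂ] E) :
    vectorFunctional E x y T = ⟪x, T y⟫_ℂ := rfl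

theorem norm_vectorFunctional_le (x y : E) : ‖vectorFunctional E x y‖ ≤ ‖x‖ * ‖y‖ := by
  refine ContinuousLinearMap.opNorm_le_bound _ (by positivity) fun T => ?_
  rw [vectorFunctional_apply]
  calc ‖⟪x, T y⟫_ℂ‖ ≤ ‖x‖ * ‖T y‖ := norm_inner_le_norm _ _
    _ ≤ ‖x‖ * (‖T‖ * ‖y‖) := by gcongr; exact T.le_opNorm y
    _ = ‖x‖ * ‖y‖ * ‖T‖ := by ring

theorem vectorFunctional_mem_predual (x y : E) : vectorFunctional E x y ∈ predual E :=
  subset_closure (Submodule.subset_span ⟨(x, y), rfl⟩)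

/-- A bounded linear map is `w*`-continuous if it pulls vector functionals back to the predual. -/
theorem continuous_wstar_of_vectorFunctional (T : (E →L[ℂ] E) →L[ℂ] (F →L[ℂ] F))
    (hT : ∀ x y, vectorFunctional F x y ∘L T ∈ predual E) :
    @Continuous _ _ (wstar E) (wstar F) T := by
  have hψ : ∀ ψ ∈ predual F, ψ ∘L T ∈ predual E := by
    let c : StrongDual ℂ (F →L[ℂ] F) →L[ℂ] StrongDual ℂ (E →L[ℂ] E) :=
      (ContinuousLinearMap.compL ℂ (E →L[ℂ] E) (F →L[ℂ] F) ℂ).flip T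
    have hle : predual F ≤ (predual E).comap c.toLinearMap := by
      refine Submodule.topologicalClosure_minimal _ (Submodule.span_le.2 ?_) ?_
      · rintro _ ⟨z, rfl⟩
        exact hT z.1 z.2
      · exact (Submodule.isClosed_topologicalClosure _).preimage c.continuous
    exact fun ψ h => hle h
  let : TopologicalSpace (E →L[ℂ] E) := wstar E
  refine continuous_induced_rng.2 (continuous_pi fun ψ => ?_)
  have h1 : Continuous fun w : predual E → ℂ => w ⟨_, hψ ψ ψ.2⟩ := continuous_apply _
  exact @Continuous.comp (E →L[ℂ] E) (predual E → ℂ) ℂ (wstar E) _ _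
    (fun T φ => φ.1 T) _ h1 continuous_induced_dom

theorem continuous_wstar_apply (x y : E) :
    @Continuous _ _ (wstar E) _ (fun T : E →L[ℂ] E => ⟪x, T y⟫_ℂ) := by
  let : TopologicalSpace (E →L[ℂ] E) := wstar E
  have h1 : Continuous fun w : predual E → ℂ => w ⟨_, vectorFunctional_mem_predual x y⟩ :=
    continuous_apply _
  exact @Continuous.comp (E →L[ℂ] E) (predual E → ℂ) ℂ (wstar E) _ _
    (fun T φ => φ.1 T) _ h1 continuous_induced_dom

theorem t2Space_wstar : @T2Space (E →L[ℂ] E) (wstar E) := by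
  let : TopologicalSpace (E →L[ℂ] E) := wstar E
  refine T2Space.of_injective_continuous (f := fun (T : E →L[ℂ] E) (z : E × E) => ⟪z.1, T z.2⟫_ℂ)
    (fun T U h => ?_) (continuous_pi fun z => continuous_wstar_apply z.1 z.2)
  ext y
  exact ext_inner_left ℂ fun x => congrFun h (x, y)

theorem hasSum_strongDual_apply {V ι : Type*} [NormedAddCommGroup V] [NormedSpace ℂ V]
    {v : ι → StrongDual ℂ V} {φ : StrongDual ℂ V} (h : HasSum v φ) (T : V) :
    HasSum (fun i => v i T) (φ T) :=
  (ContinuousLinearMap.apply ℂ ℂ T).hasSum h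

/-- A functional `T ↦ ∑ ⟪x_i, T y_i⟫` with square summable `x`, `y` lies in the predual: the series
converges in norm. -/
theorem hasSum_vectorFunctional_mem_predual {ι : Type*} {x y : ι → E}
    (hx : Summable fun i => ‖x i‖ ^ 2) (hy : Summable fun i => ‖y i‖ ^ 2)
    {ψ : StrongDual ℂ (E →L[ℂ] E)} (hψ : ∀ T, HasSum (fun i => ⟪x i, T (y i)⟫_ℂ) (ψ T)) :
    ψ ∈ predual E := by
  have hs : Summable fun i => vectorFunctional E (x i) (y i) := by
    have hg : Summable fun i => (‖x i‖ ^ 2 + ‖y i‖ ^ 2) / 2 := (hx.add hy).div_const 2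
    have hn : ∀ i, ‖vectorFunctional E (x i) (y i)‖ ≤ (‖x i‖ ^ 2 + ‖y i‖ ^ 2) / 2 := fun i =>
      (norm_vectorFunctional_le _ _).trans (by nlinarith [sq_nonneg (‖x i‖ - ‖y i‖)])
    have h := Summable.of_norm_bounded (E := StrongDual ℂ (E →L[ℂ] E))
      (f := fun i => vectorFunctional E (x i) (y i)) hg
    exact h hn
  obtain ⟨φ, hφ⟩ := hs
  have h1 : ψ = φ := by
    ext T
    exact (hψ T).unique (hasSum_strongDual_apply hφ T)
  rw [h1]
  exact mem_closure_of_tendsto hφ (Eventually.of_forall fun s =>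
    Submodule.sum_mem _ fun i _ => Submodule.subset_span ⟨(x i, y i), rfl⟩)

variable {G H : Type*} [NormedAddCommGroup G] [InnerProductSpace ℂ G]
  [NormedAddCommGroup H] [InnerProductSpace ℂ H] [CompleteSpace H]

/-- The Berezin transform `χ ↦ K* (χ ⊗ I) K` as a bounded linear map on `B(E)`. -/
def berezinL (K : H →L[ℂ] HTensor E G) : (E →L[ℂ] E) →L[ℂ] (H →L[ℂ] H) :=
  LinearMap.mkContinuous
    { toFun := fun χ => berezinTransform K χ
      map_add' := fun χ₁ χ₂ => by
        simp only [berezinTransform, tensorId_add, ContinuousLinearMap.add_comp,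
          ContinuousLinearMap.comp_add]
      map_smul' := fun c χ => by
        simp only [berezinTransform, tensorId_smul, ContinuousLinearMap.smul_comp,
          ContinuousLinearMap.comp_smul, RingHom.id_apply] }
    (‖ContinuousLinearMap.adjoint K‖ * ‖K‖) (fun χ => by
      refine ContinuousLinearMap.opNorm_le_bound _ (by positivity) fun x => ?_
      change ‖ContinuousLinearMap.adjoint K (tensorId G χ (K x))‖ ≤ _
      calc _ ≤ ‖ContinuousLinearMap.adjoint K‖ * ‖tensorId G χ (K x)‖ :=
            ContinuousLinearMap.le_opNorm _ _
        _ ≤ ‖ContinuousLinearMap.adjoint K‖ * (‖χ‖ * (‖K‖ * ‖x‖)) := by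
            gcongr
            refine (norm_tensorId_apply_le _ _).trans ?_
            gcongr
            exact K.le_opNorm x
        _ = _ := by ring)

theorem inner_berezinTransform (K : H →L[ℂ] HTensor E G) (χ : E →L[ℂ] E) (x y : H) :
    ⟪x, berezinTransform K χ y⟫_ℂ = ⟪K x, tensorId G χ (K y)⟫_ℂ :=
  ContinuousLinearMap.adjoint_inner_right K _ _

variable [CompleteSpace E]

/-- The Berezin transform is the sum of the maps `χ ↦ K_i* χ K_i`, for the slices `K_i` of `K`
along a Hilbert basis. -/
theorem hasSum_inner_berezinTransform {ι : Type*} (b : HilbertBasis ι ℂ G)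
    (K : H →L[ℂ] HTensor E G) (χ : E →L[ℂ] E) (x y : H) :
    HasSum (fun i => ⟪ContinuousLinearMap.adjoint (slice E (b i)) (K x),
      χ (ContinuousLinearMap.adjoint (slice E (b i)) (K y))⟫_ℂ)
      ⟪x, berezinTransform K χ y⟫_ℂ := by
  rw [inner_berezinTransform]
  simp_rw [← adjoint_slice_tensorId]
  exact hasSum_inner_adjoint_slice b _ _

theorem summable_norm_sq_adjoint_slice {ι : Type*} (b : HilbertBasis ι ℂ G) (u : HTensor E G) :
    Summable fun i => ‖ContinuousLinearMap.adjoint (slice E (b i)) u‖ ^ 2 := by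
  have := (hasSum_inner_adjoint_slice b u u).summable
  simp_rw [inner_self_eq_norm_sq_to_K] at this
  exact Complex.summable_ofReal.1 (by simpa using this)

variable [CompleteSpace G]

theorem continuous_wstar_berezinL (K : H →L[ℂ] HTensor E G) :
    @Continuous _ _ (wstar E) (wstar H) (berezinL K) := by
  obtain ⟨w, b, -⟩ := exists_hilbertBasis ℂ G
  refine continuous_wstar_of_vectorFunctional _ fun x y => ?_
  exact hasSum_vectorFunctional_mem_predual (summable_norm_sq_adjoint_slice b (K x))
    (summable_norm_sq_adjoint_slice b (K y)) fun χ => hasSum_inner_berezinTransform b K χ x y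

theorem wStarContinuous_berezinL (K : H →L[ℂ] HTensor E G) (V : Submodule ℂ (E →L[ℂ] E)) :
    WStarContinuous ((berezinL K).toLinearMap ∘ₗ V.subtype) := by
  let : TopologicalSpace (E →L[ℂ] E) := wstar E
  let : TopologicalSpace (H →L[ℂ] H) := wstar H
  exact (continuous_wstar_berezinL K).comp continuous_induced_dom

theorem completelyPos_berezinL (K : H →L[ℂ] HTensor E G) (V : Submodule ℂ (E →L[ℂ] E)) :
    CompletelyPos ((berezinL K).toLinearMap ∘ₗ V.subtype) := by
  obtain ⟨w, b, -⟩ := exists_hilbertBasis ℂ G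
  intro d X hX x
  have h : HasSum (fun i => ∑ s, ∑ t, ⟪ContinuousLinearMap.adjoint (slice E (b i)) (K (x s)),
      (X s t : E →L[ℂ] E) (ContinuousLinearMap.adjoint (slice E (b i)) (K (x t)))⟫_ℂ)
      (∑ s, ∑ t, ⟪x s, berezinTransform K (X s t) (x t)⟫_ℂ) :=
    hasSum_sum fun s _ => hasSum_sum fun t _ => hasSum_inner_berezinTransform b K _ _ _
  exact h.nonneg fun i => hX fun s => ContinuousLinearMap.adjoint (slice E (b i)) (K (x s))

end WStarBerezin

/-! ### Multi-words of operators and intertwiners -/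

section Intertwining

theorem wordOp_mul_multiOp {H : Type*} [NormedAddCommGroup H] [InnerProductSpace ℂ H] {k : ℕ}
    {n : Fin k → ℕ} {A : ∀ i, Fin (n i) → H →L[ℂ] H} (hA : CommutingTuples A) (i : Fin k)
    (γ : FreeMonoid (Fin (n i))) (β : Words n) :
    wordOp (A i) γ * multiOp A β = multiOp A (Function.update β i (γ * β i)) := by
  induction k with
  | zero => exact i.elim0
  | succ k ih =>
    obtain ⟨α, β, rfl⟩ : ∃ α β', β = Fin.cons α β' := ⟨_, _, (Fin.cons_self_tail β).symm⟩
    refine Fin.cases (fun γ => ?_) (fun i γ => ?_) i γ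
    · rw [Fin.update_cons_zero, multiOp_cons, multiOp_cons, Fin.cons_zero, wordOp_mul, mul_assoc]
    · rw [← Fin.cons_update, multiOp_cons, multiOp_cons, Fin.cons_succ,
        ← ih (A := fun i => A i.succ) (fun p q hpq => hA _ _ (by simpa using hpq)),
        ← mul_assoc, ← mul_assoc, (commute_wordOp hA (Fin.succ_ne_zero i) _ _).eq]

theorem multiOp_leftMul {H : Type*} [NormedAddCommGroup H] [InnerProductSpace ℂ H] {k : ℕ}
    {n : Fin k → ℕ} {A : ∀ i, Fin (n i) → H →L[ℂ] H} (hA : CommutingTuples A) (i : Fin k)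
    (j : Fin (n i)) (β : Words n) : A i j * multiOp A β = multiOp A (leftMul i j β) := by
  rw [leftMul, ← wordOp_mul_multiOp hA, wordOp_of]

variable {E F : Type*} [NormedAddCommGroup E] [InnerProductSpace ℂ E] [CompleteSpace E]
  [NormedAddCommGroup F] [InnerProductSpace ℂ F] [CompleteSpace F]

theorem map_adjoint_wordOp {n : ℕ} {X : Fin n → E →L[ℂ] E} {Y : Fin n → F →L[ℂ] F}
    {T : E →L[ℂ] F} (h : ∀ j x, T (ContinuousLinearMap.adjoint (X j) x)
      = ContinuousLinearMap.adjoint (Y j) (T x)) (α : FreeMonoid (Fin n)) (x : E) :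
    T (ContinuousLinearMap.adjoint (wordOp X α) x)
      = ContinuousLinearMap.adjoint (wordOp Y α) (T x) := by
  induction α using FreeMonoid.recOn generalizing x with
  | one => simp [wordOp_one, adjoint_one_eq]
  | of_mul j α ih =>
    rw [adjoint_wordOp_mul_apply, adjoint_wordOp_mul_apply, ih, wordOp_of, wordOp_of, h]

theorem map_adjoint_multiOp {k : ℕ} {n : Fin k → ℕ} {X : ∀ i, Fin (n i) → E →L[ℂ] E}
    {Y : ∀ i, Fin (n i) → F →L[ℂ] F} {T : E →L[ℂ] F}
    (h : ∀ i j x, T (ContinuousLinearMap.adjoint (X i j) x)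
      = ContinuousLinearMap.adjoint (Y i j) (T x)) (α : Words n) (x : E) :
    T (ContinuousLinearMap.adjoint (multiOp X α) x)
      = ContinuousLinearMap.adjoint (multiOp Y α) (T x) := by
  induction k generalizing x with
  | zero => simp [multiOp, adjoint_one_eq]
  | succ k ih =>
    obtain ⟨β, α, rfl⟩ : ∃ β α', α = Fin.cons β α' := ⟨_, _, (Fin.cons_self_tail α).symm⟩
    rw [multiOp_cons, multiOp_cons, adjoint_mul_eq, adjoint_mul_eq, mul_apply_eq_comp,
      mul_apply_eq_comp, ih (X := fun i => X i.succ) (Y := fun i => Y i.succ) fun i => h i.succ,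
      map_adjoint_wordOp (h 0)]

end Intertwining

/-! ### The universal models `W` and `S` -/

section Models

variable {k : ℕ} {n : Fin k → ℕ} (f : ∀ i, PosRegular (n i)) (m : Fin k → ℕ)

theorem inner_basisVec (β : Words n) (x : Fock n) : ⟪basisVec β, x⟫_ℂ = x β := by
  classical
  have h := lp.inner_single_left (G := fun _ : Words n => ℂ) (𝕜 := ℂ) β 1 x
  rw [basisVec]
  convert h using 1
  · congr!
  · simp

theorem adjoint_W_apply (i : Fin k) (j : Fin (n i)) (x : Fock n) (β : Words n) :
    ContinuousLinearMap.adjoint (W f m i j) x β = weight f m i j β * x (leftMul i j β) := by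
  rw [← inner_basisVec, ContinuousLinearMap.adjoint_inner_right, W_basisVec, inner_smul_left,
    inner_basisVec, Complex.conj_ofReal]
  rfl

theorem weight_leftMul_of_ne {p q : Fin k} (hpq : p ≠ q) (s : Fin (n p)) (t : Fin (n q))
    (β : Words n) : weight f m p s (leftMul q t β) = weight f m p s β := by
  simp [weight, leftMul, hpq]

theorem leftMul_comm {p q : Fin k} (hpq : p ≠ q) (s : Fin (n p)) (t : Fin (n q)) (β : Words n) :
    leftMul p s (leftMul q t β) = leftMul q t (leftMul p s β) := by
  simp only [leftMul, Function.update_of_ne hpq, Function.update_of_ne hpq.symm]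
  exact Function.update_comm hpq.symm _ _ _

theorem commutingTuples_W : CommutingTuples (W f m) := by
  intro p q hpq s t
  refine ContinuousLinearMap.adjoint.injective ?_
  rw [adjoint_mul_eq, adjoint_mul_eq]
  ext x β
  simp only [mul_apply_eq_comp, adjoint_W_apply, weight_leftMul_of_ne f m hpq,
    weight_leftMul_of_ne f m hpq.symm, leftMul_comm hpq]
  ring

variable (Q : Set (NCPoly n))

theorem W_mem_MQ (i : Fin k) (j : Fin (n i)) {x : Fock n} (hx : x ∈ MQ f m Q) :
    W f m i j x ∈ MQ f m Q := by
  have hle : MQ f m Q ≤ (MQ f m Q).comap (W f m i j).toLinearMap := by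
    refine Submodule.topologicalClosure_minimal _ (Submodule.span_le.2 ?_)
      ((Submodule.isClosed_topologicalClosure _).preimage (W f m i j).continuous)
    rintro _ ⟨α, β, q, c, hq, rfl⟩
    refine subset_closure (Submodule.subset_span ⟨leftMul i j α, β, q, c, hq, ?_⟩)
    rw [← multiOp_leftMul (commutingTuples_W f m)]
    rfl
  exact hle hx

theorem adjoint_W_mem_NQ (i : Fin k) (j : Fin (n i)) {x : Fock n} (hx : x ∈ NQ f m Q) :
    ContinuousLinearMap.adjoint (W f m i j) x ∈ NQ f m Q := by
  rw [Submodule.mem_orthogonal] at hx ⊢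
  intro u hu
  rw [ContinuousLinearMap.adjoint_inner_right]
  exact hx _ (W_mem_MQ f m Q i j hu)

/-- `N_Q` is invariant under the adjoints `𝐖_{i,j}*`, and `𝐒_{i,j}*` is the restriction of
`𝐖_{i,j}*`. -/
theorem coe_adjoint_S (i : Fin k) (j : Fin (n i)) (x : NQ f m Q) :
    ((ContinuousLinearMap.adjoint (S f m Q i j) x : NQ f m Q) : Fock n)
      = ContinuousLinearMap.adjoint (W f m i j) (x : Fock n) := by
  have : ContinuousLinearMap.adjoint (S f m Q i j) x
      = ⟨ContinuousLinearMap.adjoint (W f m i j) (x : Fock n),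
          adjoint_W_mem_NQ f m Q i j x.2⟩ := by
    refine ext_inner_left ℂ fun y => ?_
    rw [ContinuousLinearMap.adjoint_inner_right, Submodule.coe_inner, Submodule.coe_inner,
      ContinuousLinearMap.adjoint_inner_right]
    exact (NQ f m Q).inner_orthogonalProjectionOnto_eq_of_mem_right x (W f m i j y)
  rw [this]

theorem commutingTuples_S : CommutingTuples (S f m Q) := by
  intro p q hpq s t
  refine ContinuousLinearMap.adjoint.injective ?_
  rw [adjoint_mul_eq, adjoint_mul_eq]
  ext1 x
  refine Subtype.ext ?_
  simp only [mul_apply_eq_comp, coe_adjoint_S]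
  have := congrArg (fun T => ContinuousLinearMap.adjoint T (x : Fock n))
    (commutingTuples_W f m p q hpq s t).eq
  simpa only [adjoint_mul_eq, mul_apply_eq_comp] using this

theorem coe_adjoint_wordOp_S (i : Fin k) (α : FreeMonoid (Fin (n i))) (x : NQ f m Q) :
    ((ContinuousLinearMap.adjoint (wordOp (S f m Q i) α) x : NQ f m Q) : Fock n)
      = ContinuousLinearMap.adjoint (wordOp (W f m i) α) (x : Fock n) :=
  map_adjoint_wordOp (T := (NQ f m Q).subtypeL) (fun j x => coe_adjoint_S f m Q i j x) α x

/-- The iterated weights telescope: `(W_{i,α}* x)_β = √(b_{β_i} / b_{αβ_i}) x_{αβ}`. -/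
theorem adjoint_wordOp_W_apply (i : Fin k) (α : FreeMonoid (Fin (n i))) (x : Fock n)
    (β : Words n) :
    ContinuousLinearMap.adjoint (wordOp (W f m i) α) x β
      = ((√(bCoeff (f i) (m i) (β i)) / √(bCoeff (f i) (m i) (α * β i)) : ℝ) : ℂ)
        * x (Function.update β i (α * β i)) := by
  induction α using FreeMonoid.recOn generalizing x with
  | one =>
    have := (Real.sqrt_pos.2 (bCoeff_pos (f i) (m i) (β i))).ne'
    simp [wordOp_one, adjoint_one_eq, this]
  | of_mul j α ih =>
    rw [adjoint_wordOp_mul_apply, ih, wordOp_of, adjoint_W_apply, weight, ← mul_assoc,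
      ← Complex.ofReal_mul]
    have h1 := (Real.sqrt_pos.2 (bCoeff_pos (f i) (m i) (α * β i))).ne'
    simp only [leftMul, Function.update_self, Function.update_idem, mul_assoc]
    congr 2
    field_simp

end Models

/-! ### The Berezin kernel -/

section Kernel

variable {H : Type*} [NormedAddCommGroup H] [InnerProductSpace ℂ H] [CompleteSpace H]
  {k : ℕ} {n : Fin k → ℕ} {f : ∀ i, PosRegular (n i)} {m : Fin k → ℕ}
  {A : ∀ i, Fin (n i) → H →L[ℂ] H} {D R : H →L[ℂ] H}

/-- `R^{1/2}` as an operator into the closure of its range. -/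
def sqrtCLM (R : H →L[ℂ] H) : H →L[ℂ] rangeSqrt R :=
  (CFC.sqrt R).codRestrict (rangeSqrt R) fun x => (sqrtVec R x).2

/-- The weight `√b_{1,β₁} ⋯ √b_{k,β_k}` of the Berezin kernel. -/
def kernelWeight (f : ∀ i, PosRegular (n i)) (m : Fin k → ℕ) (β : Words n) : ℝ :=
  ∏ i, √(bCoeff (f i) (m i) (β i))

theorem ofReal_kernelWeight_sq (hm : ∀ i, 0 < m i) (β : Words n) :
    ENNReal.ofReal (kernelWeight f m β ^ 2) = ∏ i, bWord (f i) (m i) (β i) := by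
  rw [kernelWeight, ← Finset.prod_pow, ENNReal.ofReal_prod_of_nonneg fun i _ => sq_nonneg _]
  refine Finset.prod_congr rfl fun i _ => ?_
  rw [Real.sq_sqrt (bCoeff_nonneg _ _ _), bWord_of_pos _ (hm i)]

theorem kernelWeight_pos (β : Words n) : 0 < kernelWeight f m β :=
  Finset.prod_pos fun _ _ => Real.sqrt_pos.2 (bCoeff_pos _ _ _)

theorem mul_kernelWeight_update (i : Fin k) (α : FreeMonoid (Fin (n i))) (β : Words n) :
    √(bCoeff (f i) (m i) (β i)) / √(bCoeff (f i) (m i) (α * β i))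
      * kernelWeight f m (Function.update β i (α * β i)) = kernelWeight f m β := by
  have h1 := (Real.sqrt_pos.2 (bCoeff_pos (f i) (m i) (α * β i))).ne'
  rw [kernelWeight, kernelWeight, ← Finset.mul_prod_erase _ _ (Finset.mem_univ i),
    ← Finset.mul_prod_erase (a := i) _ _ (Finset.mem_univ i), ← mul_assoc]
  congr 1
  · rw [Function.update_self]
    field_simp
  · refine Finset.prod_congr rfl fun l hl => ?_
    rw [Function.update_of_ne (Finset.ne_of_mem_erase hl)]

theorem weight_mul_kernelWeight_leftMul (i : Fin k) (j : Fin (n i)) (β : Words n) :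
    weight f m i j β * kernelWeight f m (leftMul i j β) = kernelWeight f m β :=
  mul_kernelWeight_update i _ β

theorem basisVec_apply_self (β : Words n) : (basisVec β : Fock n) β = 1 := by
  let _ : DecidableEq (Words n) := Classical.decEq _
  exact lp.single_apply_self 2 β 1

theorem basisVec_apply_of_ne {β γ : Words n} (h : β ≠ γ) : (basisVec γ : Fock n) β = 0 := by
  let _ : DecidableEq (Words n) := Classical.decEq _
  exact lp.single_apply_ne 2 γ 1 h

theorem norm_basisVec (β : Words n) : ‖(basisVec β : Fock n)‖ = 1 := by
  let _ : DecidableEq (Words n) := Classical.decEq _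
  exact (lp.norm_single (by norm_num) β 1).trans norm_one

theorem coe_smul_tmul {E G : Type*} [NormedAddCommGroup E] [InnerProductSpace ℂ E]
    [NormedAddCommGroup G] [InnerProductSpace ℂ G] (c : ℂ) (x : E) (g : G) :
    ((c • (x ⊗ₜ[ℂ] g) : E ⊗[ℂ] G) : HTensor E G) = c • slice E g x := by
  rw [UniformSpace.Completion.coe_smul, slice_apply]

/-- The Berezin kernel exists: by the reconstruction formula for `D`, the coefficients
`√b_β R^{1/2} A_β* h` are square summable, with sum of squares `⟪h, D h⟫`. -/
theorem exists_isBerezinKernel (hm : ∀ i, 0 < m i) (hΦ : ∀ i, PhiWellDefined (f i) (A i))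
    (hD : D ∈ pureCone f m A) :
    ∃ K : H →L[ℂ] HTensor (Fock n) (rangeSqrt (defect f A m D)),
      IsBerezinKernel f m A (defect f A m D) K ∧ ∀ x, ⟪K x, K x⟫_ℂ = ⟪x, D x⟫_ℂ := by
  set R := defect f A m D with hRdef
  have hR : 0 ≤ R := defect_nonneg_of_mem_pureCone hD le_rfl
  let T : Words n → H →L[ℂ] rangeSqrt R := fun β =>
    (kernelWeight f m β : ℂ) • (sqrtCLM R ∘L multiOpStar A β)
  have hT : ∀ x, ∑' β, ENNReal.ofReal (‖T β x‖ ^ 2) = qform D x := fun x => by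
    rw [qform_eq_of_mem_pureCone hΦ hD]
    refine tsum_congr fun β => ?_
    have : ‖T β x‖ ^ 2 = kernelWeight f m β ^ 2 * ‖CFC.sqrt R (multiOpStar A β x)‖ ^ 2 := by
      change ‖(kernelWeight f m β : ℂ) • sqrtVec R (multiOpStar A β x)‖ ^ 2 = _
      rw [norm_smul, mul_pow, Complex.norm_real, Real.norm_eq_abs, sq_abs]
      rfl
    rw [this, ENNReal.ofReal_mul (sq_nonneg _), ofReal_kernelWeight_sq hm,
      ofReal_norm_sq_sqrt_apply hR]
  obtain ⟨U, hU⟩ := exists_clm_lp (T := T) (norm_nonneg D)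
    (fun x => (hT x).trans_le (qform_le D x))
  let V : Words n → rangeSqrt R →ₗᵢ[ℂ] HTensor (Fock n) (rangeSqrt R) := fun β =>
    ⟨(UniformSpace.Completion.toComplL ∘L
      TensorProduct.mkL ℂ (Fock n) (rangeSqrt R) (basisVec β)).toLinearMap, fun g => by
      change ‖((basisVec β ⊗ₜ[ℂ] g : Fock n ⊗[ℂ] rangeSqrt R) : HTensor (Fock n) (rangeSqrt R))‖ = _
      rw [UniformSpace.Completion.norm_coe, TensorProduct.norm_tmul, norm_basisVec,
        one_mul]⟩
  have hV : OrthogonalFamily ℂ (fun _ : Words n => rangeSqrt R) V := fun β γ hβγ g h => by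
    change ⟪slice (Fock n) g (basisVec β), slice (Fock n) h (basisVec γ)⟫_ℂ = 0
    rw [inner_slice_slice, inner_basisVec, basisVec_apply_of_ne hβγ, zero_mul]
  refine ⟨hV.linearIsometry.toContinuousLinearMap ∘L U, fun h => ?_, fun x => ?_⟩
  · change HasSum _ (hV.linearIsometry (U h))
    convert hV.hasSum_linearIsometry (U h) using 2 with β
    rw [hU, coe_smul_tmul]
    exact ((V β).map_smul (kernelWeight f m β : ℂ) (sqrtVec R (multiOpStar A β h))).symm
  · change ⟪hV.linearIsometry (U x), hV.linearIsometry (U x)⟫_ℂ = _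
    rw [LinearIsometry.inner_map_map, inner_eq_toReal_qform hD.1, ← hT,
      ENNReal.tsum_toReal_eq fun i => ENNReal.ofReal_ne_top]
    have h1 := lp.hasSum_inner (𝕜 := ℂ) (U x) (U x)
    simp_rw [hU, inner_self_eq_norm_sq_to_K] at h1
    rw [inner_self_eq_norm_sq_to_K, ← h1.tsum_eq]
    push_cast
    refine tsum_congr fun β => ?_
    rw [ENNReal.toReal_ofReal (sq_nonneg _)]
    norm_cast

variable {K : H →L[ℂ] HTensor (Fock n) (rangeSqrt R)}

/-- The coordinates of the slices of the Berezin kernel. -/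
theorem adjoint_slice_kernel_apply (hK : IsBerezinKernel f m A R K) (g : rangeSqrt R) (h : H)
    (β : Words n) :
    ContinuousLinearMap.adjoint (slice (Fock n) g) (K h) β
      = kernelWeight f m β * ⟪g, sqrtVec R (multiOpStar A β h)⟫_ℂ := by
  have h1 := (hK h).mapL (innerSL ℂ (slice (Fock n) g (basisVec β)))
  have h2 : ∀ γ, innerSL ℂ (slice (Fock n) g (basisVec β))
      ((((∏ i, √(bCoeff (f i) (m i) (γ i)) : ℝ) : ℂ)
        • (basisVec γ ⊗ₜ[ℂ] sqrtVec R (multiOpStar A γ h)) : Fock n ⊗[ℂ] rangeSqrt R) :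
        HTensor (Fock n) (rangeSqrt R))
      = kernelWeight f m γ * ((basisVec γ : Fock n) β
        * ⟪g, sqrtVec R (multiOpStar A γ h)⟫_ℂ) := fun γ => by
    rw [coe_smul_tmul, map_smul, innerSL_apply_apply,
      inner_slice_slice, inner_basisVec]
    rfl
  simp_rw [h2] at h1
  have h3 := hasSum_single (f := fun γ => (kernelWeight f m γ : ℂ) * ((basisVec γ : Fock n) β
        * ⟪g, sqrtVec R (multiOpStar A γ h)⟫_ℂ)) β fun γ hγ => by
    rw [basisVec_apply_of_ne hγ.symm, zero_mul, mul_zero]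
  rw [← inner_basisVec, ContinuousLinearMap.adjoint_inner_right]
  refine (h1.unique h3).trans ?_
  rw [basisVec_apply_self, one_mul]

theorem multiOpStar_leftMul (hcomm : CommutingTuples A) (i : Fin k) (j : Fin (n i))
    (β : Words n) :
    multiOpStar A (leftMul i j β) = multiOpStar A β * ContinuousLinearMap.adjoint (A i j) := by
  rw [← adjoint_multiOp hcomm, ← adjoint_multiOp hcomm, ← multiOp_leftMul hcomm, adjoint_mul_eq]

/-- The slices of the Berezin kernel intertwine `A_{i,j}*` and `𝐖_{i,j}*`. -/
theorem adjoint_slice_kernel_adjoint (hcomm : CommutingTuples A)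
    (hK : IsBerezinKernel f m A R K) (g : rangeSqrt R) (i : Fin k) (j : Fin (n i)) (h : H) :
    ContinuousLinearMap.adjoint (slice (Fock n) g) (K (ContinuousLinearMap.adjoint (A i j) h))
      = ContinuousLinearMap.adjoint (W f m i j)
          (ContinuousLinearMap.adjoint (slice (Fock n) g) (K h)) := by
  ext β
  rw [adjoint_W_apply, adjoint_slice_kernel_apply hK, adjoint_slice_kernel_apply hK,
    multiOpStar_leftMul hcomm, mul_apply_eq_comp, ← mul_assoc, ← Complex.ofReal_mul,
    weight_mul_kernelWeight_leftMul]

/-- The slices of the Berezin kernel map into `N_Q`, because `q(A) = 0` for `q ∈ Q`. -/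
theorem adjoint_slice_kernel_mem_NQ (hcomm : CommutingTuples A) {Q : Set (NCPoly n)}
    (hA : ∀ q ∈ Q, polyEval q A = 0) (hK : IsBerezinKernel f m A R K) (g : rangeSqrt R) (h : H) :
    ContinuousLinearMap.adjoint (slice (Fock n) g) (K h) ∈ NQ f m Q := by
  set κ : H →L[ℂ] Fock n := ContinuousLinearMap.adjoint (slice (Fock n) g) ∘L K with hκ
  have hmul : ∀ α u, ContinuousLinearMap.adjoint κ (multiOp (W f m) α u)
      = multiOp A α (ContinuousLinearMap.adjoint κ u) := fun α u => by
    refine ext_inner_right ℂ fun y => ?_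
    rw [ContinuousLinearMap.adjoint_inner_left, ← ContinuousLinearMap.adjoint_inner_right,
      ← map_adjoint_multiOp (T := κ) (X := A)
        (fun i j x => adjoint_slice_kernel_adjoint hcomm hK g i j x),
      ← ContinuousLinearMap.adjoint_inner_left, ContinuousLinearMap.adjoint_inner_right]
  have hpoly : ∀ q u, ContinuousLinearMap.adjoint κ (polyEval q (W f m) u)
      = polyEval q A (ContinuousLinearMap.adjoint κ u) := fun q u => by
    simp only [polyEval, Finsupp.sum, sum_apply, smul_apply, map_sum, map_smul, hmul]
  have hle : MQ f m Q ≤ (ℂ ∙ (κ h))ᗮ := by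
    refine Submodule.topologicalClosure_minimal _ (Submodule.span_le.2 ?_)
      (Submodule.isClosed_orthogonal _)
    rintro _ ⟨α, β, q, c, hq, rfl⟩
    rw [SetLike.mem_coe, Submodule.mem_orthogonal_singleton_iff_inner_left,
      ← ContinuousLinearMap.adjoint_inner_left, mul_apply_eq_comp, mul_apply_eq_comp, hmul,
      hpoly, hA q hq, zero_apply, map_zero, inner_zero_left]
  rw [Submodule.mem_orthogonal]
  intro u hu
  exact Submodule.mem_orthogonal_singleton_iff_inner_left.1 (hle hu)

variable {Q : Set (NCPoly n)}

/-- The projection onto `N_Q` does not change the slices of the kernel, as they take values in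
`N_Q`. -/
theorem coe_adjoint_slice_constrainedKernel (hcomm : CommutingTuples A)
    (hA : ∀ q ∈ Q, polyEval q A = 0) (hK : IsBerezinKernel f m A R K) (g : rangeSqrt R) (h : H) :
    ((ContinuousLinearMap.adjoint (slice (NQ f m Q) g) (constrainedKernel f m Q R K h) :
        NQ f m Q) : Fock n)
      = ContinuousLinearMap.adjoint (slice (Fock n) g) (K h) := by
  rw [constrainedKernel, ContinuousLinearMap.comp_apply, adjoint_slice_tensorId]
  exact Submodule.starProjection_eq_self_iff.2 (adjoint_slice_kernel_mem_NQ hcomm hA hK g h)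

theorem inner_constrainedKernel (hcomm : CommutingTuples A)
    (hA : ∀ q ∈ Q, polyEval q A = 0) (hK : IsBerezinKernel f m A R K) (x y : H) :
    ⟪constrainedKernel f m Q R K x, constrainedKernel f m Q R K y⟫_ℂ = ⟪K x, K y⟫_ℂ := by
  obtain ⟨w, b, -⟩ := exists_hilbertBasis ℂ (rangeSqrt R)
  refine (hasSum_inner_adjoint_slice b _ _).unique ?_
  simp_rw [Submodule.coe_inner, coe_adjoint_slice_constrainedKernel hcomm hA hK]
  exact hasSum_inner_adjoint_slice b _ _

theorem tensorId_one {E G : Type*} [NormedAddCommGroup E] [InnerProductSpace ℂ E]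
    [NormedAddCommGroup G] [InnerProductSpace ℂ G] : tensorId G (1 : E →L[ℂ] E) = 1 :=
  HTensor.clm_ext fun x g => by rw [tensorId_tmul]; rfl

/-- The Berezin transform of `I` is `K* K = D`. -/
theorem berezinTransform_constrainedKernel_one (hcomm : CommutingTuples A)
    (hA : ∀ q ∈ Q, polyEval q A = 0) (hK : IsBerezinKernel f m A R K)
    (hKD : ∀ x, ⟪K x, K x⟫_ℂ = ⟪x, D x⟫_ℂ) :
    berezinTransform (constrainedKernel f m Q R K) 1 = D := by
  refine ContinuousLinearMap.coe_injective ((ext_inner_map _ _).1 fun x => ?_)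
  rw [← inner_conj_symm, ← inner_conj_symm _ x]
  congr 1
  change ⟪x, berezinTransform (constrainedKernel f m Q R K) 1 x⟫_ℂ = ⟪x, D x⟫_ℂ
  rw [inner_berezinTransform, tensorId_one, one_apply_eq_self,
    inner_constrainedKernel hcomm hA hK, hKD]

/-- The intertwining relation of the Berezin transform, from that of the slices of the kernel. -/
theorem berezinTransform_constrainedKernel_mul (hcomm : CommutingTuples A)
    (hA : ∀ q ∈ Q, polyEval q A = 0) (hK : IsBerezinKernel f m A R K) (α β : Words n) :
    berezinTransform (constrainedKernel f m Q R K)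
        (multiOp (S f m Q) α * ContinuousLinearMap.adjoint (multiOp (S f m Q) β))
      = multiOp A α * berezinTransform (constrainedKernel f m Q R K) 1
        * ContinuousLinearMap.adjoint (multiOp A β) := by
  obtain ⟨w, b, -⟩ := exists_hilbertBasis ℂ (rangeSqrt R)
  ext y
  refine ext_inner_left ℂ fun x => ?_
  refine (hasSum_inner_berezinTransform b _ _ x y).unique ?_
  have hint : ∀ (g : rangeSqrt R) (γ : Words n) (z : H),
      ContinuousLinearMap.adjoint (slice (NQ f m Q) g)
        (constrainedKernel f m Q R K (ContinuousLinearMap.adjoint (multiOp A γ) z))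
      = ContinuousLinearMap.adjoint (multiOp (S f m Q) γ)
        (ContinuousLinearMap.adjoint (slice (NQ f m Q) g) (constrainedKernel f m Q R K z)) :=
    fun g γ z => map_adjoint_multiOp (X := A) (Y := S f m Q)
      (T := ContinuousLinearMap.adjoint (slice (NQ f m Q) g) ∘L constrainedKernel f m Q R K)
      (fun i j x => Subtype.ext (by
        rw [coe_adjoint_S, ContinuousLinearMap.comp_apply, ContinuousLinearMap.comp_apply,
          coe_adjoint_slice_constrainedKernel hcomm hA hK,
          coe_adjoint_slice_constrainedKernel hcomm hA hK,
          adjoint_slice_kernel_adjoint hcomm hK])) γ z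
  have h1 := hasSum_inner_berezinTransform b (constrainedKernel f m Q R K) 1
    (ContinuousLinearMap.adjoint (multiOp A α) x) (ContinuousLinearMap.adjoint (multiOp A β) y)
  simp only [hint, one_apply_eq_self] at h1
  rw [ContinuousLinearMap.adjoint_inner_left] at h1
  simp only [mul_apply_eq_comp]
  convert h1 using 2 with i
  exact (ContinuousLinearMap.adjoint_inner_left _ _ _).symm

end Kernel

/-! ### Defects of the identity under the universal model -/

section ModelDefects

variable {k : ℕ} {n : Fin k → ℕ} {f : ∀ i, PosRegular (n i)} {m : Fin k → ℕ}

/-- Fubini for a product weight: the sum over the `i`-th word is carried out first. -/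
theorem tsum_prod_mul_eq_tsum_split (i : Fin k) (u : ∀ l, FreeMonoid (Fin (n l)) → ℝ≥0∞)
    (g : Words n → ℝ≥0∞) :
    ∑' β : Words n, (∏ l, u l (β l)) * g β
      = ∑' r : ∀ l : {l // l ≠ i}, FreeMonoid (Fin (n l)),
        (∏ l : {l // l ≠ i}, u l (r l))
        * ∑' x, u i x * g ((Equiv.piSplitAt i fun l => FreeMonoid (Fin (n l))).symm (x, r)) := by
  rw [← (Equiv.piSplitAt i fun l => FreeMonoid (Fin (n l))).symm.tsum_eq, ENNReal.tsum_prod',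
    ENNReal.tsum_comm]
  refine tsum_congr fun r => ?_
  rw [← ENNReal.tsum_mul_left]
  refine tsum_congr fun x => ?_
  rw [← mul_assoc]
  congr 1
  rw [Fintype.prod_eq_mul_prod_subtype_ne _ i, mul_comm]
  congr 1
  · refine Finset.prod_congr rfl fun l _ => ?_
    simp [Equiv.piSplitAt, l.2]
  · simp [Equiv.piSplitAt]

/-- The identity `b^{(e+1)} = b^{(e)} + a * b^{(e+1)}` in the `i`-th variable. -/
theorem tsum_prod_bWord_mul (i : Fin k) (e : Fin k → ℕ) {e' : ℕ} (he : e i = e' + 1)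
    (g : Words n → ℝ≥0∞) :
    ∑' β : Words n, (∏ l, bWord (f l) (e l) (β l)) * g β
      = ∑' β : Words n, (∏ l, bWord (f l) (Function.update e i e' l) (β l)) * g β
        + ∑' α, ENNReal.ofReal ((f i).coeff α) * ∑' β : Words n,
          (∏ l, bWord (f l) (e l) (β l)) * g (Function.update β i (α * β i)) := by
  have hupd : ∀ α x r, Function.update
      ((Equiv.piSplitAt i fun l => FreeMonoid (Fin (n l))).symm (x, r)) i
        (α * ((Equiv.piSplitAt i fun l => FreeMonoid (Fin (n l))).symm (x, r)) i)
      = (Equiv.piSplitAt i fun l => FreeMonoid (Fin (n l))).symm (α * x, r) := by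
    intro α x r
    funext l
    by_cases h : l = i
    · subst h
      simp [Equiv.piSplitAt]
    · simp [Equiv.piSplitAt, h]
  have h1 := fun g => tsum_prod_mul_eq_tsum_split i (fun l => bWord (f l) (e l)) g
  have h2 := tsum_prod_mul_eq_tsum_split i (fun l => bWord (f l) (Function.update e i e' l)) g
  simp only [h1, hupd, h2, ← ENNReal.tsum_mul_left]
  rw [ENNReal.tsum_comm (α := FreeMonoid (Fin (n i))), ← ENNReal.tsum_add]
  refine tsum_congr fun r => ?_
  have h3 : ∏ l : {l // l ≠ i}, bWord (f l) (Function.update e i e' l) (r l)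
      = ∏ l : {l // l ≠ i}, bWord (f l) (e l) (r l) :=
    Finset.prod_congr rfl fun l _ => by rw [Function.update_of_ne l.2]
  simp only [ENNReal.tsum_mul_left, mul_left_comm (ENNReal.ofReal _), h3, Function.update_self, he]
  rw [← mul_add, tsum_bWord_succ_mul]
  simp only [ENNReal.tsum_mul_left, mul_left_comm (bWord _ _ _) (ENNReal.ofReal _)]

/-- The normalized squared coordinate `|x_β|² / b_β` of a vector of the Fock space. -/
def normSqCoord (f : ∀ i, PosRegular (n i)) (m : Fin k → ℕ) (x : Fock n) (β : Words n) : ℝ≥0∞ :=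
  ENNReal.ofReal (‖x β‖ ^ 2 / kernelWeight f m β ^ 2)

/-- The normalization absorbs the weights of `𝐖_{i,j}`. -/
theorem normSqCoord_adjoint_wordOp_W (i : Fin k) (α : FreeMonoid (Fin (n i))) (x : Fock n)
    (β : Words n) :
    normSqCoord f m (ContinuousLinearMap.adjoint (wordOp (W f m i) α) x) β
      = normSqCoord f m x (Function.update β i (α * β i)) := by
  rw [normSqCoord, normSqCoord, adjoint_wordOp_W_apply, ← mul_kernelWeight_update i α β]
  congr 1
  have h1 := (Real.sqrt_pos.2 (bCoeff_pos (f i) (m i) (α * β i))).ne'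
  have h2 := (Real.sqrt_pos.2 (bCoeff_pos (f i) (m i) (β i))).ne'
  have h3 := (kernelWeight_pos (f := f) (m := m) (Function.update β i (α * β i))).ne'
  rw [norm_mul, Complex.norm_real, Real.norm_of_nonneg (by positivity)]
  field_simp

theorem prod_bWord_mul_normSqCoord (hm : ∀ i, 0 < m i) (x : Fock n) (β : Words n) :
    (∏ i, bWord (f i) (m i) (β i)) * normSqCoord f m x β = ENNReal.ofReal (‖x β‖ ^ 2) := by
  have h := (kernelWeight_pos (f := f) (m := m) β).ne'
  rw [normSqCoord, ← ofReal_kernelWeight_sq hm, ← ENNReal.ofReal_mul (sq_nonneg _)]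
  congr 1
  field_simp

theorem tsum_ofReal_norm_sq (x : Fock n) :
    ∑' β, ENNReal.ofReal (‖x β‖ ^ 2) = ENNReal.ofReal (‖x‖ ^ 2) := by
  have h : HasSum (fun β => ‖x β‖ ^ 2) (‖x‖ ^ 2) := by
    have := lp.hasSum_norm (p := 2) (by norm_num) x
    simpa using this
  rw [← h.tsum_eq, ENNReal.ofReal_tsum_of_nonneg (fun _ => sq_nonneg _) h.summable]

variable {Q : Set (NCPoly n)}

theorem qform_one_eq_tsum (hm : ∀ i, 0 < m i) (x : NQ f m Q) :
    qform (1 : NQ f m Q →L[ℂ] NQ f m Q) x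
      = ∑' β : Words n, (∏ i, bWord (f i) (m i) (β i)) * normSqCoord f m (x : Fock n) β := by
  simp_rw [prod_bWord_mul_normSqCoord hm]
  rw [tsum_ofReal_norm_sq, qform_one]
  rfl

/-- The action of `Φ_{f_i,S_i}` on a quadratic form which is diagonal in the coordinates of the
Fock space. -/
theorem psi_S_apply (i : Fin k) {q : NQ f m Q → ℝ≥0∞} {c : Words n → ℝ≥0∞}
    (hq : ∀ x, q x = ∑' β, c β * normSqCoord f m (x : Fock n) β) (x : NQ f m Q) :
    psi (f i) (S f m Q i) q x = ∑' α, ENNReal.ofReal ((f i).coeff α)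
      * ∑' β, c β * normSqCoord f m (x : Fock n) (Function.update β i (α * β i)) := by
  simp only [psi, hq, coe_adjoint_wordOp_S, normSqCoord_adjoint_wordOp_W]

/-- `Φ_{f_i,S_i}(I) ≤ I`, since `a * b^{(m)} ≤ b^{(m)}` for the convolution product. -/
theorem psi_S_le (hm : ∀ i, 0 < m i) (i : Fin k) (x : NQ f m Q) :
    psi (f i) (S f m Q i) (qform 1) x ≤ qform (1 : NQ f m Q →L[ℂ] NQ f m Q) x := by
  rw [psi_S_apply i (qform_one_eq_tsum hm), qform_one_eq_tsum hm,
    tsum_prod_bWord_mul i m (Nat.succ_pred_eq_of_pos (hm i)).symm]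
  exact le_add_self

theorem phiWellDefined_S (hm : ∀ i, 0 < m i) (i : Fin k) :
    PhiWellDefined (f i) (S f m Q i) :=
  (hasSum_phiTerm (C := 1) zero_le_one zero_le_one fun x =>
    (psi_S_le hm i x).trans_eq (by rw [qform_one, one_mul])).2.1.summable

/-- One application of `id - Φ_{f_i,S_i}` lowers the exponent of `b` in the `i`-th variable. -/
theorem sub_phi_S_spec (hm : ∀ i, 0 < m i) (i : Fin k) {X : NQ f m Q →L[ℂ] NQ f m Q} (hX : 0 ≤ X)
    {e : Fin k → ℕ} {e' : ℕ} (he : e i = e' + 1)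
    (hq : ∀ x, qform X x
      = ∑' β : Words n, (∏ l, bWord (f l) (e l) (β l)) * normSqCoord f m (x : Fock n) β) :
    0 ≤ X - Phi (f i) (S f m Q i) X ∧ ∀ x, qform (X - Phi (f i) (S f m Q i) X) x
      = ∑' β : Words n, (∏ l, bWord (f l) (Function.update e i e' l) (β l))
          * normSqCoord f m (x : Fock n) β := by
  obtain ⟨h1, -, h2⟩ := phi_spec (phiWellDefined_S (Q := Q) hm i) hX
  have h3 : ∀ x, qform X x
      = ∑' β : Words n, (∏ l, bWord (f l) (Function.update e i e' l) (β l))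
          * normSqCoord f m (x : Fock n) β + qform (Phi (f i) (S f m Q i) X) x := fun x => by
    rw [h2, psi_S_apply i hq, hq, tsum_prod_bWord_mul i e he]
  have h4 : 0 ≤ X - Phi (f i) (S f m Q i) X := nonneg_of_qform hX h1 fun x => by
    rw [h3 x]
    exact le_add_self
  refine ⟨h4, fun x => ?_⟩
  have h5 := (qform_eq_qform_sub_add h1 h4 x).symm.trans (h3 x)
  exact (ENNReal.add_left_inj (qform_lt_top _ _).ne).1 h5

/-- The quadratic form of `Φ_{f_i,S_i}^s(I)` only involves words of length at least `s` in the
`i`-th variable, as the function `f_i` has no constant term. -/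
theorem qform_phi_S_iterate_le (hm : ∀ i, 0 < m i) (i : Fin k) (s : ℕ) (x : NQ f m Q) :
    qform ((Phi (f i) (S f m Q i))^[s] 1) x
      ≤ ∑' β : Words n, {β : Words n | s ≤ (β i).length}.indicator
          (fun β => ENNReal.ofReal (‖(x : Fock n) β‖ ^ 2)) β := by
  have hconv : ∀ (s : ℕ) (x : NQ f m Q) (β : Words n), {β : Words n | s ≤ (β i).length}.indicator
      (fun β => ENNReal.ofReal (‖(x : Fock n) β‖ ^ 2)) β
      = (∏ l, bWord (f l) (m l) (β l)) * {β : Words n | s ≤ (β i).length}.indicator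
          (normSqCoord f m (x : Fock n)) β := fun s x β => by
    by_cases h : s ≤ (β i).length
    · simp [h, prod_bWord_mul_normSqCoord hm]
    · simp [h]
  induction s generalizing x with
  | zero =>
    simp only [Function.iterate_zero, id]
    rw [qform_one_eq_tsum hm]
    exact ENNReal.tsum_le_tsum fun β => by simp [prod_bWord_mul_normSqCoord hm]
  | succ s ih =>
    have hs := phi_iterate_spec (f := f i) (A := S f m Q i) (phiWellDefined_S hm i)
      (zero_le_one (α := NQ f m Q →L[ℂ] NQ f m Q)) s
    rw [Function.iterate_succ_apply', (phi_spec (phiWellDefined_S hm i) hs.1).2.2]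
    simp_rw [hconv] at ih ⊢
    rw [tsum_prod_bWord_mul i m (Nat.succ_pred_eq_of_pos (hm i)).symm]
    -- only the second summand `a * b` is needed: a nonempty `α` makes `α β_i` longer than `β_i`
    refine le_trans ?_ le_add_self
    refine ENNReal.tsum_le_tsum fun α => ?_
    by_cases hα : α = 1
    · simp [hα, (f i).coeff_one]
    gcongr
    refine (ih _).trans (ENNReal.tsum_le_tsum fun β => ?_)
    gcongr
    by_cases h : s ≤ (β i).length
    · have hpos : 0 < α.length := Nat.pos_of_ne_zero fun h0 => hα (FreeMonoid.length_eq_zero.1 h0)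
      have h' : s + 1 ≤ (α * β i).length := by
        rw [FreeMonoid.length_mul]
        omega
      rw [Set.indicator_of_mem (show β ∈ {β : Words n | s ≤ (β i).length} from h),
        Set.indicator_of_mem (by simpa using h'), coe_adjoint_wordOp_S,
        normSqCoord_adjoint_wordOp_W]
    · rw [Set.indicator_of_notMem (show β ∉ {β : Words n | s ≤ (β i).length} from h)]
      exact zero_le

theorem tendsto_tsum_indicator (i : Fin k) (x : Fock n) :
    Tendsto (fun s : ℕ => ∑' β : Words n, {β : Words n | s ≤ (β i).length}.indicator
          (fun β => ENNReal.ofReal (‖x β‖ ^ 2)) β) atTop (𝓝 0) := by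
  have hsum : Summable fun β => ‖x β‖ ^ 2 := by
    have := (lp.hasSum_norm (p := 2) (by norm_num) x).summable
    simpa using this
  have h := tendsto_tsum_of_dominated_convergence
    (f := fun (s : ℕ) β => {β : Words n | s ≤ (β i).length}.indicator (fun β => ‖x β‖ ^ 2) β)
    (g := fun _ => 0) hsum (fun β => ?_) (𝓕 := atTop) (Eventually.of_forall fun s β => ?_)
  · have h' := ENNReal.tendsto_ofReal h
    rw [tsum_zero, ENNReal.ofReal_zero] at h'
    refine h'.congr fun s => ?_
    rw [ENNReal.ofReal_tsum_of_nonneg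
      (fun β => Set.indicator_nonneg (fun _ _ => sq_nonneg _) β) (hsum.indicator _)]
    refine tsum_congr fun β => ?_
    by_cases h : s ≤ (β i).length <;> simp [h]
  · refine tendsto_const_nhds.congr' ?_
    filter_upwards [eventually_gt_atTop (β i).length] with s hs
    rw [Set.indicator_of_notMem]
    simpa using hs
  · rw [Real.norm_of_nonneg (Set.indicator_nonneg (fun _ _ => sq_nonneg _) β)]
    exact Set.indicator_le_self' (fun _ _ => sq_nonneg _) β

end ModelDefects

/-! ### `w*`-limits -/

section WStarLimits

variable {E H : Type*} [NormedAddCommGroup E] [InnerProductSpace ℂ E]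
  [NormedAddCommGroup H] [InnerProductSpace ℂ H]

/-- On bounded sets, weak operator convergence implies `w*`-convergence. -/
theorem tendsto_wstar_of_bounded {ι : Type*} {l : Filter ι} {T : ι → E →L[ℂ] E} {X : E →L[ℂ] E}
    {C : ℝ} (hC : ∀ i, ‖T i‖ ≤ C)
    (h : ∀ x y, Tendsto (fun i => ⟪x, T i y⟫_ℂ) l (𝓝 ⟪x, X y⟫_ℂ)) :
    Tendsto T l (@nhds _ (wstar E) X) := by
  rw [nhds_induced, tendsto_comap_iff, tendsto_pi_nhds]
  rintro ⟨ψ, hψ⟩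
  have hspan : ∀ ψ ∈ Submodule.span ℂ (Set.range fun z : E × E => vectorFunctional E z.1 z.2),
      Tendsto (fun i => ψ (T i)) l (𝓝 (ψ X)) := fun ψ hψ => by
    induction hψ using Submodule.span_induction with
    | mem ψ hψ =>
      obtain ⟨z, rfl⟩ := hψ
      exact h z.1 z.2
    | zero => exact tendsto_const_nhds
    | add ψ ψ' _ _ h1 h2 => exact h1.add h2
    | smul c ψ _ h1 => exact h1.const_smul c
  change Tendsto (fun i => ψ (T i)) l (𝓝 (ψ X))
  refine Metric.tendsto_nhds.2 fun ε hε => ?_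
  have hD : 0 < |C| + ‖X‖ + 1 := by positivity
  obtain ⟨ψ', hψ', hd⟩ := (Metric.mem_closure_iff (α := StrongDual ℂ (E →L[ℂ] E))).1 hψ
    (ε / 2 / (|C| + ‖X‖ + 1)) (by positivity)
  filter_upwards [Metric.tendsto_nhds.1 (hspan ψ' hψ') (ε / 2) (by positivity)] with i hi
  replace hd : ‖ψ - ψ'‖ < ε / 2 / (|C| + ‖X‖ + 1) :=
    (dist_eq_norm (E := StrongDual ℂ (E →L[ℂ] E)) ψ ψ').symm.trans_lt hd
  rw [dist_eq_norm] at hi ⊢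
  have h1 : ‖(ψ - ψ') (T i - X)‖ ≤ ‖ψ - ψ'‖ * (|C| + ‖X‖ + 1) := by
    refine (ContinuousLinearMap.le_opNorm _ _).trans ?_
    gcongr
    have := (norm_sub_le (T i) X).trans (add_le_add_left ((hC i).trans (le_abs_self C)) ‖X‖)
    linarith
  have h2 : ‖ψ - ψ'‖ * (|C| + ‖X‖ + 1) < ε / 2 := (lt_div_iff₀ hD).1 hd
  have h3 : ψ (T i) - ψ X = (ψ - ψ') (T i - X) + (ψ' (T i) - ψ' X) := by
    simp only [sub_apply, map_sub]
    ring
  rw [h3]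
  exact (norm_add_le _ _).trans_lt (by linarith)

theorem WStarContinuous.tendsto_inner {V : Submodule ℂ (E →L[ℂ] E)} {φ : V →ₗ[ℂ] (H →L[ℂ] H)}
    (hφ : WStarContinuous φ) {ι : Type*} {l : Filter ι} {Y : ι → V} {Z : V}
    (h : Tendsto (fun i => (Y i : E →L[ℂ] E)) l (@nhds _ (wstar E) Z)) (x y : H) :
    Tendsto (fun i => ⟪x, φ (Y i) y⟫_ℂ) l (𝓝 ⟪x, φ Z y⟫_ℂ) := by
  let : TopologicalSpace (E →L[ℂ] E) := wstar E
  let : TopologicalSpace (H →L[ℂ] H) := wstar H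
  have h1 : Tendsto Y l (𝓝 Z) := by
    rw [nhds_induced, tendsto_comap_iff]
    exact h
  exact ((continuous_wstar_apply x y).tendsto _).comp
    ((Continuous.tendsto (show Continuous φ from hφ) Z).comp h1)

/-- `map_sub` for an abstract `V`, where the additive structures involved unify at once. -/
theorem map_sub_submodule {V : Submodule ℂ (E →L[ℂ] E)} (φ : V →ₗ[ℂ] (H →L[ℂ] H)) (X Y : V) :
    φ (X - Y) = φ X - φ Y := map_sub φ X Y

theorem CompletelyPos.map_nonneg {V : Submodule ℂ (E →L[ℂ] E)} {φ : V →ₗ[ℂ] (H →L[ℂ] H)}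
    (hφ : CompletelyPos φ) {X : V} (hX : 0 ≤ (X : E →L[ℂ] E)) : 0 ≤ φ X := by
  refine nonneg_iff_forall_inner.2 fun x => ?_
  have := hφ 1 (fun _ _ => X) (fun x => by simpa using nonneg_iff_forall_inner.1 hX (x 0))
    (fun _ => x)
  simpa using this

variable [CompleteSpace E]

/-- A weakly convergent series of positive operators converges in the `w*`-topology, as its partial
sums are bounded by the sum. -/
theorem tendsto_wstar_of_hasSum_ofCLM {ι : Type*} {t : ι → E →L[ℂ] E} {X : E →L[ℂ] E}
    (ht : ∀ i, 0 ≤ t i) (h : HasSum (fun i => ContinuousLinearMapWOT.ofCLM (t i))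
      (ContinuousLinearMapWOT.ofCLM X)) :
    Tendsto (fun F : Finset ι => ∑ i ∈ F, t i) atTop (@nhds _ (wstar E) X) := by
  have hinner := hasSum_ofCLM_iff.1 h
  refine tendsto_wstar_of_bounded (C := ‖X‖) (fun F => ?_) fun x y => ?_
  · refine CStarAlgebra.norm_le_norm_of_nonneg_of_le (Finset.sum_nonneg fun i _ => ht i)
      (sub_nonneg.1 (nonneg_iff_forall_inner.2 fun x => ?_))
    rw [sub_apply, inner_sub_right, sub_nonneg, sum_apply, inner_sum]
    exact sum_le_hasSum F (fun i _ => nonneg_iff_forall_inner.1 (ht i) x) (hinner x)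
  · rw [HasSum, SummationFilter.unconditional_filter,
      ContinuousLinearMapWOT.tendsto_iff_forall_inner_apply_tendsto] at h
    refine (h y x).congr fun F => ?_
    rw [← ofCLM_sum]
    rfl

/-- A `w*`-continuous map commutes with weakly convergent series of positive operators. -/
theorem WStarContinuous.exists_hasSum_map [CompleteSpace H] {V : Submodule ℂ (E →L[ℂ] E)}
    (hV : @IsClosed _ (wstar E) (V : Set (E →L[ℂ] E))) {φ : V →ₗ[ℂ] (H →L[ℂ] H)}
    (hφ : WStarContinuous φ) {ι : Type*} {t : ι → V} {X : E →L[ℂ] E}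
    (ht : ∀ i, 0 ≤ (t i : E →L[ℂ] E))
    (h : HasSum (fun i => ContinuousLinearMapWOT.ofCLM (t i : E →L[ℂ] E))
      (ContinuousLinearMapWOT.ofCLM X)) :
    ∃ Y : V, (Y : E →L[ℂ] E) = X ∧ HasSum (fun i => ContinuousLinearMapWOT.ofCLM (φ (t i)))
      (ContinuousLinearMapWOT.ofCLM (φ Y)) := by
  have hlim : Tendsto (fun F : Finset ι => ((∑ i ∈ F, t i : V) : E →L[ℂ] E)) atTop
      (@nhds _ (wstar E) X) := by
    simpa using tendsto_wstar_of_hasSum_ofCLM ht h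
  have hX : X ∈ V := by
    let : TopologicalSpace (E →L[ℂ] E) := wstar E
    exact hV.mem_of_tendsto hlim (Eventually.of_forall fun F => (∑ i ∈ F, t i).2)
  refine ⟨⟨X, hX⟩, rfl, hasSum_ofCLM_iff.2 fun x => ?_⟩
  rw [HasSum, SummationFilter.unconditional_filter]
  refine (hφ.tendsto_inner (Z := ⟨X, hX⟩) hlim x x).congr fun F => ?_
  rw [map_sum, sum_apply, inner_sum]

theorem continuous_wstar_conj (T : E →L[ℂ] E) :
    @Continuous _ _ (wstar E) (wstar E)
      (fun X => T * X * ContinuousLinearMap.adjoint T) := by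
  refine continuous_wstar_of_vectorFunctional
    (ContinuousLinearMap.mulLeftRight ℂ (E →L[ℂ] E) T (ContinuousLinearMap.adjoint T))
    fun x y => ?_
  have : vectorFunctional E x y ∘L
      ContinuousLinearMap.mulLeftRight ℂ (E →L[ℂ] E) T (ContinuousLinearMap.adjoint T)
      = vectorFunctional E (ContinuousLinearMap.adjoint T x)
          (ContinuousLinearMap.adjoint T y) := by
    ext X
    simp only [ContinuousLinearMap.comp_apply, vectorFunctional_apply,
      ContinuousLinearMap.mulLeftRight_apply, mul_apply_eq_comp,
      ContinuousLinearMap.adjoint_inner_left]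
  rw [this]
  exact vectorFunctional_mem_predual _ _

end WStarLimits

/-! ### Completely positive maps on the operator system -/

section OpSystem

variable {k : ℕ} {n : Fin k → ℕ} {f : ∀ i, PosRegular (n i)} {m : Fin k → ℕ} {Q : Set (NCPoly n)}
  {H : Type*} [NormedAddCommGroup H] [InnerProductSpace ℂ H]

theorem isClosed_opSystem :
    @IsClosed _ (wstar (NQ f m Q)) (opSystem f m Q : Set (NQ f m Q →L[ℂ] NQ f m Q)) := by
  rw [opSystem, coe_wstarClosure]
  exact @isClosed_closure _ (wstar _) _

/-- A `w*`-continuous linear map on the operator system is determined by its values at the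
operators `S_α S_β*`. -/
theorem ext_genS {u v : opSystem f m Q →ₗ[ℂ] (H →L[ℂ] H)} (hu : WStarContinuous u)
    (hv : WStarContinuous v) (h : ∀ α β, u (genS f m Q α β) = v (genS f m Q α β)) : u = v := by
  let : TopologicalSpace (NQ f m Q →L[ℂ] NQ f m Q) := wstar _
  let : TopologicalSpace (H →L[ℂ] H) := wstar H
  have : T2Space (H →L[ℂ] H) := t2Space_wstar
  have hcl : IsClosed {X : opSystem f m Q | u X = v X} :=
    isClosed_eq (show Continuous u from hu) (show Continuous v from hv)
  ext1 X
  refine hcl.closure_subset_iff.2 subset_rfl ?_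
  refine closure_subtype.2 (closure_mono ?_ X.2)
  intro Y hY
  have hle : Submodule.span ℂ {T | ∃ α β : Words n,
      T = multiOp (S f m Q) α * ContinuousLinearMap.adjoint (multiOp (S f m Q) β)}
      ≤ (LinearMap.eqLocus u v).map (opSystem f m Q).subtype := by
    refine Submodule.span_le.2 ?_
    rintro _ ⟨α, β, rfl⟩
    exact ⟨genS f m Q α β, h α β, rfl⟩
  exact hle hY

/-- Conjugation by `S_{i,γ}` on the generators of the operator system. -/
theorem conj_genS (i : Fin k) (γ : FreeMonoid (Fin (n i))) (α β : Words n) :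
    wordOp (S f m Q i) γ * (genS f m Q α β : NQ f m Q →L[ℂ] NQ f m Q)
        * ContinuousLinearMap.adjoint (wordOp (S f m Q i) γ)
      = genS f m Q (Function.update α i (γ * α i)) (Function.update β i (γ * β i)) := by
  change wordOp (S f m Q i) γ * (multiOp (S f m Q) α
      * ContinuousLinearMap.adjoint (multiOp (S f m Q) β)) * _ = multiOp _ _
        * ContinuousLinearMap.adjoint (multiOp _ _)
  rw [← wordOp_mul_multiOp (commutingTuples_S f m Q), ← wordOp_mul_multiOp
    (commutingTuples_S f m Q), adjoint_mul_eq, mul_assoc, mul_assoc, mul_assoc]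

theorem conj_mem_opSystem (i : Fin k) (γ : FreeMonoid (Fin (n i)))
    {X : NQ f m Q →L[ℂ] NQ f m Q} (hX : X ∈ opSystem f m Q) :
    wordOp (S f m Q i) γ * X * ContinuousLinearMap.adjoint (wordOp (S f m Q i) γ)
      ∈ opSystem f m Q := by
  let : TopologicalSpace (NQ f m Q →L[ℂ] NQ f m Q) := wstar _
  have hcont := continuous_wstar_conj (wordOp (S f m Q i) γ)
  refine hcont.closure_preimage_subset _ (closure_mono (fun Y hY => ?_) hX)
  rw [Set.mem_preimage]
  induction hY using Submodule.span_induction with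
  | mem Y hY =>
    obtain ⟨α, β, rfl⟩ := hY
    exact Submodule.subset_span ⟨_, _, conj_genS i γ α β⟩
  | zero => simp
  | add Y Z _ _ h1 h2 =>
    rw [mul_add, add_mul]
    exact add_mem h1 h2
  | smul c Y _ h1 =>
    rw [mul_smul_comm, smul_mul_assoc]
    exact Submodule.smul_mem _ c h1

variable [CompleteSpace H] {A : ∀ i, Fin (n i) → H →L[ℂ] H}
  {φ : opSystem f m Q →ₗ[ℂ] (H →L[ℂ] H)}

/-- The maps in `CP^{w*}(A, V_Q)` intertwine conjugation by `S_{i,γ}` and by `A_{i,γ}`. -/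
theorem map_conj (hcomm : CommutingTuples A) (hφ : φ ∈ CPw f m Q A) (i : Fin k)
    (γ : FreeMonoid (Fin (n i))) (X : opSystem f m Q) :
    φ ⟨_, conj_mem_opSystem i γ X.2⟩
      = wordOp (A i) γ * φ X * ContinuousLinearMap.adjoint (wordOp (A i) γ) := by
  let σ : opSystem f m Q →ₗ[ℂ] opSystem f m Q :=
    { toFun := fun X => ⟨_, conj_mem_opSystem i γ X.2⟩
      map_add' := fun X Y => Subtype.ext (by simp [mul_add, add_mul])
      map_smul' := fun c X => Subtype.ext (by simp) }
  let τ : opSystem f m Q →ₗ[ℂ] (H →L[ℂ] H) := (ContinuousLinearMap.mulLeftRight ℂ (H →L[ℂ] H)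
    (wordOp (A i) γ) (ContinuousLinearMap.adjoint (wordOp (A i) γ))).toLinearMap ∘ₗ φ
  have hσ : WStarContinuous (φ ∘ₗ σ) := by
    let : TopologicalSpace (NQ f m Q →L[ℂ] NQ f m Q) := wstar _
    let : TopologicalSpace (H →L[ℂ] H) := wstar H
    have h1 : Continuous σ := continuous_induced_rng.2
      ((continuous_wstar_conj (wordOp (S f m Q i) γ)).comp continuous_induced_dom)
    exact (show Continuous φ from hφ.1).comp h1
  have hτ : WStarContinuous τ := by
    let : TopologicalSpace (NQ f m Q →L[ℂ] NQ f m Q) := wstar _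
    let : TopologicalSpace (H →L[ℂ] H) := wstar H
    exact (continuous_wstar_conj (wordOp (A i) γ)).comp (show Continuous φ from hφ.1)
  have h : φ ∘ₗ σ = τ := ext_genS hσ hτ fun α β => by
    have h1 : σ (genS f m Q α β)
        = genS f m Q (Function.update α i (γ * α i)) (Function.update β i (γ * β i)) :=
      Subtype.ext (conj_genS i γ α β)
    change φ (σ _) = wordOp (A i) γ * φ _ * ContinuousLinearMap.adjoint (wordOp (A i) γ)
    rw [h1, hφ.2.2, hφ.2.2, ← wordOp_mul_multiOp hcomm, ← wordOp_mul_multiOp hcomm,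
      adjoint_mul_eq]
    simp only [mul_assoc]
  exact congrArg (· X) h

/-- The operator system is invariant under `Φ_{f_i,S_i}` on positive operators, and the maps in
`CP^{w*}(A, V_Q)` intertwine `Φ_{f_i,S_i}` and `Φ_{f_i,A_i}`. -/
theorem exists_map_phi (hm : ∀ i, 0 < m i) (hcomm : CommutingTuples A) (hφ : φ ∈ CPw f m Q A)
    (i : Fin k) {X : opSystem f m Q} (hX : 0 ≤ (X : NQ f m Q →L[ℂ] NQ f m Q)) :
    ∃ Y : opSystem f m Q, (Y : NQ f m Q →L[ℂ] NQ f m Q) = Phi (f i) (S f m Q i) X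
      ∧ φ Y = Phi (f i) (A i) (φ X) := by
  let t : FreeMonoid (Fin (n i)) → opSystem f m Q := fun α =>
    ⟨((f i).coeff α : ℂ) • (wordOp (S f m Q i) α * (X : NQ f m Q →L[ℂ] NQ f m Q)
      * ContinuousLinearMap.adjoint (wordOp (S f m Q i) α)),
      Submodule.smul_mem _ _ (conj_mem_opSystem i α X.2)⟩
  have hsum : HasSum (fun α => ContinuousLinearMapWOT.ofCLM (t α : NQ f m Q →L[ℂ] NQ f m Q))
      (ContinuousLinearMapWOT.ofCLM (Phi (f i) (S f m Q i) X)) :=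
    (phi_spec (phiWellDefined_S (Q := Q) hm i) hX).2.1
  have ht0 : ∀ α, 0 ≤ (t α : NQ f m Q →L[ℂ] NQ f m Q) := fun α =>
    smul_conj_nonneg ((f i).coeff_nonneg α) _ hX
  obtain ⟨Y, hY, h⟩ := hφ.1.exists_hasSum_map isClosed_opSystem (t := t) ht0 hsum
  have ht : ∀ α, φ (t α) = ((f i).coeff α : ℂ)
      • (wordOp (A i) α * φ X * ContinuousLinearMap.adjoint (wordOp (A i) α)) := fun α => by
    rw [← map_conj hcomm hφ]
    exact φ.map_smul _ ⟨_, conj_mem_opSystem i α X.2⟩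
  have hA : HasSum (phiTerm (f i) (A i) (φ X)) (ContinuousLinearMapWOT.ofCLM (φ Y)) := by
    simp_rw [ht] at h
    exact h
  exact ⟨Y, hY, by rw [Phi, hA.tsum_eq]⟩

/-- Multi-exponents are built from `0` by raising an entry all of whose predecessors vanish; in
`ψ₁^{p₁} ∘ ⋯ ∘ ψ_k^{p_k}` this is the application of one more factor on the left. -/
theorem exponent_induction {P : (Fin k → ℕ) → Prop} (h0 : P 0)
    (hs : ∀ p i, (∀ j < i, p j = 0) → P p → P (Function.update p i (p i + 1))) (p : Fin k → ℕ) :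
    P p := by
  induction hN : ∑ i, p i using Nat.strong_induction_on generalizing p with
  | _ N ih =>
    by_cases hp : p = 0
    · exact hp ▸ h0
    obtain ⟨i, hi, hmin⟩ := wellFounded_lt.has_min {i | p i ≠ 0} (Function.ne_iff.1 hp)
    have hlt : ∀ j < i, p j = 0 := fun j hj => by_contra fun h => hmin j h hj
    have hlt' : ∑ j, Function.update p i (p i - 1) j < N := by
      rw [← hN]
      refine Finset.sum_lt_sum (fun j _ => ?_) ⟨i, Finset.mem_univ i, ?_⟩
      · by_cases h : j = i
        · subst h
          simp
        · simp [h]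
      · have : p i ≠ 0 := hi
        simp only [Function.update_self]
        omega
    have := hs _ i (fun j hj => by rw [Function.update_of_ne hj.ne, hlt j hj]) (ih _ hlt' _ rfl)
    rwa [Function.update_self, Nat.sub_add_cancel (Nat.pos_of_ne_zero hi), Function.update_idem,
      Function.update_eq_self] at this

omit [CompleteSpace H] in
theorem compIter_update {k : ℕ} (ψ : Fin k → (H →L[ℂ] H) → (H →L[ℂ] H)) (p : Fin k → ℕ)
    (i : Fin k) (hp : ∀ j < i, p j = 0) (X : H →L[ℂ] H) :
    compIter ψ (Function.update p i (p i + 1)) X = ψ i (compIter ψ p X) := by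
  induction k with
  | zero => exact i.elim0
  | succ k ih =>
    rw [compIter_succ, compIter_succ]
    refine Fin.cases (fun _ => ?_) (fun i hp => ?_) i hp
    · rw [Function.update_self, Function.iterate_succ_apply']
      simp
    · have h0 : p 0 = 0 := hp 0 (Fin.succ_pos i)
      rw [Function.update_of_ne (Fin.succ_ne_zero i).symm, h0]
      simp only [Function.iterate_zero, id]
      rw [← ih (fun i => ψ i.succ) (fun i => p i.succ) i
        (fun j hj => hp j.succ (Fin.succ_lt_succ_iff.2 hj))]
      congr 1
      funext j
      by_cases h : j = i
      · subst h
        simp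
      · simp [h]

/-- The defects `Δ^p_{f,S}(I)`, `p ≤ m`, are positive and lie in the operator system, and the maps
in `CP^{w*}(A, V_Q)` send them to the defects of `φ(I)`. The explicit quadratic form is carried
along because it gives the positivity of the next defect. -/
theorem exists_map_defect (hm : ∀ i, 0 < m i) (hcomm : CommutingTuples A)
    (hφ : φ ∈ CPw f m Q A) (p : Fin k → ℕ) (hp : p ≤ m) :
    ∃ Y : opSystem f m Q, 0 ≤ (Y : NQ f m Q →L[ℂ] NQ f m Q)
      ∧ (∀ x, qform (Y : NQ f m Q →L[ℂ] NQ f m Q) x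
        = ∑' β : Words n, (∏ l, bWord (f l) ((m - p) l) (β l))
            * normSqCoord f m (x : Fock n) β)
      ∧ φ Y = defect f A p (φ (unitS f m Q)) := by
  induction p using exponent_induction with
  | h0 =>
    refine ⟨unitS f m Q, zero_le_one (α := NQ f m Q →L[ℂ] NQ f m Q), fun x => ?_, ?_⟩
    · rw [tsub_zero]
      exact qform_one_eq_tsum hm x
    · rw [defect_zero]
  | hs p i hi ih =>
    have hle : p ≤ Function.update p i (p i + 1) := by
      intro j
      by_cases h : j = i
      · subst h
        simp
      · simp [h]
    obtain ⟨X, hX0, hXq, hX⟩ := ih (hle.trans hp)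
    obtain ⟨Y, hY, hY'⟩ := exists_map_phi hm hcomm hφ i hX0
    have hpi : p i + 1 ≤ m i := by simpa using hp i
    have he : (m - p) i = (m i - p i - 1) + 1 := by
      rw [Pi.sub_apply]
      omega
    have hupd : Function.update (m - p) i (m i - p i - 1)
        = m - Function.update p i (p i + 1) := by
      funext j
      by_cases h : j = i
      · subst h
        simp only [Function.update_self, Pi.sub_apply]
        omega
      · simp [h]
    have h := sub_phi_S_spec hm i hX0 he hXq
    rw [hupd, ← hY] at h
    refine ⟨X - Y, h.1, h.2, ?_⟩
    rw [map_sub_submodule, hX, hY', hX, defect, defect, compIter_update _ p i hi]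

/-- The powers `Φ_{f_i,S_i}^s(I)` lie in the operator system, and the maps in `CP^{w*}(A, V_Q)`
send them to `Φ_{f_i,A_i}^s(φ(I))`. -/
theorem exists_map_phi_iterate (hm : ∀ i, 0 < m i) (hcomm : CommutingTuples A)
    (hφ : φ ∈ CPw f m Q A) (i : Fin k) (s : ℕ) :
    ∃ Y : opSystem f m Q, (Y : NQ f m Q →L[ℂ] NQ f m Q) = (Phi (f i) (S f m Q i))^[s] 1
      ∧ φ Y = (Phi (f i) (A i))^[s] (φ (unitS f m Q)) := by
  induction s with
  | zero => exact ⟨unitS f m Q, rfl, rfl⟩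
  | succ s ih =>
    obtain ⟨X, hX, hX'⟩ := ih
    have hX0 : 0 ≤ (X : NQ f m Q →L[ℂ] NQ f m Q) := hX ▸
      (phi_iterate_spec (f := f i) (A := S f m Q i) (phiWellDefined_S hm i)
        (zero_le_one (α := NQ f m Q →L[ℂ] NQ f m Q)) s).1
    obtain ⟨Y, hY, hY'⟩ := exists_map_phi hm hcomm hφ i hX0
    exact ⟨Y, by rw [hY, hX, Function.iterate_succ_apply'],
      by rw [hY', hX', Function.iterate_succ_apply']⟩

/-- For `φ` in `CP^{w*}(A, V_Q)` the operator `φ(I)` inherits positive defects and purity from the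
identity of the model. -/
theorem map_unitS_mem_pureCone (hm : ∀ i, 0 < m i) (hcomm : CommutingTuples A)
    (hφ : φ ∈ CPw f m Q A) : φ (unitS f m Q) ∈ pureCone f m A := by
  refine ⟨hφ.2.1.map_nonneg (zero_le_one (α := NQ f m Q →L[ℂ] NQ f m Q)), fun p hp _ => ?_,
    fun i => ?_⟩
  · obtain ⟨Y, hY0, -, hY⟩ := exists_map_defect hm hcomm hφ p hp
    exact hY ▸ hφ.2.1.map_nonneg hY0
  · choose Y hY hY' using exists_map_phi_iterate hm hcomm hφ i
    have hY0 : ∀ s, 0 ≤ (Y s : NQ f m Q →L[ℂ] NQ f m Q) := fun s => hY s ▸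
      (phi_iterate_spec (f := f i) (A := S f m Q i) (phiWellDefined_S hm i)
        (zero_le_one (α := NQ f m Q →L[ℂ] NQ f m Q)) s).1
    have hq : ∀ s x, qform (Y s : NQ f m Q →L[ℂ] NQ f m Q) x
        ≤ ∑' β : Words n, {β : Words n | s ≤ (β i).length}.indicator
          (fun β => ENNReal.ofReal (‖(x : Fock n) β‖ ^ 2)) β := fun s x =>
      hY s ▸ qform_phi_S_iterate_le hm i s x
    have hbound : ∀ s, ‖(Y s : NQ f m Q →L[ℂ] NQ f m Q)‖
        ≤ ‖(1 : NQ f m Q →L[ℂ] NQ f m Q)‖ := fun s => by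
      refine CStarAlgebra.norm_le_norm_of_nonneg_of_le (hY0 s) (sub_nonneg.1
        (nonneg_of_qform zero_le_one (hY0 s) fun x => (hq s x).trans ?_))
      calc ∑' β : Words n, {β : Words n | s ≤ (β i).length}.indicator
            (fun β => ENNReal.ofReal (‖(x : Fock n) β‖ ^ 2)) β
          ≤ ∑' β : Words n, ENNReal.ofReal (‖(x : Fock n) β‖ ^ 2) :=
            ENNReal.tsum_le_tsum fun β => Set.indicator_le_self _ _ _
        _ = ENNReal.ofReal (‖(x : Fock n)‖ ^ 2) := tsum_ofReal_norm_sq _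
        _ = qform 1 x := (qform_one x).symm
    have hlim := (tendsto_ofCLM_zero_iff_qform hY0).2 fun x =>
      tendsto_of_tendsto_of_tendsto_of_le_of_le tendsto_const_nhds
        (tendsto_tsum_indicator i (x : Fock n)) (fun _ => zero_le) fun s => hq s x
    rw [ContinuousLinearMapWOT.tendsto_iff_forall_inner_apply_tendsto] at hlim
    have hw := tendsto_wstar_of_bounded (X := 0) hbound fun x y => hlim y x
    rw [ContinuousLinearMapWOT.tendsto_iff_forall_inner_apply_tendsto]
    intro x y
    have := hφ.1.tendsto_inner (Z := 0) hw y x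
    rw [map_zero] at this
    exact this.congr fun s => by rw [hY' s]; rfl

end OpSystem

end Polydomain

end

theorem mainTheorem6 {k : ℕ} (n m : Fin k → ℕ) (hn : ∀ i, 0 < n i) (hm : ∀ i, 0 < m i)
    (f : ∀ i, PosRegular (n i)) (Q : Set (NCPoly n)) (hQ : NQ f m Q ≠ ⊥)
    {H : Type*} [NormedAddCommGroup H] [InnerProductSpace ℂ H] [CompleteSpace H]
    (A : ∀ i, Fin (n i) → H →L[ℂ] H) (hcomm : CommutingTuples A)
    (hΦ : ∀ i, PhiWellDefined (f i) (A i)) (hA : ∀ q ∈ Q, polyEval q A = 0) :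
    Set.BijOn (fun φ : opSystem f m Q →ₗ[ℂ] (H →L[ℂ] H) => φ (unitS f m Q))
        (CPw f m Q A) (pureCone f m A) ∧
      ∀ D ∈ pureCone f m A,
        Compatible f m A (defect f A m D) Q ∧
        ∃ K : H →L[ℂ] HTensor (Fock n) (rangeSqrt (defect f A m D)),
          IsBerezinKernel f m A (defect f A m D) K ∧
          ∃ φ ∈ CPw f m Q A, φ (unitS f m Q) = D ∧
            ∀ χ : opSystem f m Q,
              φ χ = berezinTransform (constrainedKernel f m Q (defect f A m D) K)
                (χ : NQ f m Q →L[ℂ] NQ f m Q) := by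
  have hsurj : ∀ D ∈ pureCone f m A,
      ∃ K : H →L[ℂ] HTensor (Fock n) (rangeSqrt (defect f A m D)),
        IsBerezinKernel f m A (defect f A m D) K ∧
        ∃ φ ∈ CPw f m Q A, φ (unitS f m Q) = D ∧
          ∀ χ : opSystem f m Q,
            φ χ = berezinTransform (constrainedKernel f m Q (defect f A m D) K)
              (χ : NQ f m Q →L[ℂ] NQ f m Q) := fun D hD => by
    -- `Γ⁻¹(D)` is the restriction of the Berezin transform on `B(N_Q)` to the operator system
    obtain ⟨K, hK, hKD⟩ := exists_isBerezinKernel hm hΦ hD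
    have h1 := berezinTransform_constrainedKernel_one hcomm hA hK hKD
    refine ⟨K, hK, (berezinL (constrainedKernel f m Q (defect f A m D) K)).toLinearMap ∘ₗ
      (opSystem f m Q).subtype, ⟨wStarContinuous_berezinL _ _, completelyPos_berezinL _ _,
        fun α β => ?_⟩, h1, fun χ => rfl⟩
    change berezinTransform _ (multiOp (S f m Q) α
      * ContinuousLinearMap.adjoint (multiOp (S f m Q) β))
        = multiOp A α * berezinTransform _ 1 * _
    rw [berezinTransform_constrainedKernel_mul hcomm hA hK]
  refine ⟨⟨fun φ hφ => map_unitS_mem_pureCone hm hcomm hφ, fun φ hφ φ' hφ' h => ?_,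
    fun D hD => ?_⟩, fun D hD => ⟨compatible_of_mem_pureCone hm hcomm hΦ hA hD, hsurj D hD⟩⟩
  · refine ext_genS hφ.1 hφ'.1 fun α β => ?_
    have h' : φ (unitS f m Q) = φ' (unitS f m Q) := h
    rw [hφ.2.2, hφ'.2.2, h']
  · obtain ⟨K, -, φ, hφ, hφD, -⟩ := hsurj D hD
    exact ⟨φ, hφ, hφD⟩
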